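/- Let $\Delta$ be a finite simplicial complex and let $\Delta^{(0)}$ denote its set of vertices. Let $v\mapsto x_v\in\mathbb R^d$ be a map from the vertices to $\mathbb R^d$ that is proper: the image of every face with $m\le d$ vertices spans a linear subspace of dimension $m$. For a subcomplex $\Gamma\subseteq\Delta$, let $S_k(\Gamma)$ denote the space of stresses of degree $k$, i.e. of the homogeneous polynomials $p$ of degree $k$ in the real polynomial ring $\mathbb R[\mathbf x]$ with one variable $\mathbf x_v$ for every vertex $v$, such that $f(\partial/\partial \mathbf x)\,p=0$ for every $f$ in the nonface ideal $I_\Gamma$ (the ideal generated by all monomials whose support is not a face of $\Gamma$), and such that $\sum_v (x_v)_i\,\partial p/\partial \mathbf x_v=0$ for $i=1,\dots,d$; put $S_{-1}(\Gamma)=0$. Let $\omega=\sum_v \omega_v\,\partial/\partial \mathbf x_v$ be a linear differential with real coefficients; it maps $S_{k+1}(\Gamma)$ to $S_k(\Gamma)$. The pair $(\Delta,\omega)$ is called weakly toric $k$-chordal if $\omega:S_k(\mathrm{St}_v\Delta)\to S_{k-1}(\mathrm{St}_v\Delta)$ is injective for every vertex $v$ of $\Delta$, and toric $k$-chordal if $\omega:S_{k+1}(\Delta)\to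 S_k(\Delta)$ is surjective and $\omega:S_k(\Delta)\to S_{k-1}(\Delta)$ is injective. Reduced homology $\widetilde H$ and reduced Betti numbers $\widetilde\beta$ are taken with real coefficients; the empty set is a face, of dimension $-1$. The complex $\Delta$ is called resolution $j$-chordal if for every reduced $j$-cycle $z$ of $\Delta$ there is a $(j+1)$-chain $c$ of $\Delta$ with $\partial c=z$ such that the supports of $c$ and $z$ have the same vertices. Let $k\ge 0$ be an integer and assume that $\widetilde H_{k-1}(\mathrm{Lk}_\sigma\Delta)=0$ for every face $\sigma$ of $\Delta$ (including $\sigma=\emptyset$) of cardinality $<d-k$. (1) Suppose that $k\le d$, that $\dim\operatorname{coker}[\omega:S_{k+1}(\Delta)\to S_k(\Delta)]=\alpha$, and that $(\Delta,\omega)$ is weakly toric $k$-chordal. Then $\widetilde\beta_{k-1}(\Delta_W)\le\alpha$ for every $W\subseteq\Delta^{(0)}$, where $\Delta_W$ is the subcomplex of $\Delta$ induced by $W$. (2) If $(\Delta,\omega)$ is toric $k$-chordal, then $\Delta$ is resolution $(k-1)$-chordal, and $\Delta$ has no missing faces of dimension $k$ (a missing face is an inclusion-minimal set of vertices that is not a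 face). -/

import Mathlib

open MvPolynomial

noncomputable section

/-! ## Simplicial complexes

Faces include the empty face: the cardinality conditions below range over `∅`, and the homology
is reduced. (Mathlib's abstract simplicial complexes consist of nonempty faces only.) -/

/-- A finite simplicial complex on a finite ground set `V`: a family of subsets closed under
passing to subsets. Elements of `V` need not be vertices. -/
@[ext]
structure SimplComplex (V : Type*) where
  faces : Set (Finset V)
  down_closed : ∀ σ ∈ faces, ∀ τ : Finset V, τ ⊆ σ → τ ∈ faces

namespace SimplComplex

variable {V : Type*}

/-- The set of vertices. -/
def vertices (Δ : SimplComplex V) : Set V := {v | {v} ∈ Δ.faces}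

/-- The subcomplex induced by a set `W` of vertices. -/
def induced (Δ : SimplComplex V) (W : Finset V) : SimplComplex V where
  faces := {σ | σ ∈ Δ.faces ∧ σ ⊆ W}
  down_closed := fun σ hσ τ hτ => ⟨Δ.down_closed σ hσ.1 τ hτ, hτ.trans hσ.2⟩

/-- The star of `σ`: all subsets of faces containing `σ`. -/
def star (Δ : SimplComplex V) (σ : Finset V) : SimplComplex V where
  faces := {τ | ∃ τ' ∈ Δ.faces, τ ⊆ τ' ∧ σ ⊆ τ'}
  down_closed := by
    rintro ρ ⟨τ', h1, h2, h3⟩ τ hτ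
    exact ⟨τ', h1, hτ.trans h2, h3⟩

/-- The link of `σ`: all differences `τ \ σ` with `σ ⊆ τ` a face. -/
def link [DecidableEq V] (Δ : SimplComplex V) (σ : Finset V) : SimplComplex V where
  faces := {ρ | ∃ τ ∈ Δ.faces, σ ⊆ τ ∧ ρ = τ \ σ}
  down_closed := by
    rintro ρ ⟨τ, h1, h2, rfl⟩ π hπ
    refine ⟨π ∪ σ, Δ.down_closed τ h1 _ ?_, Finset.subset_union_right, ?_⟩
    · exact Finset.union_subset (hπ.trans Finset.sdiff_subset) h2
    · ext v
      have := @hπ v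
      simp only [Finset.mem_sdiff, Finset.mem_union] at this ⊢
      tauto

/-- A missing face: a nonface on the set of vertices, minimal with respect to inclusion. -/
def IsMissingFace (Δ : SimplComplex V) (σ : Finset V) : Prop :=
  (∀ v ∈ σ, v ∈ Δ.vertices) ∧ σ ∉ Δ.faces ∧ ∀ τ : Finset V, τ ⊂ σ → τ ∈ Δ.faces

/-! ## Reduced simplicial homology with real coefficients -/

variable [Fintype V] [LinearOrder V]

/-- The simplicial `j`-chains, as functions on finite subsets of `V` that vanish outside the
`j`-dimensional faces. The empty face has dimension `-1`. -/
def chains (Δ : SimplComplex V) (j : ℤ) : Submodule ℝ (Finset V → ℝ) where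
  carrier := {c | ∀ σ, c σ ≠ 0 → σ ∈ Δ.faces ∧ (σ.card : ℤ) = j + 1}
  zero_mem' := fun σ h => absurd rfl h
  add_mem' := by
    intro a b ha hb σ h
    by_cases h1 : a σ = 0
    · by_cases h2 : b σ = 0
      · exact absurd (by simp [h1, h2]) h
      · exact hb σ h2
    · exact ha σ h1
  smul_mem' := by
    intro r a ha σ h
    refine ha σ fun h0 => h ?_
    simp [h0]

/-- The simplicial boundary operator, with respect to the orientation of simplices given by the
order of `V`: the coefficient of `insert v τ` contributes to the coefficient of `τ` with the sign
`(-1)^i`, where `i` is the position of `v` in `insert v τ`. -/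
def boundary : (Finset V → ℝ) →ₗ[ℝ] (Finset V → ℝ) where
  toFun c := fun τ => ∑ v ∈ Finset.univ \ τ,
    (-1 : ℝ) ^ (τ.filter (fun w => w < v)).card * c (insert v τ)
  map_add' a b := by
    funext τ
    simp [mul_add, Finset.sum_add_distrib]
  map_smul' r a := by
    funext τ
    simp only [Pi.smul_apply, smul_eq_mul, RingHom.id_apply, Finset.mul_sum]
    exact Finset.sum_congr rfl fun v _ => by ring

/-- The reduced simplicial `j`-cycles. -/
def cycles (Δ : SimplComplex V) (j : ℤ) : Submodule ℝ (Finset V → ℝ) :=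
  Δ.chains j ⊓ LinearMap.ker boundary

/-- The simplicial `j`-boundaries. -/
def boundaries (Δ : SimplComplex V) (j : ℤ) : Submodule ℝ (Finset V → ℝ) :=
  (Δ.chains (j + 1)).map boundary

/-- Reduced simplicial homology with real coefficients in dimension `j`. -/
abbrev redHomology (Δ : SimplComplex V) (j : ℤ) : Type _ :=
  Δ.cycles j ⧸ (Δ.boundaries j).submoduleOf (Δ.cycles j)

/-- The reduced Betti number in dimension `j`. -/
def redBetti (Δ : SimplComplex V) (j : ℤ) : ℕ := Module.finrank ℝ (Δ.redHomology j)

/-- The vertices of the support of a chain. -/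
def chainVertices (c : Finset V → ℝ) : Set V := {v | ∃ σ, c σ ≠ 0 ∧ v ∈ σ}

/-- The chain `c` is a resolution of the cycle `z`. -/
def IsResolution (c z : Finset V → ℝ) : Prop :=
  chainVertices c = chainVertices z ∧ boundary c = z

/-- Resolution `j`-chordality: every `j`-cycle has a resolution among the `(j+1)`-chains. -/
def IsResolutionChordal (Δ : SimplComplex V) (j : ℤ) : Prop :=
  ∀ z ∈ Δ.cycles j, ∃ c ∈ Δ.chains (j + 1), IsResolution c z

end SimplComplex

/-! ## Stress spaces -/

section Stress

variable {V : Type*}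

/-- The partial derivative as a linear endomorphism of the polynomial ring. -/
def pd (v : V) : Module.End ℝ (MvPolynomial V ℝ) :=
  (pderiv v : Derivation ℝ (MvPolynomial V ℝ) (MvPolynomial V ℝ)).toLinearMap

theorem pd_commute (u v : V) : Commute (pd u) (pd v) := by
  have h : ⁅(pderiv u : Derivation ℝ (MvPolynomial V ℝ) (MvPolynomial V ℝ)),
      (pderiv v : Derivation ℝ (MvPolynomial V ℝ) (MvPolynomial V ℝ))⁆ = 0 := by
    refine MvPolynomial.derivation_ext fun i => ?_
    classical
    simp [Derivation.commutator_apply, pderiv_X, Pi.single_apply, apply_ite]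
  refine LinearMap.ext fun p => ?_
  have := congrArg (fun D => D p) h
  simp only [Derivation.commutator_apply, Derivation.zero_apply, sub_eq_zero] at this
  exact this

variable [Fintype V]

/-- The differential operator `∏ v, (∂/∂x_v)^(a v)` dual to the monomial `x^a`. -/
def monomialDual (a : V →₀ ℕ) : Module.End ℝ (MvPolynomial V ℝ) :=
  Finset.univ.noncommProd (fun v => pd v ^ a v)
    (fun u _ v _ _ => (pd_commute u v).pow_pow (a u) (a v))

/-- The differential operator `f^∨ = f(d/dx)` dual to a polynomial `f`. -/
def polyDual (f : MvPolynomial V ℝ) : Module.End ℝ (MvPolynomial V ℝ) :=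
  ∑ a ∈ f.support, f.coeff a • monomialDual a

/-- The linear differential `∑ v, a v ∂/∂x_v` dual to the linear form `∑ v, a v x_v`. -/
def linDiff (a : V → ℝ) : Module.End ℝ (MvPolynomial V ℝ) := ∑ v, a v • pd v

theorem linDiff_commute (a b : V → ℝ) : Commute (linDiff a) (linDiff b) := by
  unfold linDiff
  refine Commute.sum_left _ _ _ fun u _ => Commute.sum_right _ _ _ fun v _ => ?_
  exact ((pd_commute u v).smul_left _).smul_right _

theorem linDiff_polyDual_commute (a : V → ℝ) (f : MvPolynomial V ℝ) :
    Commute (linDiff a) (polyDual f) := by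
  unfold linDiff polyDual
  refine Commute.sum_left _ _ _ fun u _ => Commute.sum_right _ _ _ fun m _ => ?_
  refine (Commute.smul_left ?_ _).smul_right _
  exact Finset.noncommProd_commute _ _ _ _ fun v _ => (pd_commute u v).pow_right _

/-- The nonface ideal, generated by the monomials whose support is not a face. -/
def nonfaceIdeal (Δ : SimplComplex V) : Ideal (MvPolynomial V ℝ) :=
  Ideal.span {f | ∃ a : V →₀ ℕ, a.support ∉ Δ.faces ∧ f = monomial a 1}

/-- The stress space of the geometric simplicial complex given by `Δ` and the coordinates `x` of
its vertices in `ℝ^d`: the polynomials annihilated by the dual of the nonface ideal and by the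
differentials `∑ v, x v i ∂/∂x_v` for all coordinates `i`. -/
def stressSpace {d : ℕ} (Δ : SimplComplex V) (x : V → Fin d → ℝ) :
    Submodule ℝ (MvPolynomial V ℝ) where
  carrier := {p | (∀ f ∈ nonfaceIdeal Δ, polyDual f p = 0) ∧
    ∀ i : Fin d, linDiff (fun v => x v i) p = 0}
  zero_mem' := ⟨fun _ _ => map_zero _, fun _ => map_zero _⟩
  add_mem' := fun {p q} hp hq =>
    ⟨fun f hf => by rw [map_add, hp.1 f hf, hq.1 f hf, add_zero],
      fun i => by rw [map_add, hp.2 i, hq.2 i, add_zero]⟩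
  smul_mem' := fun r p hp =>
    ⟨fun f hf => by rw [map_smul, hp.1 f hf, smul_zero],
      fun i => by rw [map_smul, hp.2 i, smul_zero]⟩

/-- The space of stresses of degree `k`. -/
def stress {d : ℕ} (Δ : SimplComplex V) (x : V → Fin d → ℝ) (k : ℕ) :
    Submodule ℝ (MvPolynomial V ℝ) :=
  stressSpace Δ x ⊓ homogeneousSubmodule V ℝ k

theorem linDiff_mem_stress {d : ℕ} (Δ : SimplComplex V) (x : V → Fin d → ℝ) (ω : V → ℝ) (k : ℕ)
    (p : MvPolynomial V ℝ) (hp : p ∈ stress Δ x (k + 1)) : linDiff ω p ∈ stress Δ x k := by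
  obtain ⟨⟨h1, h2⟩, h3⟩ := hp
  refine ⟨⟨fun f hf => ?_, fun i => ?_⟩, ?_⟩
  · have := congrArg (fun D => D p) (linDiff_polyDual_commute ω f).eq
    simp only [Module.End.mul_apply] at this
    rw [← this, h1 f hf, map_zero]
  · have := congrArg (fun D => D p) (linDiff_commute ω (fun v => x v i)).eq
    simp only [Module.End.mul_apply] at this
    rw [← this, h2 i, map_zero]
  · simp only [linDiff, LinearMap.sum_apply, LinearMap.smul_apply]
    refine Submodule.sum_mem _ fun v _ => Submodule.smul_mem _ _ ?_
    have h : (p : MvPolynomial V ℝ).IsHomogeneous (k + 1) := h3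
    have h' : ((pderiv v) p).IsHomogeneous k := by simpa using h.pderiv (i := v)
    exact h'

/-- The map `ω : S_{k+1}(Δ) → S_k(Δ)` induced by a linear differential. -/
def stressMap {d : ℕ} (Δ : SimplComplex V) (x : V → Fin d → ℝ) (ω : V → ℝ) (k : ℕ) :
    stress Δ x (k + 1) →ₗ[ℝ] stress Δ x k :=
  (linDiff ω).restrict (linDiff_mem_stress Δ x ω k)

/-- The dimension of the cokernel of `ω : S_{k+1}(Δ) → S_k(Δ)`. -/
def stressCokerDim {d : ℕ} (Δ : SimplComplex V) (x : V → Fin d → ℝ) (ω : V → ℝ) (k : ℕ) : ℕ :=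
  Module.finrank ℝ (stress Δ x k ⧸ LinearMap.range (stressMap Δ x ω k))

/-- Properness of a geometric simplicial complex in `ℝ^d`: the image of every face with at most `d`
elements spans a linear subspace whose dimension is the number of its elements. -/
def IsProper {d : ℕ} (Δ : SimplComplex V) (x : V → Fin d → ℝ) : Prop :=
  ∀ σ ∈ Δ.faces, σ.card ≤ d →
    Module.finrank ℝ (Submodule.span ℝ (x '' (σ : Set V))) = σ.card

/-- Injectivity of `ω : S_k(Δ) → S_{k-1}(Δ)`. For `k = 0` the target is the zero space, and the
condition says that `S_0(Δ) = 0`, because differentials annihilate constants. -/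
def StressInjective {d : ℕ} (Δ : SimplComplex V) (x : V → Fin d → ℝ) (ω : V → ℝ) (k : ℕ) : Prop :=
  Set.InjOn (linDiff ω) (stress Δ x k : Set (MvPolynomial V ℝ))

/-- Toric `k`-chordality of `(Δ, ω)`. -/
def IsToricChordal {d : ℕ} (Δ : SimplComplex V) (x : V → Fin d → ℝ) (ω : V → ℝ) (k : ℕ) : Prop :=
  Function.Surjective (stressMap Δ x ω k) ∧ StressInjective Δ x ω k

/-- Weak toric `k`-chordality of `(Δ, ω)`. -/
def IsWeaklyToricChordal {d : ℕ} (Δ : SimplComplex V) (x : V → Fin d → ℝ) (ω : V → ℝ) (k : ℕ) :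
    Prop :=
  ∀ v ∈ Δ.vertices, StressInjective (Δ.star {v}) x ω k

end Stress

end

/-! A polynomial is killed by the nonface ideal exactly when all its monomials are supported on
faces. So stresses are the face-supported polynomials annihilated by the coordinate forms, and it
pays to let the set of annihilating linear forms vary (`annStress`).

The bridge to homology is `detChain`: squarefree coefficients weighted by determinants. For k forms
in general position on the faces, it identifies the polynomials of degree k annihilated by them with
the (k-1)-cycles (`exists_detChain_eq`, `eq_zero_of_detChain_eq_zero`). A further form maps degree
k+1 into the boundaries, and onto degree k if the homology vanishes. Vanishing in the links extends
this surjectivity to larger sets of forms (`exists_linDiff_eq_of_isUniform`): a polynomial splits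
into pieces on stars of vertices (`exists_sum_star`), and a star with r+1 forms is equivalent to the
link with r forms (`annStressConeEquiv`).

For (1) with k > 0, let F_0, ..., F_d be generic combinations of the d coordinates and ω. For a
subcomplex X let s_X(r) and t_X(r) be the dimensions, in degrees k and k+1, of the polynomials on X
annihilated by F_0, ..., F_{r-1}. For X = Δ_W, β_{k-1}(X) ≤ s_X(k) - t_X(k) + t_X(k+1) ≤ E(X), where
E(X) = ∑_{k ≤ r ≤ d} s_X(r) - t_X(k); the second inequality uses t_X(d+1) = 0, a consequence of weak
chordality. Adding a vertex does not decrease E: the star of the new vertex contributes at least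
what is lost to its link, because generic forms minimize dimensions
(`finrank_link_le_finrank_star`), and the sum over r telescopes. Hence β_{k-1}(Δ_W) ≤ E(Δ), and
surjectivity collapses E(Δ) to s_Δ(d) - t_Δ(d). Exchanging one form (`finrank_annStress_generic_le`)
bounds this by dim S_k(Δ) - dim S_{k+1}(Δ) ≤ α.

For (2) with 0 < k ≤ d, α = 0 and the stars inherit injectivity, so every induced subcomplex has
vanishing (k-1)-homology. Filling a cycle within its own vertex set gives resolution chordality, and
the boundary of a missing k-face would be a cycle that does not bound
(`isResolutionChordal_of_cycles_le`). If k > d, injectivity alone rules out nonzero (k-1)-cycles. -/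

noncomputable section

/-! ### Stresses as face-supported polynomials annihilated by linear forms -/

section AnnihilatedPolynomials

variable {V : Type*}

/-- The polynomials all of whose monomials are supported on faces. -/
def faceSupported (Δ : SimplComplex V) : Submodule ℝ (MvPolynomial V ℝ) :=
  restrictSupport ℝ {a | a.support ∈ Δ.faces}

theorem mem_faceSupported {Δ : SimplComplex V} {p : MvPolynomial V ℝ} :
    p ∈ faceSupported Δ ↔ ∀ a, coeff a p ≠ 0 → a.support ∈ Δ.faces := by
  rw [faceSupported, mem_restrictSupport_iff]
  simp [Set.subset_def]

theorem monomial_mem_faceSupported {Δ : SimplComplex V} {a : V →₀ ℕ} (r : ℝ)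
    (h : a.support ∈ Δ.faces) : monomial a r ∈ faceSupported Δ :=
  (monomial_mem_restrictSupport ℝ).2 (Or.inl h)

theorem faceSupported_mono {Δ Γ : SimplComplex V} (h : Δ.faces ⊆ Γ.faces) :
    faceSupported Δ ≤ faceSupported Γ := fun _ hp =>
  mem_faceSupported.2 fun a ha => h (mem_faceSupported.1 hp a ha)

theorem mem_faceSupported_of_vars {Δ : SimplComplex V} {p : MvPolynomial V ℝ}
    (h : p.vars ∈ Δ.faces) : p ∈ faceSupported Δ :=
  mem_faceSupported.2 fun _ ha =>
    Δ.down_closed _ h _ (support_subset_vars_of_mem_support (mem_support_iff.2 ha))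

theorem pd_apply (v : V) (p : MvPolynomial V ℝ) : pd v p = pderiv v p := rfl

theorem coeff_pd (v : V) (p : MvPolynomial V ℝ) (m : V →₀ ℕ) :
    coeff m (pd v p) = coeff (m + Finsupp.single v 1) p * (m v + 1) := by
  rw [pd_apply, coeff_pderiv]

theorem isHomogeneous_pd {v : V} {p : MvPolynomial V ℝ} {m : ℕ} (h : p.IsHomogeneous (m + 1)) :
    (pd v p).IsHomogeneous m := by
  have h' : (pderiv v p).IsHomogeneous m := by simpa using h.pderiv (i := v)
  exact h'

theorem coeff_pd_pow (v : V) (n : ℕ) (m : V →₀ ℕ) :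
    ∃ c : ℝ, 0 < c ∧ ∀ p, coeff m ((pd v ^ n) p) = c * coeff (m + Finsupp.single v n) p := by
  induction n generalizing m with
  | zero => exact ⟨1, one_pos, fun p => by simp⟩
  | succ n ih =>
    obtain ⟨c, hc, h⟩ := ih (m + Finsupp.single v 1)
    refine ⟨(m v + 1) * c, by positivity, fun p => ?_⟩
    rw [pow_succ', Module.End.mul_apply, coeff_pd, h, add_assoc, ← Finsupp.single_add, add_comm 1 n]
    ring

theorem pd_mem_faceSupported {Δ : SimplComplex V} {p : MvPolynomial V ℝ} (v : V)
    (h : p ∈ faceSupported Δ) : pd v p ∈ faceSupported Δ := by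
  refine mem_faceSupported.2 fun a ha => ?_
  rw [coeff_pd] at ha
  refine Δ.down_closed _ (mem_faceSupported.1 h _ (left_ne_zero_of_mul ha)) _ ?_
  exact Finsupp.support_mono (by simp)

/-- Only monomials divisible by `X v` survive the derivative, and their supports contain v. -/
theorem pd_mem_faceSupported_star {Δ : SimplComplex V} {p : MvPolynomial V ℝ} (v : V)
    (h : p ∈ faceSupported Δ) : pd v p ∈ faceSupported (Δ.star {v}) := by
  refine mem_faceSupported.2 fun a ha => ?_
  rw [coeff_pd] at ha
  refine ⟨_, mem_faceSupported.1 h _ (left_ne_zero_of_mul ha), Finsupp.support_mono (by simp), ?_⟩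
  simp

variable [Fintype V]

theorem linDiff_apply (a : V → ℝ) (p : MvPolynomial V ℝ) : linDiff a p = ∑ v, a v • pd v p := by
  simp [linDiff]

theorem coeff_linDiff (a : V → ℝ) (p : MvPolynomial V ℝ) (m : V →₀ ℕ) :
    coeff m (linDiff a p) = ∑ v, a v * (coeff (m + Finsupp.single v 1) p * (m v + 1)) := by
  simp [linDiff_apply, coeff_sum, coeff_pd]

theorem isHomogeneous_linDiff {a : V → ℝ} {p : MvPolynomial V ℝ} {m : ℕ}
    (h : p.IsHomogeneous (m + 1)) : (linDiff a p).IsHomogeneous m := by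
  rw [linDiff_apply]
  exact Submodule.sum_mem (homogeneousSubmodule V ℝ m) fun v _ =>
    Submodule.smul_mem _ _ (isHomogeneous_pd h)

theorem linDiff_add (a b : V → ℝ) : linDiff (a + b) = linDiff a + linDiff b := by
  simp [linDiff, add_smul, Finset.sum_add_distrib]

theorem linDiff_smul (r : ℝ) (a : V → ℝ) : linDiff (r • a) = r • linDiff a := by
  simp [linDiff, Finset.smul_sum, smul_smul]

/-- `linDiff` as a linear map. -/
def linDiffHom : (V → ℝ) →ₗ[ℝ] Module.End ℝ (MvPolynomial V ℝ) where
  toFun := linDiff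
  map_add' := linDiff_add
  map_smul' := linDiff_smul

theorem linDiffHom_apply (a : V → ℝ) : linDiffHom a = linDiff a := rfl

theorem linDiff_comm_apply (a b : V → ℝ) (p : MvPolynomial V ℝ) :
    linDiff a (linDiff b p) = linDiff b (linDiff a p) :=
  congrArg (fun D => D p) (linDiff_commute a b).eq

theorem linDiff_single [DecidableEq V] (v : V) : linDiff (Pi.single v (1 : ℝ)) = pd v := by
  simp [linDiff, Pi.single_apply]

theorem linDiff_pd_comm (a : V → ℝ) (v : V) (p : MvPolynomial V ℝ) :
    linDiff a (pd v p) = pd v (linDiff a p) := by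
  classical
  rw [← linDiff_single, linDiff_comm_apply]

theorem linDiff_mul (a : V → ℝ) (p q : MvPolynomial V ℝ) :
    linDiff a (p * q) = p * linDiff a q + q * linDiff a p := by
  simp only [linDiff_apply, pd_apply, Derivation.leibniz, smul_eq_mul, smul_add,
    Finset.sum_add_distrib, Finset.mul_sum, mul_smul_comm]

theorem linDiff_X (a : V → ℝ) (v : V) : linDiff a (X v) = C (a v) := by
  classical
  simp only [linDiff_apply, pd_apply, pderiv_X, Pi.single_apply]
  simp [smul_eq_C_mul]

theorem linDiff_C (a : V → ℝ) (r : ℝ) : linDiff a (C r) = 0 := by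
  simp [linDiff_apply, pd_apply]

theorem linDiff_pow (a : V → ℝ) (p : MvPolynomial V ℝ) (n : ℕ) :
    linDiff a (p ^ (n + 1)) = C ((n : ℝ) + 1) * p ^ n * linDiff a p := by
  induction n with
  | zero => simp
  | succ n ih =>
    rw [pow_succ, linDiff_mul, ih]
    simp only [Nat.cast_add, Nat.cast_one, map_add, map_one]
    ring

theorem linDiff_mem_faceSupported {Δ : SimplComplex V} {p : MvPolynomial V ℝ} (a : V → ℝ)
    (h : p ∈ faceSupported Δ) : linDiff a p ∈ faceSupported Δ := by
  rw [linDiff_apply]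
  exact Submodule.sum_mem _ fun v _ => Submodule.smul_mem _ _ (pd_mem_faceSupported v h)

/-- The constant depends on the exponents alone, so killing p by a dual monomial amounts to the
vanishing of the coefficients of p at all multiples of that monomial. -/
theorem coeff_monomialDual (a m : V →₀ ℕ) :
    ∃ c : ℝ, 0 < c ∧ ∀ p, coeff m (monomialDual a p) = c * coeff (m + a) p := by
  classical
  have key : ∀ (s : Finset V) (m : V →₀ ℕ), ∃ c : ℝ, 0 < c ∧
      ∀ (h : (s : Set V).Pairwise (Function.onFun Commute fun v => pd v ^ a v)) p,
      coeff m (s.noncommProd (fun v => pd v ^ a v) h p) =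
      c * coeff (m + ∑ v ∈ s, Finsupp.single v (a v)) p := by
    intro s
    induction s using Finset.induction_on with
    | empty => exact fun m => ⟨1, one_pos, fun _ p => by simp⟩
    | insert v s hv ih =>
      intro m
      obtain ⟨c, hc, h⟩ := coeff_pd_pow v (a v) m
      obtain ⟨c', hc', h'⟩ := ih (m + Finsupp.single v (a v))
      refine ⟨c * c', by positivity, fun _ p => ?_⟩
      rw [Finset.noncommProd_insert_of_notMem _ _ _ _ hv, Module.End.mul_apply, h, h',
        Finset.sum_insert hv, add_assoc]
      ring
  obtain ⟨c, hc, h⟩ := key Finset.univ m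
  refine ⟨c, hc, fun p => ?_⟩
  have : ∑ v, Finsupp.single v (a v) = a := Finsupp.univ_sum_single a
  rw [this] at h
  exact h _ p

theorem forall_polyDual_eq_zero_iff {Δ : SimplComplex V} {p : MvPolynomial V ℝ} :
    (∀ f ∈ nonfaceIdeal Δ, polyDual f p = 0) ↔ p ∈ faceSupported Δ := by
  constructor
  · intro h
    refine mem_faceSupported.2 fun a ha => by_contra fun hface => ha ?_
    have h1 := h (monomial a 1) (Ideal.subset_span ⟨a, hface, rfl⟩)
    have h2 : polyDual (monomial a (1 : ℝ)) = monomialDual a := by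
      classical
      simp [polyDual, support_monomial]
    rw [h2] at h1
    -- The constant term of the derivative along the exponent a isolates the coefficient of p at a.
    obtain ⟨c, hc, hm⟩ := coeff_monomialDual a 0
    have := hm p
    rw [h1, coeff_zero, zero_add] at this
    exact (mul_eq_zero.1 this.symm).resolve_left hc.ne'
  · intro h f hf
    have hset : {f : MvPolynomial V ℝ | ∃ a : V →₀ ℕ, a.support ∉ Δ.faces ∧ f = monomial a 1} =
        (fun a => monomial a (1 : ℝ)) '' {a | a.support ∉ Δ.faces} := by
      ext g
      simp [eq_comm]
    rw [nonfaceIdeal, hset, mem_ideal_span_monomial_image] at hf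
    rw [polyDual, LinearMap.sum_apply]
    refine Finset.sum_eq_zero fun a ha => ?_
    rw [LinearMap.smul_apply]
    obtain ⟨b, hb, hba⟩ := hf a ha
    have : monomialDual a p = 0 := by
      ext m
      obtain ⟨c, hc, hm⟩ := coeff_monomialDual a m
      rw [hm, coeff_zero]
      by_contra hne
      refine hb (Δ.down_closed _ (mem_faceSupported.1 h _ (right_ne_zero_of_mul hne)) _ ?_)
      exact Finsupp.support_mono (hba.trans (by simp))
    rw [this, smul_zero]

/-- The homogeneous polynomials of degree `m` supported on faces of `Δ` that are annihilated by
the linear differentials with coefficients in `A`. -/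
def annStress (Δ : SimplComplex V) (A : Set (V → ℝ)) (m : ℕ) : Submodule ℝ (MvPolynomial V ℝ) :=
  faceSupported Δ ⊓ homogeneousSubmodule V ℝ m ⊓ ⨅ a ∈ A, LinearMap.ker (linDiff a)

theorem mem_annStress {Δ : SimplComplex V} {A : Set (V → ℝ)} {m : ℕ} {p : MvPolynomial V ℝ} :
    p ∈ annStress Δ A m ↔
      p ∈ faceSupported Δ ∧ p.IsHomogeneous m ∧ ∀ a ∈ A, linDiff a p = 0 := by
  simp [annStress, and_assoc]

instance (Δ : SimplComplex V) (A : Set (V → ℝ)) (m : ℕ) :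
    FiniteDimensional ℝ (annStress Δ A m) := by
  have : FiniteDimensional ℝ (homogeneousSubmodule V ℝ m) :=
    Module.Finite.iff_fg.2 (homogeneousSubmodule_fg _ _ m)
  exact Submodule.finiteDimensional_of_le (inf_le_left.trans inf_le_right :
    annStress Δ A m ≤ homogeneousSubmodule V ℝ m)

theorem stress_eq_annStress {d : ℕ} (Δ : SimplComplex V) (x : V → Fin d → ℝ) (k : ℕ) :
    stress Δ x k = annStress Δ (Set.range fun i v => x v i) k := by
  ext p
  rw [mem_annStress, ← forall_polyDual_eq_zero_iff]
  simp only [stress, stressSpace, Submodule.mem_inf, Submodule.mem_mk, AddSubmonoid.mem_mk,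
    Set.forall_mem_range]
  exact ⟨fun h => ⟨h.1.1, h.2, h.1.2⟩, fun h => ⟨⟨h.1, h.2.2⟩, h.2.1⟩⟩

theorem annStress_mono {Δ Γ : SimplComplex V} {A B : Set (V → ℝ)} (h : Δ.faces ⊆ Γ.faces)
    (hAB : B ⊆ A) (m : ℕ) : annStress Δ A m ≤ annStress Γ B m := fun _ hp =>
  have hp := mem_annStress.1 hp
  mem_annStress.2 ⟨faceSupported_mono h hp.1, hp.2.1, fun a ha => hp.2.2 a (hAB ha)⟩

theorem linDiff_eq_zero_of_mem_span {A : Set (V → ℝ)} {p : MvPolynomial V ℝ}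
    (h : ∀ a ∈ A, linDiff a p = 0) {b : V → ℝ} (hb : b ∈ Submodule.span ℝ A) :
    linDiff b p = 0 := by
  have : Submodule.span ℝ A ≤ LinearMap.ker ((LinearMap.applyₗ p).comp linDiffHom) :=
    Submodule.span_le.2 fun a ha => h a ha
  exact this hb

theorem annStress_le_of_subset_span {Δ : SimplComplex V} {A B : Set (V → ℝ)} (m : ℕ)
    (h : B ⊆ Submodule.span ℝ A) : annStress Δ A m ≤ annStress Δ B m := fun _ hp =>
  have hp := mem_annStress.1 hp
  mem_annStress.2 ⟨hp.1, hp.2.1, fun _ hb => linDiff_eq_zero_of_mem_span hp.2.2 (h hb)⟩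

theorem linDiff_mem_annStress {Δ : SimplComplex V} {A : Set (V → ℝ)} {m : ℕ}
    {p : MvPolynomial V ℝ} (g : V → ℝ) (hp : p ∈ annStress Δ A (m + 1)) :
    linDiff g p ∈ annStress Δ A m := by
  have hp := mem_annStress.1 hp
  refine mem_annStress.2 ⟨linDiff_mem_faceSupported g hp.1, isHomogeneous_linDiff hp.2.1,
    fun a ha => ?_⟩
  rw [linDiff_comm_apply, hp.2.2 a ha, map_zero]

theorem pd_mem_annStress_star {Δ : SimplComplex V} {A : Set (V → ℝ)} {m : ℕ}
    {p : MvPolynomial V ℝ} (v : V) (hp : p ∈ annStress Δ A (m + 1)) :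
    pd v p ∈ annStress (Δ.star {v}) A m := by
  have hp := mem_annStress.1 hp
  refine mem_annStress.2 ⟨pd_mem_faceSupported_star v hp.1, isHomogeneous_pd hp.2.1,
    fun a ha => ?_⟩
  rw [linDiff_pd_comm, hp.2.2 a ha, map_zero]

/-- A homogeneous polynomial of positive degree with vanishing partial derivatives is zero. -/
theorem eq_zero_of_pd_eq_zero {p : MvPolynomial V ℝ} {m : ℕ} (hp : p.IsHomogeneous (m + 1))
    (h : ∀ v, pd v p = 0) : p = 0 := by
  have h1 := hp.sum_X_mul_pderiv
  have h2 : ∀ v, pderiv v p = 0 := h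
  simp only [h2, mul_zero, Finset.sum_const_zero] at h1
  exact (smul_eq_zero.1 h1.symm).resolve_left (Nat.succ_ne_zero m)

end AnnihilatedPolynomials

/-! ### Coning: stars and links -/

section Cone

variable {V : Type*}

/-- The substitution `X v ↦ X v - c v * X u`. -/
def shear (u : V) (c : V → ℝ) : MvPolynomial V ℝ →ₐ[ℝ] MvPolynomial V ℝ :=
  bind₁ fun v => X v - C (c v) * X u

theorem shear_X (u : V) (c : V → ℝ) (v : V) : shear u c (X v) = X v - C (c v) * X u := by
  simp [shear]

theorem shear_neg_shear {u : V} {c : V → ℝ} (hc : c u = 0) (p : MvPolynomial V ℝ) :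
    shear u (-c) (shear u c p) = p := by
  have : (shear u (-c)).comp (shear u c) = AlgHom.id ℝ _ := by
    refine MvPolynomial.algHom_ext fun v => ?_
    simp [shear_X, hc, algHom_C]
  exact congrArg (fun f => f p) this

theorem isHomogeneous_shear {u : V} (c : V → ℝ) {p : MvPolynomial V ℝ} {m : ℕ}
    (hp : p.IsHomogeneous m) : (shear u c p).IsHomogeneous m := by
  have := hp.aeval (S := ℝ) (fun v => X v - C (c v) * X u) (n := 1)
    fun v => (isHomogeneous_X _ _).sub (isHomogeneous_C_mul_X _ _)
  rwa [one_mul] at this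

/-- The substitution enlarges supports by u at most, which is harmless in a cone with apex u. -/
theorem shear_mem_faceSupported_star [DecidableEq V] {Δ : SimplComplex V} {u : V} (c : V → ℝ)
    {p : MvPolynomial V ℝ} (hp : p ∈ faceSupported (Δ.star {u})) :
    shear u c p ∈ faceSupported (Δ.star {u}) := by
  rw [p.as_sum, map_sum]
  refine Submodule.sum_mem _ fun a ha => mem_faceSupported_of_vars ?_
  obtain ⟨τ, hτ, h1, h2⟩ := mem_faceSupported.1 hp a (mem_support_iff.1 ha)
  refine ⟨τ, hτ, (vars_bind₁ _ _).trans (Finset.biUnion_subset.2 fun v hv => ?_), h2⟩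
  rw [vars_monomial (mem_support_iff.1 ha)] at hv
  refine (vars_sub_subset _).trans (Finset.union_subset ?_ ((vars_mul _ _).trans ?_))
  · rw [vars_X]; simpa using h1 hv
  · rw [vars_C, vars_X]; simpa using h2

theorem faceSupported_link_le_star [DecidableEq V] {Δ : SimplComplex V} {u : V} :
    faceSupported (Δ.link {u}) ≤ faceSupported (Δ.star {u}) := by
  refine faceSupported_mono ?_
  rintro _ ⟨τ, hτ, h, rfl⟩
  exact ⟨τ, hτ, Finset.sdiff_subset, h⟩

theorem pd_eq_zero_of_mem_link [DecidableEq V] {Δ : SimplComplex V} {u : V}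
    {p : MvPolynomial V ℝ} (hp : p ∈ faceSupported (Δ.link {u})) : pd u p = 0 := by
  ext m
  rw [coeff_pd, coeff_zero]
  by_contra hne
  obtain ⟨τ, -, -, h⟩ := mem_faceSupported.1 hp _ (left_ne_zero_of_mul hne)
  have : u ∈ τ \ {u} := by rw [← h]; simp
  simp at this

theorem mem_link_of_pd_eq_zero [DecidableEq V] {Δ : SimplComplex V} {u : V}
    {p : MvPolynomial V ℝ} (hp : p ∈ faceSupported (Δ.star {u})) (h0 : pd u p = 0) :
    p ∈ faceSupported (Δ.link {u}) := by
  refine mem_faceSupported.2 fun a ha => ?_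
  obtain ⟨τ, hτ, h1, h2⟩ := mem_faceSupported.1 hp a ha
  have hu : u ∉ a.support := by
    intro hu
    have hle : Finsupp.single u 1 ≤ a := by
      rw [Finsupp.single_le_iff]
      exact Nat.one_le_iff_ne_zero.2 (Finsupp.mem_support_iff.1 hu)
    have h := congrArg (coeff (a - Finsupp.single u 1)) h0
    rw [coeff_pd, tsub_add_cancel_of_le hle, coeff_zero] at h
    rcases mul_eq_zero.1 h with h | h
    · exact ha h
    · exact absurd h (by positivity)
  refine (Δ.link {u}).down_closed (τ \ {u}) ⟨τ, hτ, h2, rfl⟩ _ fun v hv => ?_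
  rw [Finset.mem_sdiff, Finset.mem_singleton]
  exact ⟨h1 hv, fun h => hu (h ▸ hv)⟩

variable [Fintype V]

/-- Chain rule: the substituted variable `X v - c v * X u` has derivative `a v - a u * c v` along
`a`. -/
theorem linDiff_shear (a : V → ℝ) (u : V) (c : V → ℝ) (p : MvPolynomial V ℝ) :
    linDiff a (shear u c p) = shear u c (linDiff (a - a u • c) p) := by
  induction p using MvPolynomial.induction_on with
  | C r => simp [linDiff_C, algHom_C, algebraMap_eq]
  | add p q hp hq => simp only [map_add, hp, hq]
  | mul_X p v hp =>
    rw [map_mul, linDiff_mul, linDiff_mul, hp, map_add, map_mul, map_mul, linDiff_X, shear_X,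
      map_sub, linDiff_mul, linDiff_X, linDiff_C, linDiff_X, algHom_C, algebraMap_eq]
    simp only [Pi.sub_apply, Pi.smul_apply, smul_eq_mul, map_sub, map_mul]
    ring

/-- The linear form obtained from `a` by subtracting the multiple of `θ` with the same value
at `u`. -/
def eliminate (θ : V → ℝ) (u : V) (a : V → ℝ) : V → ℝ := a - (a u / θ u) • θ

variable [DecidableEq V]

/-- The coefficients of the shear that turns `linDiff θ` into a multiple of `pd u`. -/
def shearCoeff (θ : V → ℝ) (u : V) : V → ℝ := Function.update ((θ u)⁻¹ • θ) u 0

omit [Fintype V] in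
theorem shearCoeff_self (θ : V → ℝ) (u : V) : shearCoeff θ u u = 0 := by simp [shearCoeff]

omit [Fintype V] in
theorem sub_smul_shearCoeff {θ : V → ℝ} {u : V} (hθ : θ u ≠ 0) (a : V → ℝ) :
    a - a u • shearCoeff θ u = eliminate θ u a + a u • Pi.single u 1 := by
  funext v
  by_cases h : v = u
  · subst h; simp [shearCoeff, eliminate, hθ]
  · simp [shearCoeff, eliminate, h]; ring

theorem linDiff_shear_of_pd_eq_zero {θ : V → ℝ} {u : V} (hθ : θ u ≠ 0) (a : V → ℝ)
    {p : MvPolynomial V ℝ} (hp : pd u p = 0) :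
    linDiff a (shear u (shearCoeff θ u) p) =
      shear u (shearCoeff θ u) (linDiff (eliminate θ u a) p) := by
  rw [linDiff_shear, sub_smul_shearCoeff hθ, linDiff_add, linDiff_smul, linDiff_single]
  simp [hp]

theorem linDiff_self_shear {θ : V → ℝ} {u : V} (hθ : θ u ≠ 0) (p : MvPolynomial V ℝ) :
    linDiff θ (shear u (shearCoeff θ u) p) = θ u • shear u (shearCoeff θ u) (pd u p) := by
  rw [linDiff_shear, sub_smul_shearCoeff hθ, linDiff_add, linDiff_smul, linDiff_single]
  have : eliminate θ u θ = 0 := by simp [eliminate, hθ]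
  rw [this, ← linDiffHom_apply 0, map_zero]
  simp

variable {Δ : SimplComplex V} {A : Set (V → ℝ)} {θ : V → ℝ} {u : V} {m : ℕ}
  {p : MvPolynomial V ℝ}

theorem shear_mem_annStress (hθ : θ u ≠ 0) (hp : p ∈ annStress (Δ.link {u}) (eliminate θ u '' A) m) :
    shear u (shearCoeff θ u) p ∈ annStress (Δ.star {u}) A m := by
  have hp := mem_annStress.1 hp
  refine mem_annStress.2 ⟨shear_mem_faceSupported_star _ (faceSupported_link_le_star hp.1),
    isHomogeneous_shear _ hp.2.1, fun a ha => ?_⟩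
  rw [linDiff_shear_of_pd_eq_zero hθ a (pd_eq_zero_of_mem_link hp.1),
    hp.2.2 _ (Set.mem_image_of_mem _ ha), map_zero]

omit [Fintype V] in
theorem shear_shear_neg (p : MvPolynomial V ℝ) :
    shear u (shearCoeff θ u) (shear u (-shearCoeff θ u) p) = p := by
  have := shear_neg_shear (u := u) (c := -shearCoeff θ u) (by simp [shearCoeff_self]) p
  rwa [neg_neg] at this

/-- After the shear, θ acts as a nonzero multiple of the derivative by the apex variable.
Annihilation by θ therefore says that the sheared polynomial does not involve the apex, and so lives
on the base of the cone. -/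
theorem shear_neg_mem_annStress (hA : θ ∈ A) (hθ : θ u ≠ 0)
    (hp : p ∈ annStress (Δ.star {u}) A m) :
    shear u (-shearCoeff θ u) p ∈ annStress (Δ.link {u}) (eliminate θ u '' A) m := by
  have hp := mem_annStress.1 hp
  set q := shear u (-shearCoeff θ u) p with hq
  have hqp : shear u (shearCoeff θ u) q = p := shear_shear_neg p
  have hinj : Function.Injective (shear u (shearCoeff θ u)) :=
    Function.LeftInverse.injective (shear_neg_shear (shearCoeff_self θ u))
  have h0 : pd u q = 0 := by
    have h := linDiff_self_shear hθ q
    rw [hqp, hp.2.2 θ hA] at h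
    refine hinj ?_
    rw [map_zero]
    exact (smul_eq_zero.1 h.symm).resolve_left hθ
  refine mem_annStress.2 ⟨mem_link_of_pd_eq_zero (shear_mem_faceSupported_star _ hp.1) h0,
    isHomogeneous_shear _ hp.2.1, ?_⟩
  rintro _ ⟨a, ha, rfl⟩
  refine hinj ?_
  rw [← linDiff_shear_of_pd_eq_zero hθ a h0, hqp, hp.2.2 a ha, map_zero]

/-- Coning: the polynomials on the star are isomorphic to those on the link. -/
def annStressConeEquiv (hA : θ ∈ A) (hθ : θ u ≠ 0) :
    annStress (Δ.link {u}) (eliminate θ u '' A) m ≃ₗ[ℝ] annStress (Δ.star {u}) A m :=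
  LinearEquiv.ofLinearMap
    ((shear u (shearCoeff θ u)).toLinearMap.restrict fun _ hp => shear_mem_annStress hθ hp)
    ((shear u (-shearCoeff θ u)).toLinearMap.restrict fun _ hp => shear_neg_mem_annStress hA hθ hp)
    (by ext p : 2; exact shear_shear_neg _)
    (by ext p : 2; exact shear_neg_shear (shearCoeff_self θ u) _)

theorem finrank_annStress_star (hA : θ ∈ A) (hθ : θ u ≠ 0) :
    Module.finrank ℝ (annStress (Δ.star {u}) A m) =
      Module.finrank ℝ (annStress (Δ.link {u}) (eliminate θ u '' A) m) :=
  (annStressConeEquiv hA hθ).finrank_eq.symm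

/-- Surjectivity of a linear differential on the star follows from surjectivity on the link. -/
theorem exists_linDiff_eq_star (hA : θ ∈ A) (hθ : θ u ≠ 0) {g : V → ℝ}
    (h : ∀ q ∈ annStress (Δ.link {u}) (eliminate θ u '' A) m,
      ∃ r ∈ annStress (Δ.link {u}) (eliminate θ u '' A) (m + 1),
        linDiff (eliminate θ u g) r = q)
    (hp : p ∈ annStress (Δ.star {u}) A m) :
    ∃ r ∈ annStress (Δ.star {u}) A (m + 1), linDiff g r = p := by
  obtain ⟨r, hr, hrq⟩ := h _ (shear_neg_mem_annStress hA hθ hp)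
  refine ⟨_, shear_mem_annStress hθ hr, ?_⟩
  rw [linDiff_shear_of_pd_eq_zero hθ g (pd_eq_zero_of_mem_link (mem_annStress.1 hr).1), hrq,
    shear_shear_neg]

omit [Fintype V] in
theorem exists_pd_eq_star (hp : p ∈ faceSupported (Δ.star {u})) (hm : p.IsHomogeneous m) :
    ∃ r ∈ faceSupported (Δ.star {u}), r.IsHomogeneous (m + 1) ∧ pd u r = p := by
  -- Termwise antiderivative with respect to `X u`.
  refine ⟨∑ a ∈ p.support, monomial (a + Finsupp.single u 1) (coeff a p / (a u + 1)), ?_, ?_, ?_⟩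
  · refine Submodule.sum_mem _ fun a ha => monomial_mem_faceSupported _ ?_
    obtain ⟨τ, hτ, h1, h2⟩ := mem_faceSupported.1 hp a (mem_support_iff.1 ha)
    refine ⟨τ, hτ, Finsupp.support_add.trans (Finset.union_subset h1 ?_), h2⟩
    exact Finsupp.support_single_subset.trans h2
  · refine IsHomogeneous.sum _ _ _ fun a ha => isHomogeneous_monomial _ ?_
    have hdeg : a.degree = m := by_contra fun h => mem_support_iff.1 ha (hm.coeff_eq_zero h)
    rw [map_add, hdeg, Finsupp.degree_single]
  · rw [map_sum]
    conv_rhs => rw [p.as_sum]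
    refine Finset.sum_congr rfl fun a ha => ?_
    rw [pd_apply, pderiv_monomial, add_tsub_cancel_right]
    congr 1
    have : (a u : ℝ) + 1 ≠ 0 := by positivity
    simp [this]

/-- Without annihilation conditions, a linear differential is surjective on the star of a vertex
where it does not vanish. -/
theorem exists_linDiff_eq_star_of_empty {g : V → ℝ} (hg : g u ≠ 0)
    (hp : p ∈ annStress (Δ.star {u}) ∅ m) :
    ∃ r ∈ annStress (Δ.star {u}) ∅ (m + 1), linDiff g r = p := by
  have hp := mem_annStress.1 hp
  obtain ⟨r, hr, hrm, hrp⟩ := exists_pd_eq_star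
    (shear_mem_faceSupported_star (-shearCoeff g u) hp.1) (isHomogeneous_shear _ hp.2.1)
  refine ⟨(g u)⁻¹ • shear u (shearCoeff g u) r, ?_, ?_⟩
  · refine Submodule.smul_mem _ _ (mem_annStress.2
      ⟨shear_mem_faceSupported_star _ hr, isHomogeneous_shear _ hrm, by simp⟩)
  · rw [map_smul, linDiff_self_shear hg, hrp, shear_shear_neg, smul_smul, inv_mul_cancel₀ hg,
      one_smul]

end Cone

/-! ### Splitting polynomials over vertex stars -/

section Trace

variable {V : Type*} [Fintype V] {ι : Type*} [DecidableEq ι]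

omit [Fintype V] in
theorem X_mul_pd_mem_star {Δ : SimplComplex V} {p : MvPolynomial V ℝ} (v : V)
    (h : p ∈ faceSupported Δ) : X v * pd v p ∈ faceSupported (Δ.star {v}) := by
  classical
  refine mem_faceSupported.2 fun a ha => ?_
  rw [mul_comm, coeff_mul_X'] at ha
  split_ifs at ha with hv
  · have hle : Finsupp.single v 1 ≤ a := by
      rw [Finsupp.single_le_iff]
      exact Nat.one_le_iff_ne_zero.2 (Finsupp.mem_support_iff.1 hv)
    rw [coeff_pd, tsub_add_cancel_of_le hle] at ha
    exact ⟨_, mem_faceSupported.1 h _ (left_ne_zero_of_mul ha), subset_rfl, by simpa using hv⟩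
  · exact absurd rfl ha

/-- If each form is surjective on the polynomials annihilated by the other ones, then the
polynomials annihilated by all forms are sums of such polynomials on the stars of vertices. -/
theorem exists_sum_star {Δ : SimplComplex V} (a : ι → V → ℝ) (I : Finset ι) {k : ℕ}
    (hk : I.card ≠ k)
    (hsurj : ∀ i ∈ I, ∀ s ∈ annStress Δ (a '' (I.erase i : Set ι)) k,
      ∃ p ∈ annStress Δ (a '' (I.erase i : Set ι)) (k + 1), linDiff (a i) p = s)
    {s : MvPolynomial V ℝ} (hs : s ∈ annStress Δ (a '' (I : Set ι)) k) :
    ∃ t : V → MvPolynomial V ℝ, (∀ v, t v ∈ annStress (Δ.star {v}) (a '' (I : Set ι)) k) ∧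
      s = ∑ v, t v := by
  have hp : ∀ i : ι, ∃ p : MvPolynomial V ℝ, i ∈ I →
      p ∈ annStress Δ (a '' (I.erase i : Set ι)) (k + 1) ∧ linDiff (a i) p = s := by
    intro i
    by_cases hi : i ∈ I
    · obtain ⟨p, hp⟩ := hsurj i hi s
        (annStress_mono subset_rfl (Set.image_mono (by simp)) k hs)
      exact ⟨p, fun _ => hp⟩
    · exact ⟨0, fun h => absurd h hi⟩
  choose p hp using hp
  have hs' := mem_annStress.1 hs
  have hdiff : ∀ i ∈ I, ∀ j ∈ I, linDiff (a j) (p i) = if j = i then s else 0 := by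
    intro i hi j hj
    split_ifs with h
    · rw [h]; exact (hp i hi).2
    · exact (mem_annStress.1 (hp i hi).1).2.2 _ (Set.mem_image_of_mem _ (by simp [h, hj]))
  -- Both terms live on the star of v. The j-th form sends each of them to `a j v` times the
  -- derivative of s by v, so it kills their difference.
  set u : V → MvPolynomial V ℝ := fun v =>
    pd v (∑ i ∈ I, a i v • p i) - X v * pd v s with hu
  have hr : ((I.card : ℝ) - k) ≠ 0 := sub_ne_zero.2 (by exact_mod_cast hk)
  refine ⟨fun v => ((I.card : ℝ) - k)⁻¹ • u v, fun v => Submodule.smul_mem _ _ ?_, ?_⟩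
  · have hq : (∑ i ∈ I, a i v • p i) ∈ annStress Δ ∅ (k + 1) :=
      Submodule.sum_mem _ fun i hi => Submodule.smul_mem _ _
        (annStress_mono subset_rfl (by simp) _ (hp i hi).1)
    have hq := mem_annStress.1 hq
    refine mem_annStress.2 ⟨Submodule.sub_mem _ (pd_mem_faceSupported_star v hq.1)
      (X_mul_pd_mem_star v hs'.1), (isHomogeneous_pd hq.2.1).sub ?_, ?_⟩
    · rcases k with _ | k
      · rw [totalDegree_eq_zero_iff_eq_C.1 ((totalDegree_zero_iff_isHomogeneous _).2 hs'.2.1),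
          pd_apply, pderiv_C, mul_zero]
        exact isHomogeneous_zero _ _ _
      · rw [add_comm]
        exact (isHomogeneous_X _ _).mul (isHomogeneous_pd hs'.2.1)
    · rintro _ ⟨j, hj, rfl⟩
      rw [map_sub, linDiff_pd_comm, linDiff_mul, linDiff_pd_comm,
        hs'.2.2 _ (Set.mem_image_of_mem _ hj), linDiff_X, map_sum]
      have : ∑ i ∈ I, linDiff (a j) (a i v • p i) = a j v • s := by
        rw [Finset.sum_eq_single j]
        · rw [map_smul, hdiff j hj j hj, if_pos rfl]
        · intro i hi hij
          rw [map_smul, hdiff i hi j hj, if_neg hij.symm, smul_zero]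
        · exact fun h => absurd hj h
      rw [this, map_smul, map_zero, mul_zero, zero_add, mul_comm, ← smul_eq_C_mul, sub_self]
  -- Summed over v, the first terms recover s once for each form, and by Euler's identity the second
  -- ones give k times s. This is where |I| ≠ k is needed.
  · have h1 : ∑ v, pd v (∑ i ∈ I, a i v • p i) = (I.card : ℝ) • s := by
      have h2 : ∀ v, pd v (∑ i ∈ I, a i v • p i) = ∑ i ∈ I, a i v • pd v (p i) := by
        intro v; rw [map_sum]; simp
      simp only [h2]
      rw [Finset.sum_comm]
      simp only [← linDiff_apply]
      rw [Finset.sum_congr rfl fun i hi => (hp i hi).2, Finset.sum_const, Nat.cast_smul_eq_nsmul]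
    have h3 : ∑ v, X v * pd v s = (k : ℝ) • s := by
      rw [Nat.cast_smul_eq_nsmul]
      exact hs'.2.1.sum_X_mul_pderiv
    rw [← Finset.smul_sum, hu, Finset.sum_sub_distrib, h1, h3, ← sub_smul, smul_smul,
      inv_mul_cancel₀ hr, one_smul]

end Trace

/-! ### Squarefree coefficients and powers of linear forms -/

section Squarefree

variable {V : Type*}

/-- The exponent of the squarefree monomial with support `σ`. -/
def sqfreeExp (σ : Finset V) : V →₀ ℕ := ∑ v ∈ σ, Finsupp.single v 1

variable [DecidableEq V]

theorem sqfreeExp_apply (σ : Finset V) (v : V) : sqfreeExp σ v = if v ∈ σ then 1 else 0 := by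
  simp [sqfreeExp, Finsupp.finsetSum_apply, Finsupp.single_apply]

theorem support_sqfreeExp (σ : Finset V) : (sqfreeExp σ).support = σ := by
  ext v; simp [sqfreeExp_apply]

theorem sqfreeExp_insert {σ : Finset V} {v : V} (hv : v ∉ σ) :
    sqfreeExp (insert v σ) = sqfreeExp σ + Finsupp.single v 1 := by
  rw [sqfreeExp, Finset.sum_insert hv, add_comm, sqfreeExp]

theorem eq_sqfreeExp_of_le_one {a : V →₀ ℕ} (h : ∀ v, a v ≤ 1) : a = sqfreeExp a.support := by
  ext v
  rw [sqfreeExp_apply]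
  have := h v
  split_ifs with hv
  · have := Finsupp.mem_support_iff.1 hv; omega
  · exact Finsupp.notMem_support_iff.1 hv

omit [DecidableEq V] in
theorem degree_sqfreeExp (σ : Finset V) : (sqfreeExp σ).degree = σ.card := by
  simp [sqfreeExp, map_sum]

variable [Fintype V]

/-- Take a monomial of p with the largest support. If the exponent of v in it exceeds 1, the support
has fewer than m elements, and some annihilating form restricts on it to the indicator of v. In the
corresponding relation between coefficients, every other term either has factor zero or belongs to a
monomial with larger support, so the chosen coefficient vanishes. Hence the monomial is squarefree.
-/
theorem eq_zero_of_coeff_sqfreeExp {Δ : SimplComplex V} {p : MvPolynomial V ℝ} {m : ℕ}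
    (hp : p ∈ faceSupported Δ) (hm : p.IsHomogeneous m)
    (hsep : ∀ τ ∈ Δ.faces, τ.card < m → ∀ v ∈ τ, ∃ a : V → ℝ, linDiff a p = 0 ∧
      ∀ w ∈ τ, a w = if w = v then 1 else 0)
    (hsq : ∀ σ : Finset V, σ.card = m → coeff (sqfreeExp σ) p = 0) : p = 0 := by
  by_contra hne
  obtain ⟨a, ha, hmax⟩ := Finset.exists_max_image p.support (fun a => a.support.card)
    (support_nonempty.2 hne)
  have ha' := mem_support_iff.1 ha
  have hdeg : a.degree = m := by_contra fun h => ha' (hm.coeff_eq_zero h)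
  by_cases h1 : ∀ v, a v ≤ 1
  · have h2 := eq_sqfreeExp_of_le_one h1
    refine ha' ?_
    rw [h2]
    refine hsq _ ?_
    rw [← degree_sqfreeExp, ← h2, hdeg]
  push Not at h1
  obtain ⟨v, hv⟩ := h1
  have hvs : v ∈ a.support := Finsupp.mem_support_iff.2 (by omega)
  have hcard : a.support.card < m := by
    rw [← hdeg, Finsupp.degree_apply, Finset.card_eq_sum_ones]
    refine Finset.sum_lt_sum (fun w hw => ?_) ⟨v, hvs, hv⟩
    exact Nat.one_le_iff_ne_zero.2 (Finsupp.mem_support_iff.1 hw)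
  obtain ⟨b, hb, hbτ⟩ := hsep _ (mem_faceSupported.1 hp a ha') hcard v hvs
  have hle : Finsupp.single v 1 ≤ a := by rw [Finsupp.single_le_iff]; omega
  have h := congrArg (coeff (a - Finsupp.single v 1)) hb
  rw [coeff_linDiff, coeff_zero, Finset.sum_eq_single v, hbτ v hvs, if_pos rfl,
    tsub_add_cancel_of_le hle, one_mul] at h
  · rcases mul_eq_zero.1 h with h | h
    · exact ha' h
    · exact absurd h (by positivity)
  · intro w _ hwv
    by_cases hw : w ∈ a.support
    · rw [hbτ w hw, if_neg hwv, zero_mul]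
    · have hz : coeff (a - Finsupp.single v 1 + Finsupp.single w 1) p = 0 := by
        by_contra hc
        have h3 := hmax _ (mem_support_iff.2 hc)
        have h4 : insert w a.support ⊆ (a - Finsupp.single v 1 + Finsupp.single w 1).support := by
          intro t ht
          rw [Finsupp.mem_support_iff, Finsupp.add_apply, Finsupp.tsub_apply]
          rcases Finset.mem_insert.1 ht with rfl | ht
          · simp
          · have := Finsupp.mem_support_iff.1 ht
            by_cases htv : t = v
            · subst htv; simp; omega
            · simp [Finsupp.single_apply, Ne.symm htv]; omega
        have h5 := Finset.card_le_card h4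
        rw [Finset.card_insert_of_notMem hw] at h5
        omega
      rw [hz, zero_mul, mul_zero]
  · exact fun h => absurd (Finset.mem_univ _) h

/-- The linear polynomial with given coefficients. -/
def linPoly (c : V → ℝ) : MvPolynomial V ℝ := ∑ v, C (c v) * X v

omit [DecidableEq V] in
theorem linDiff_linPoly (a c : V → ℝ) : linDiff a (linPoly c) = C (∑ v, c v * a v) := by
  simp [linPoly, linDiff_mul, linDiff_X, linDiff_C, map_sum]

omit [DecidableEq V] in
theorem linDiff_linPoly_pow (a c : V → ℝ) (n : ℕ) :
    linDiff a (linPoly c ^ (n + 1)) =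
      (((n : ℝ) + 1) * ∑ v, c v * a v) • linPoly c ^ n := by
  rw [linDiff_pow, linDiff_linPoly, smul_eq_C_mul, map_mul]
  ring

omit [DecidableEq V] in
theorem isHomogeneous_linPoly_pow (c : V → ℝ) (n : ℕ) : (linPoly c ^ n).IsHomogeneous n := by
  have : (linPoly c).IsHomogeneous 1 :=
    IsHomogeneous.sum _ _ _ fun v _ => isHomogeneous_C_mul_X _ _
  simpa using this.pow n

theorem vars_linPoly_pow {c : V → ℝ} {σ : Finset V} (hc : ∀ v ∉ σ, c v = 0) (n : ℕ) :
    (linPoly c ^ n).vars ⊆ σ := by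
  refine (vars_pow _ _).trans ((vars_sum_subset _ _).trans (Finset.biUnion_subset.2 fun v _ => ?_))
  by_cases hv : v ∈ σ
  · refine (vars_mul _ _).trans ?_
    rw [vars_C, vars_X]
    simpa using hv
  · simp [hc v hv]

theorem coeff_sqfreeExp_linPoly_pow (c : V → ℝ) (σ : Finset V) :
    coeff (sqfreeExp σ) (linPoly c ^ σ.card) = σ.card.factorial * ∏ v ∈ σ, c v := by
  induction σ using Finset.induction_on with
  | empty => simp [sqfreeExp]
  | insert v σ hv ih =>
    have h1 := coeff_pd v (linPoly c ^ (σ.card + 1)) (sqfreeExp σ)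
    rw [← sqfreeExp_insert hv, sqfreeExp_apply, if_neg hv, ← linDiff_single, linDiff_linPoly_pow,
      coeff_smul, ih] at h1
    rw [Finset.card_insert_of_notMem hv, Finset.prod_insert hv, Nat.factorial_succ]
    simp [Pi.single_apply] at h1
    rw [← h1]
    push_cast
    ring

theorem coeff_sqfreeExp_linPoly_pow_of_notMem {c : V → ℝ} {σ τ : Finset V}
    (hc : ∀ v ∉ σ, c v = 0) (h : ¬ τ ⊆ σ) (n : ℕ) :
    coeff (sqfreeExp τ) (linPoly c ^ n) = 0 := by
  by_contra hne
  have := support_subset_vars_of_mem_support (mem_support_iff.2 hne)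
  rw [support_sqfreeExp] at this
  exact h (this.trans (vars_linPoly_pow hc n))

end Squarefree

/-! ### Dual covectors and coordinates with respect to independent points -/

section LinearAlgebra

theorem LinearIndependent.exists_dotProduct_eq {ι κ : Type*} [Fintype ι] {y : κ → ι → ℝ}
    (hy : LinearIndependent ℝ y) (f : κ → ℝ) : ∃ c : ι → ℝ, ∀ j, ∑ i, c i * y j i = f j := by
  classical
  obtain ⟨g, hg⟩ := ((Finsupp.linearCombination ℝ f).comp hy.repr).exists_extend
  refine ⟨fun i => g (Pi.single i 1), fun j => ?_⟩
  have h1 : g (y j) = f j := by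
    have h := congrArg (fun φ => φ ⟨y j, Submodule.subset_span ⟨j, rfl⟩⟩) hg
    simp only [LinearMap.comp_apply, Submodule.subtype_apply] at h
    have h2 : hy.repr ⟨y j, Submodule.subset_span ⟨j, rfl⟩⟩ = Finsupp.single j 1 :=
      hy.repr_eq_single j _ rfl
    exact h.trans ((congrArg _ h2).trans (by simp))
  rw [← h1, g.pi_apply_eq_sum_univ (y j)]
  refine Finset.sum_congr rfl fun i _ => ?_
  rw [smul_eq_mul, mul_comm]
  have : (Pi.single i 1 : ι → ℝ) = fun j => if i = j then 1 else 0 := by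
    funext k
    simp [Pi.single_apply, eq_comm]
  rw [← this]

variable {V : Type*} [Fintype V] [DecidableEq V]

omit [Fintype V] [DecidableEq V] in
theorem LinearIndepOn.exists_dotProduct_eq {ι : Type*} [Fintype ι] {y : V → ι → ℝ} {τ : Finset V}
    (hy : LinearIndepOn ℝ y τ) (f : V → ℝ) : ∃ c : ι → ℝ, ∀ v ∈ τ, ∑ i, c i * y v i = f v := by
  obtain ⟨c, hc⟩ := LinearIndependent.exists_dotProduct_eq hy fun v => f v
  exact ⟨c, fun v hv => hc ⟨v, hv⟩⟩

omit [DecidableEq V] in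
theorem exists_sum_smul_eq_of_mem_span {E : Type*} [AddCommGroup E] [Module ℝ E] {y : V → E}
    {τ : Finset V} {o : E} (h : o ∈ Submodule.span ℝ (y '' (τ : Set V))) :
    ∃ c : V → ℝ, (∀ v ∉ τ, c v = 0) ∧ ∑ v, c v • y v = o := by
  classical
  obtain ⟨l, hl, rfl⟩ := (Finsupp.mem_span_image_iff_linearCombination ℝ).1 h
  refine ⟨l, fun v hv => ?_, ?_⟩
  · by_contra hne
    exact hv (hl (Finsupp.mem_support_iff.2 hne))
  · rw [Finsupp.linearCombination_apply, Finsupp.sum_fintype _ _ (by simp)]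

omit [DecidableEq V] in
theorem LinearIndepOn.exists_sum_smul_eq {m : ℕ} {y : V → Fin m → ℝ} {τ : Finset V}
    (hy : LinearIndepOn ℝ y τ) (hτ : τ.card = m) (o : Fin m → ℝ) :
    ∃ c : V → ℝ, (∀ v ∉ τ, c v = 0) ∧ ∑ v, c v • y v = o := by
  refine exists_sum_smul_eq_of_mem_span ?_
  have : Submodule.span ℝ (Set.range fun v : (τ : Set V) => y v) = ⊤ :=
    LinearIndependent.span_eq_top_of_card_eq_finrank' hy (by simp [hτ])
  rw [Set.image_eq_range, this]
  trivial

theorem LinearIndepOn.coeff_ne_zero {E : Type*} [AddCommGroup E] [Module ℝ E] {y : V → E}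
    {τ : Finset V} {o : E} {c : V → ℝ} (hc : ∀ v ∉ τ, c v = 0) (hco : ∑ v, c v • y v = o) {v : V}
    (ho : o ∉ Submodule.span ℝ (y '' (τ.erase v : Set V))) : c v ≠ 0 := by
  intro h0
  refine ho ?_
  rw [← hco]
  refine Submodule.sum_mem _ fun w _ => ?_
  by_cases hw : w ∈ τ.erase v
  · exact Submodule.smul_mem _ _ (Submodule.subset_span ⟨w, hw, rfl⟩)
  · have : c w = 0 := by
      by_cases hwv : w = v
      · rw [hwv, h0]
      · exact hc w fun h => hw (Finset.mem_erase.2 ⟨hwv, h⟩)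
    rw [this, zero_smul]
    exact Submodule.zero_mem _

end LinearAlgebra

/-! ### Determinants and the boundary operator -/

section OrientedDet

variable {V : Type*} [LinearOrder V]

/-- The determinant of the points of `σ`, taken in increasing order; zero if the number of points
is not `m`. -/
def orientedDet {m : ℕ} (y : V → Fin m → ℝ) (σ : Finset V) : ℝ :=
  if h : σ.card = m then (Matrix.of fun i j => y (σ.orderEmbOfFin h j) i).det else 0

/-- The determinant of the point `w` followed by the points of `ρ` in increasing order. -/
def coneDet {m : ℕ} (y : V → Fin (m + 1) → ℝ) (w : Fin (m + 1) → ℝ) (ρ : Finset V) : ℝ :=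
  ∑ i : Fin (m + 1), (-1) ^ (i : ℕ) * w i * orientedDet (fun v j => y v (i.succAbove j)) ρ

theorem orientedDet_of_card_ne {m : ℕ} {y : V → Fin m → ℝ} {σ : Finset V} (h : σ.card ≠ m) :
    orientedDet y σ = 0 := dif_neg h

theorem orientedDet_ne_zero {m : ℕ} {y : V → Fin m → ℝ} {σ : Finset V} (h : σ.card = m)
    (hy : LinearIndepOn ℝ y σ) : orientedDet y σ ≠ 0 := by
  rw [orientedDet, dif_pos h]
  have h1 : LinearIndependent ℝ (fun j => y (σ.orderEmbOfFin h j)) :=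
    LinearIndependent.comp (ι' := Fin m) hy (fun j => ⟨σ.orderEmbOfFin h j, by simp⟩) (by
      intro i j hij
      exact (σ.orderEmbOfFin h).injective (by simpa using hij))
  have h2 := (Matrix.linearIndependent_cols_iff_isUnit
    (A := Matrix.of fun i j => y (σ.orderEmbOfFin h j) i)).1 h1
  exact ((Matrix.isUnit_iff_isUnit_det _).1 h2).ne_zero

theorem exists_orderEmbOfFin_insert {ρ : Finset V} {m : ℕ} (h : ρ.card = m) {v : V}
    (h' : (insert v ρ).card = m + 1) :
    ∃ p : Fin (m + 1), (p : ℕ) = (ρ.filter (fun w => w < v)).card ∧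
      (insert v ρ).orderEmbOfFin h' p = v ∧
      ∀ j, (insert v ρ).orderEmbOfFin h' (p.succAbove j) = ρ.orderEmbOfFin h j := by
  set e := (insert v ρ).orderEmbOfFin h' with he
  obtain ⟨p, hp⟩ : v ∈ Set.range e := by
    rw [he, Finset.range_orderEmbOfFin]; simp
  refine ⟨p, ?_, hp, ?_⟩
  · have : ρ.filter (fun w => w < v) = (Finset.Iio p).map e.toEmbedding := by
      ext w
      simp only [Finset.mem_filter, Finset.mem_map, Finset.mem_Iio, RelEmbedding.coe_toEmbedding]
      constructor
      · rintro ⟨hw, hwv⟩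
        obtain ⟨i, hi⟩ : w ∈ Set.range e := by
          rw [he, Finset.range_orderEmbOfFin]; simp [hw]
        refine ⟨i, ?_, hi⟩
        rw [← e.lt_iff_lt, hi, hp]; exact hwv
      · rintro ⟨i, hi, rfl⟩
        have h1 : e i < v := by rw [← hp, e.lt_iff_lt]; exact hi
        refine ⟨?_, h1⟩
        have h2 : e i ∈ insert v ρ := Finset.orderEmbOfFin_mem _ _ _
        exact (Finset.mem_insert.1 h2).resolve_left h1.ne
    rw [this, Finset.card_map, Fin.card_Iio]
  · have := Finset.orderEmbOfFin_unique h (f := fun j => e (p.succAbove j)) (fun j => ?_) ?_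
    · exact fun j => congrFun this j
    · have h2 : e (p.succAbove j) ∈ insert v ρ := Finset.orderEmbOfFin_mem _ _ _
      refine (Finset.mem_insert.1 h2).resolve_left fun h3 => ?_
      rw [← hp] at h3
      exact Fin.succAbove_ne p j (e.injective h3)
    · exact e.strictMono.comp (Fin.strictMono_succAbove p)

/-- Laplace expansion along the column of v. Its position among the sorted columns gives the same
sign as in the simplicial boundary. -/
theorem orientedDet_insert {m : ℕ} (y : V → Fin (m + 1) → ℝ) {ρ : Finset V} {v : V} (hv : v ∉ ρ) :
    orientedDet y (insert v ρ) =
      (-1) ^ (ρ.filter (fun w => w < v)).card * coneDet y (y v) ρ := by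
  by_cases h : ρ.card = m
  · have h' : (insert v ρ).card = m + 1 := by rw [Finset.card_insert_of_notMem hv, h]
    obtain ⟨p, hp, hpv, hps⟩ := exists_orderEmbOfFin_insert h h'
    rw [orientedDet, dif_pos h', Matrix.det_succ_column _ p, coneDet, ← hp, Finset.mul_sum]
    refine Finset.sum_congr rfl fun i _ => ?_
    rw [orientedDet, dif_pos h, Matrix.of_apply, hpv, pow_add]
    have : ((Matrix.of fun i j => y ((insert v ρ).orderEmbOfFin h' j) i).submatrix i.succAbove
        p.succAbove) = Matrix.of fun i' j => y (ρ.orderEmbOfFin h j) (i.succAbove i') := by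
      ext i' j
      simp [hps]
    rw [this]
    ring
  · have h' : (insert v ρ).card ≠ m + 1 := by rw [Finset.card_insert_of_notMem hv]; omega
    rw [orientedDet_of_card_ne h', coneDet, Finset.sum_eq_zero, mul_zero]
    intro i _
    rw [orientedDet_of_card_ne h, mul_zero]

/-- A determinant with a repeated column. -/
theorem coneDet_of_mem {m : ℕ} (y : V → Fin (m + 1) → ℝ) {ρ : Finset V} {v : V} (hv : v ∈ ρ) :
    coneDet y (y v) ρ = 0 := by
  by_cases h : ρ.card = m
  · obtain ⟨j, hj⟩ : v ∈ Set.range (ρ.orderEmbOfFin h) := by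
      rw [Finset.range_orderEmbOfFin]; exact hv
    have h1 := Matrix.det_succ_column_zero
      (Matrix.of fun i l => (Fin.cons (y v) (fun l => y (ρ.orderEmbOfFin h l)) :
        Fin (m + 1) → Fin (m + 1) → ℝ) l i)
    rw [Matrix.det_zero_of_column_eq (i := 0) (j := j.succ) (Fin.succ_ne_zero j).symm
      (by intro k; simp [hj])] at h1
    rw [coneDet]
    refine Eq.trans (Finset.sum_congr rfl fun i _ => ?_) h1.symm
    rw [orientedDet, dif_pos h]
    rfl
  · rw [coneDet, Finset.sum_eq_zero]
    intro i _
    rw [orientedDet_of_card_ne h, mul_zero]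

theorem coneDet_sum_smul [Fintype V] {m : ℕ} (y : V → Fin (m + 1) → ℝ) (c : V → ℝ) (ρ : Finset V) :
    coneDet y (∑ v, c v • y v) ρ = ∑ v, c v * coneDet y (y v) ρ := by
  simp only [coneDet, Finset.mul_sum, Finset.sum_apply, Pi.smul_apply, smul_eq_mul, Finset.sum_mul]
  rw [Finset.sum_comm]
  refine Finset.sum_congr rfl fun v _ => Finset.sum_congr rfl fun i _ => ?_
  ring

/-- Cramer's rule. -/
theorem mul_orientedDet_insert [Fintype V] {m : ℕ} (y : V → Fin (m + 1) → ℝ) {c : V → ℝ}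
    {ρ : Finset V} {v : V} (hv : v ∉ ρ) (hc : ∀ w ∉ insert v ρ, c w = 0) :
    c v * orientedDet y (insert v ρ) =
      (-1) ^ (ρ.filter (fun w => w < v)).card * coneDet y (∑ w, c w • y w) ρ := by
  rw [coneDet_sum_smul, Finset.sum_eq_single v, orientedDet_insert y hv]
  · ring
  · intro w _ hwv
    by_cases hw : w ∈ ρ
    · rw [coneDet_of_mem y hw, mul_zero]
    · rw [hc w (by simp [hwv, hw]), zero_mul]
  · exact fun h => absurd (Finset.mem_univ _) h

/-- The chain of squarefree coefficients of a polynomial, weighted by determinants. -/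
def detChain {m : ℕ} (y : V → Fin m → ℝ) : MvPolynomial V ℝ →ₗ[ℝ] (Finset V → ℝ) where
  toFun p := fun σ => coeff (sqfreeExp σ) p * orientedDet y σ
  map_add' p q := by funext σ; simp [add_mul]
  map_smul' r p := by funext σ; simp [mul_assoc]

theorem detChain_apply {m : ℕ} (y : V → Fin m → ℝ) (p : MvPolynomial V ℝ) (σ : Finset V) :
    detChain y p σ = coeff (sqfreeExp σ) p * orientedDet y σ := rfl

theorem detChain_mem_chains {Δ : SimplComplex V} {m : ℕ} (y : V → Fin m → ℝ)
    {p : MvPolynomial V ℝ} (hp : p ∈ faceSupported Δ) :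
    detChain y p ∈ Δ.chains ((m : ℤ) - 1) := by
  intro σ hσ
  rw [detChain_apply] at hσ
  refine ⟨?_, ?_⟩
  · have := mem_faceSupported.1 hp _ (left_ne_zero_of_mul hσ)
    rwa [support_sqfreeExp] at this
  · have : σ.card = m := by_contra fun h => right_ne_zero_of_mul hσ (orientedDet_of_card_ne h)
    omega

variable [Fintype V]

theorem boundary_apply (c : Finset V → ℝ) (τ : Finset V) :
    SimplComplex.boundary c τ = ∑ v ∈ Finset.univ \ τ,
      (-1 : ℝ) ^ (τ.filter (fun w => w < v)).card * c (insert v τ) := rfl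

/-- Expanding each determinant along the added vertex cancels the sign of the boundary. Vertices of
ρ contribute zero by the repeated column, so the sum may run over all of V, where it assembles the
derivatives along the coordinates of `y`. -/
theorem boundary_detChain {m : ℕ} (y : V → Fin (m + 1) → ℝ) (p : MvPolynomial V ℝ)
    (ρ : Finset V) :
    SimplComplex.boundary (detChain y p) ρ =
      ∑ i : Fin (m + 1), (-1) ^ (i : ℕ) * orientedDet (fun v j => y v (i.succAbove j)) ρ *
        coeff (sqfreeExp ρ) (linDiff (fun v => y v i) p) := by
  have h1 : ∀ i : Fin (m + 1), (-1) ^ (i : ℕ) * orientedDet (fun v j => y v (i.succAbove j)) ρ *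
      coeff (sqfreeExp ρ) (linDiff (fun v => y v i) p) =
      ∑ v, (coeff (sqfreeExp ρ + Finsupp.single v 1) p * (sqfreeExp ρ v + 1)) *
        ((-1) ^ (i : ℕ) * y v i * orientedDet (fun v j => y v (i.succAbove j)) ρ) := by
    intro i
    rw [coeff_linDiff, Finset.mul_sum]
    exact Finset.sum_congr rfl fun v _ => by ring
  rw [Finset.sum_congr rfl fun i _ => h1 i, Finset.sum_comm, boundary_apply]
  refine Finset.sum_subset_zero_on_sdiff (Finset.subset_univ _) (fun v hv => ?_) fun v hv => ?_
  · have hv : v ∈ ρ := by simpa using hv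
    rw [← Finset.mul_sum]
    have := coneDet_of_mem y hv
    rw [coneDet] at this
    rw [this, mul_zero]
  · have hv : v ∉ ρ := by simpa using hv
    rw [← Finset.mul_sum, detChain_apply, orientedDet_insert y hv, sqfreeExp_insert hv,
      sqfreeExp_apply, if_neg hv, coneDet, mul_left_comm _ (coeff _ _), ← mul_assoc ((-1) ^ _),
      ← mul_pow]
    simp

end OrientedDet

/-! ### The correspondence between cycles and annihilated polynomials -/

section CyclesAndStresses

variable {V : Type*} [Fintype V]

theorem linDiff_dotProduct_eq_zero {ι : Type*} [Fintype ι] {y : V → ι → ℝ} {p : MvPolynomial V ℝ}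
    (h : ∀ i, linDiff (fun v => y v i) p = 0) (c : ι → ℝ) :
    linDiff (fun v => ∑ i, c i * y v i) p = 0 := by
  have : (fun v => ∑ i, c i * y v i) = ∑ i, c i • fun v => y v i := by
    funext v; simp
  rw [this, ← linDiffHom_apply, map_sum, LinearMap.sum_apply]
  refine Finset.sum_eq_zero fun i _ => ?_
  rw [map_smul, LinearMap.smul_apply, linDiffHom_apply, h i, smul_zero]

variable [LinearOrder V]

/-- The squarefree coefficients determine a polynomial annihilated by `m` forms. -/
theorem eq_zero_of_detChain_eq_zero {Δ : SimplComplex V} {m : ℕ} {y : V → Fin m → ℝ}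
    (hy : ∀ τ ∈ Δ.faces, τ.card ≤ m → LinearIndepOn ℝ y τ) {s : MvPolynomial V ℝ}
    (hs : s ∈ annStress Δ (Set.range fun i v => y v i) m) (h : detChain y s = 0) : s = 0 := by
  have hs := mem_annStress.1 hs
  refine eq_zero_of_coeff_sqfreeExp hs.1 hs.2.1 (fun τ hτ hcard v _ => ?_) fun σ hσ => ?_
  · obtain ⟨c, hc⟩ := (hy τ hτ hcard.le).exists_dotProduct_eq fun w => if w = v then 1 else 0
    exact ⟨_, linDiff_dotProduct_eq_zero (fun i => hs.2.2 _ ⟨i, rfl⟩) c, hc⟩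
  · by_contra hne
    have hface := mem_faceSupported.1 hs.1 _ hne
    rw [support_sqfreeExp] at hface
    have h1 := congrFun h σ
    rw [detChain_apply] at h1
    rcases mul_eq_zero.1 h1 with h1 | h1
    · exact hne h1
    · exact orientedDet_ne_zero hσ (hy σ hface hσ.le) h1

theorem detChain_mem_cycles {Δ : SimplComplex V} {m : ℕ} {y : V → Fin (m + 1) → ℝ}
    {s : MvPolynomial V ℝ} (hs : s ∈ annStress Δ (Set.range fun i v => y v i) (m + 1)) :
    detChain y s ∈ Δ.cycles m := by
  have hs := mem_annStress.1 hs
  refine ⟨by simpa using detChain_mem_chains y hs.1, LinearMap.mem_ker.2 ?_⟩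
  funext ρ
  rw [boundary_detChain, Finset.sum_eq_zero]
  · rfl
  · intro i _
    rw [hs.2.2 _ ⟨i, rfl⟩, coeff_zero, mul_zero]

omit [LinearOrder V] in
-- A real vector space is not a finite union of proper subspaces.
theorem exists_notMem_span_of_card_lt {m : ℕ} (y : V → Fin m → ℝ) :
    ∃ o : Fin m → ℝ, ∀ ρ : Finset V, ρ.card < m → o ∉ Submodule.span ℝ (y '' (ρ : Set V)) := by
  classical
  set S : Finset (Subspace ℝ (Fin m → ℝ)) :=
    (Finset.univ.filter fun ρ : Finset V => ρ.card < m).image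
      fun ρ : Finset V => Submodule.span ℝ (y '' (ρ : Set V)) with hS
  have htop : (⊤ : Subspace ℝ (Fin m → ℝ)) ∉ S := by
    rw [hS, Finset.mem_image]
    rintro ⟨ρ, hρ, h⟩
    have h1 : Module.finrank ℝ (Submodule.span ℝ (y '' (ρ : Set V))) ≤ ρ.card := by
      classical
      have := finrank_span_finset_le_card (R := ℝ) (ρ.image y)
      rw [Finset.coe_image] at this
      exact this.trans Finset.card_image_le
    rw [h, finrank_top, Module.finrank_fin_fun] at h1
    exact absurd (Finset.mem_filter.1 hρ).2 (by omega)
  have h := Subspace.biUnion_ne_univ_of_top_notMem htop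
  obtain ⟨o, ho⟩ := (Set.ne_univ_iff_exists_notMem _).1 h
  refine ⟨o, fun ρ hρ hmem => ho ?_⟩
  refine Set.mem_biUnion (x := Submodule.span ℝ (y '' (ρ : Set V))) ?_ hmem
  exact Finset.mem_coe.2 (Finset.mem_image.2 ⟨ρ, by simpa using hρ, rfl⟩)

/-- The coefficients of the squarefree monomials in a sum of powers of linear forms. -/
theorem coeff_sum_smul_linPoly_pow {m : ℕ} {z : Finset V → ℝ} {c : Finset V → V → ℝ}
    (hz : ∀ σ, z σ ≠ 0 → σ.card = m) (hc : ∀ σ, ∀ v ∉ σ, c σ v = 0) {τ : Finset V}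
    (hτ : τ.card = m) :
    coeff (sqfreeExp τ) (∑ σ, z σ • linPoly (c σ) ^ m) = z τ * (m.factorial * ∏ v ∈ τ, c τ v) := by
  rw [coeff_sum, Finset.sum_eq_single τ]
  · rw [coeff_smul, smul_eq_mul]
    subst hτ
    rw [coeff_sqfreeExp_linPoly_pow]
  · intro σ _ hne
    rw [coeff_smul, smul_eq_mul]
    by_cases hzσ : z σ = 0
    · rw [hzσ, zero_mul]
    · rw [coeff_sqfreeExp_linPoly_pow_of_notMem (hc σ) (fun h => hne ?_), mul_zero]
      exact (Finset.eq_of_subset_of_card_le h (by rw [hz σ hzσ, hτ])).symm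
  · exact fun h => absurd (Finset.mem_univ _) h

theorem sum_smul_linPoly_pow_mem {Δ : SimplComplex V} {m : ℕ} {z : Finset V → ℝ}
    {c : Finset V → V → ℝ} (hz : ∀ σ, z σ ≠ 0 → σ ∈ Δ.faces) (hc : ∀ σ, ∀ v ∉ σ, c σ v = 0) :
    (∑ σ, z σ • linPoly (c σ) ^ m) ∈ annStress Δ ∅ m := by
  refine Submodule.sum_mem _ fun σ _ => ?_
  by_cases h : z σ = 0
  · rw [h, zero_smul]; exact Submodule.zero_mem _
  · refine Submodule.smul_mem _ _ (mem_annStress.2 ⟨mem_faceSupported_of_vars ?_,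
      isHomogeneous_linPoly_pow _ _, by simp⟩)
    exact Δ.down_closed _ (hz σ h) _ (vars_linPoly_pow (hc σ) m)

omit [LinearOrder V] in
theorem linDiff_sum_smul_linPoly_pow (m : ℕ) (z : Finset V → ℝ) (c : Finset V → V → ℝ)
    (a : V → ℝ) :
    linDiff a (∑ σ, z σ • linPoly (c σ) ^ (m + 1)) =
      ((m : ℝ) + 1) • ∑ σ, (z σ * ∑ v, c σ v * a v) • linPoly (c σ) ^ m := by
  rw [map_sum, Finset.smul_sum]
  refine Finset.sum_congr rfl fun σ _ => ?_
  rw [map_smul, linDiff_linPoly_pow, smul_smul, smul_smul]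
  congr 1
  ring

/-- Every cycle comes from a polynomial annihilated by `m + 1` forms. -/
theorem exists_detChain_eq {Δ : SimplComplex V} {m : ℕ} {y : V → Fin (m + 1) → ℝ}
    (hy : ∀ τ ∈ Δ.faces, τ.card ≤ m + 1 → LinearIndepOn ℝ y τ) {z : Finset V → ℝ}
    (hz : z ∈ Δ.cycles m) :
    ∃ s ∈ annStress Δ (Set.range fun i v => y v i) (m + 1), detChain y s = z := by
  obtain ⟨hzc, hzb⟩ := hz
  have hzb : SimplComplex.boundary z = 0 := hzb
  have hcard : ∀ σ, z σ ≠ 0 → σ.card = m + 1 := fun σ hσ => by have := (hzc σ hσ).2; omega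
  have hface : ∀ σ, z σ ≠ 0 → σ ∈ Δ.faces := fun σ hσ => (hzc σ hσ).1
  -- In the basis formed by the points of any simplex of z, this generic point has only nonzero
  -- coordinates.
  obtain ⟨o, ho⟩ := exists_notMem_span_of_card_lt y
  have hex : ∀ σ : Finset V, ∃ c : V → ℝ, (∀ v ∉ σ, c v = 0) ∧
      (z σ ≠ 0 → ∑ v, c v • y v = o) := by
    intro σ
    by_cases h : z σ = 0
    · exact ⟨0, by simp, fun h' => absurd h h'⟩
    · obtain ⟨c, hc, hco⟩ :=
        (hy σ (hface σ h) (hcard σ h).le).exists_sum_smul_eq (hcard σ h) o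
      exact ⟨c, hc, fun _ => hco⟩
  choose c hc hco using hex
  have hcne : ∀ σ, z σ ≠ 0 → ∀ v ∈ σ, c σ v ≠ 0 := fun σ h v hv =>
    LinearIndepOn.coeff_ne_zero (hc σ) (hco σ h) (ho _ (by
      rw [Finset.card_erase_of_mem hv, hcard σ h]; omega))
  have hdet : ∀ σ, z σ ≠ 0 → orientedDet y σ ≠ 0 := fun σ h =>
    orientedDet_ne_zero (hcard σ h) (hy σ (hface σ h) (hcard σ h).le)
  -- The weights make the determinant-weighted squarefree coefficients of ∑ w(σ) ℓ_σ^(m+1) equal to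
  -- (m+1)! z, where ℓ_σ is the linear form with coefficients c(σ).
  set w : Finset V → ℝ := fun σ => z σ * (orientedDet y σ * ∏ v ∈ σ, c σ v)⁻¹ with hw
  have hwz : ∀ σ, w σ ≠ 0 → z σ ≠ 0 := fun σ h => left_ne_zero_of_mul h
  set u := ∑ σ, w σ • linPoly (c σ) ^ m with hu
  have hwface : ∀ σ, w σ ≠ 0 → σ ∈ Δ.faces := fun σ h => hface σ (hwz σ h)
  -- Each ℓ_σ in play has derivative o_i along the i-th form, independently of σ. All derivatives of
  -- ∑ w(σ) ℓ_σ^(m+1) are thus multiples of the single polynomial u.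
  have hu0 : u = 0 := by
    have hmem := mem_annStress.1 (sum_smul_linPoly_pow_mem (m := m) hwface hc)
    refine eq_zero_of_coeff_sqfreeExp hmem.1 hmem.2.1 (fun τ hτ hτm v hv => ?_) fun ρ hρ => ?_
    · have hnot := ho τ (by omega)
      -- Since o is independent of the points of τ, a covector can be dual to v on τ and vanish at
      -- o; vanishing at o makes its form annihilate u.
      have hind : LinearIndependent ℝ
          (fun t : Option (τ : Set V) => t.casesOn' o fun v => y v) :=
        (linearIndependent_option' (v := fun v : (τ : Set V) => y v) (x := o)).2
          ⟨hy τ hτ (by omega), by rwa [← Set.image_eq_range]⟩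
      obtain ⟨b, hb⟩ := LinearIndependent.exists_dotProduct_eq hind
        fun t => t.elim 0 fun w => if (w : V) = v then 1 else 0
      refine ⟨fun v => ∑ i, b i * y v i, ?_, fun w hw => hb (some ⟨w, hw⟩)⟩
      rcases m with _ | m
      · omega
      rw [hu, linDiff_sum_smul_linPoly_pow, Finset.sum_eq_zero, smul_zero]
      intro σ _
      by_cases h : z σ = 0
      · simp [hw, h]
      · have h1 : ∑ v, c σ v * ∑ i, b i * y v i = ∑ i, b i * o i := by
          rw [← hco σ h]
          simp only [Finset.sum_apply, Pi.smul_apply, smul_eq_mul, Finset.mul_sum]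
          rw [Finset.sum_comm]
          exact Finset.sum_congr rfl fun i _ => Finset.sum_congr rfl fun v _ => by ring
        have h2 : ∑ i, b i * o i = 0 := hb none
        rw [h1, h2, mul_zero, zero_smul]
    · have h1 : coeff (sqfreeExp ρ) u =
          ∑ v ∈ Finset.univ \ ρ, coeff (sqfreeExp ρ) (w (insert v ρ) •
            linPoly (c (insert v ρ)) ^ m) := by
        rw [hu, coeff_sum]
        have hinj : Set.InjOn (fun v => insert v ρ) (Finset.univ \ ρ : Finset V) := by
          intro v hv v' hv' h
          have hv : v ∉ ρ := by simpa using hv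
          have h2 : v ∈ insert v' ρ := by
            have h : insert v ρ = insert v' ρ := h
            rw [← h]; simp
          exact (Finset.mem_insert.1 h2).resolve_right hv
        rw [← Finset.sum_image (g := fun v => insert v ρ)
          (f := fun σ => coeff (sqfreeExp ρ) (w σ • linPoly (c σ) ^ m)) hinj]
        refine (Finset.sum_subset (Finset.subset_univ _) fun σ _ hσ => ?_).symm
        by_cases hwσ : w σ = 0
        · rw [hwσ, zero_smul, coeff_zero]
        · rw [coeff_smul, coeff_sqfreeExp_linPoly_pow_of_notMem (hc σ) (fun h => hσ ?_), smul_zero]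
          have hσm := hcard σ (hwz σ hwσ)
          obtain ⟨v, hv, hvρ⟩ := Finset.exists_mem_notMem_of_card_lt_card
            (s := ρ) (t := σ) (by omega)
          refine Finset.mem_image.2 ⟨v, by simpa using hvρ, ?_⟩
          refine Finset.eq_of_subset_of_card_le (Finset.insert_subset hv h) ?_
          rw [Finset.card_insert_of_notMem hvρ]; omega
      -- Cramer's rule replaces the determinant and the coordinate at the added vertex by a factor
      -- depending only on ρ, up to the boundary sign. The squarefree coefficient of u at ρ is
      -- therefore a multiple of the boundary of z at ρ.
      have h2 : ∀ v ∈ Finset.univ \ ρ, coeff (sqfreeExp ρ) (w (insert v ρ) •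
            linPoly (c (insert v ρ)) ^ m) = (m.factorial * (coneDet y o ρ)⁻¹) *
            ((-1 : ℝ) ^ (ρ.filter (fun w => w < v)).card * z (insert v ρ)) := by
        intro v hv
        have hv : v ∉ ρ := by simpa using hv
        by_cases hzv : z (insert v ρ) = 0
        · simp [hw, hzv]
        · have hcr := mul_orientedDet_insert y hv (hc (insert v ρ))
          rw [hco _ hzv] at hcr
          rw [coeff_smul]
          conv_lhs => rw [← hρ, coeff_sqfreeExp_linPoly_pow, hρ]
          rw [hw]
          simp only [smul_eq_mul]
          rw [Finset.prod_insert hv]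
          have hprod : ∏ t ∈ ρ, c (insert v ρ) t ≠ 0 :=
            Finset.prod_ne_zero_iff.2 fun t ht => hcne _ hzv t (Finset.mem_insert_of_mem ht)
          rw [← mul_assoc (orientedDet _ _), mul_comm (orientedDet _ _), hcr, mul_inv, mul_inv,
            ← inv_pow]
          have : ((-1 : ℝ)⁻¹) = -1 := by norm_num
          rw [this]
          field_simp
      rw [h1, Finset.sum_congr rfl h2, ← Finset.mul_sum, ← boundary_apply, hzb]
      simp
  refine ⟨∑ σ, (((m + 1).factorial : ℝ)⁻¹ * w σ) • linPoly (c σ) ^ (m + 1), ?_, ?_⟩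
  · have hmem := mem_annStress.1 (sum_smul_linPoly_pow_mem (Δ := Δ) (m := m + 1)
      (z := fun σ => ((m + 1).factorial : ℝ)⁻¹ * w σ)
      (fun σ h => hwface σ (right_ne_zero_of_mul h)) hc)
    refine mem_annStress.2 ⟨hmem.1, hmem.2.1, ?_⟩
    rintro _ ⟨i, rfl⟩
    rw [linDiff_sum_smul_linPoly_pow]
    have h1 : ∑ σ, ((((m + 1).factorial : ℝ)⁻¹ * w σ) * ∑ v, c σ v * y v i) • linPoly (c σ) ^ m =
        (((m + 1).factorial : ℝ)⁻¹ * o i) • u := by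
      rw [hu, Finset.smul_sum]
      refine Finset.sum_congr rfl fun σ _ => ?_
      rw [smul_smul]
      by_cases h : z σ = 0
      · simp [hw, h]
      · have h2 := congrFun (hco σ h) i
        simp only [Finset.sum_apply, Pi.smul_apply, smul_eq_mul] at h2
        rw [h2]
        congr 1
        ring
    rw [h1, hu0, smul_zero, smul_zero]
  · funext τ
    rw [detChain_apply]
    by_cases hτ : τ.card = m + 1
    · rw [coeff_sum_smul_linPoly_pow (fun σ h => hcard σ (hwz σ (right_ne_zero_of_mul h))) hc hτ]
      by_cases h : z τ = 0
      · simp [hw, h]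
      · have hprod : ∏ t ∈ τ, c τ t ≠ 0 := Finset.prod_ne_zero_iff.2 fun t ht => hcne _ h t ht
        have := hdet τ h
        have hfac : ((m + 1).factorial : ℝ) ≠ 0 := by positivity
        simp only [hw]
        field_simp
    · rw [orientedDet_of_card_ne hτ, mul_zero]
      by_contra h
      exact hτ (hcard τ (Ne.symm h))

/-- The boundary of the chain of a polynomial annihilated by `m + 1` forms. -/
theorem boundary_detChain_eq_detChain_linDiff {m : ℕ} {y : V → Fin (m + 2) → ℝ}
    {p : MvPolynomial V ℝ} (hp : ∀ i : Fin (m + 1), linDiff (fun v => y v i.succ) p = 0) :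
    SimplComplex.boundary (detChain y p) =
      detChain (fun v (i : Fin (m + 1)) => y v i.succ) (linDiff (fun v => y v 0) p) := by
  funext ρ
  rw [boundary_detChain, Fin.sum_univ_succ, Finset.sum_eq_zero, add_zero, detChain_apply]
  · simp [mul_comm]
  · intro i _
    rw [hp, coeff_zero, mul_zero]

/-- If the homology vanishes, then a further form is surjective on the polynomials annihilated by
`m + 1` forms. -/
theorem exists_linDiff_eq_of_subsingleton_redHomology {Δ : SimplComplex V} {m : ℕ}
    {y : V → Fin (m + 2) → ℝ}
    (hy : ∀ τ ∈ Δ.faces, τ.card ≤ m + 1 → LinearIndepOn ℝ (fun v (i : Fin (m + 1)) => y v i.succ) τ)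
    (hy' : ∀ τ ∈ Δ.faces, τ.card = m + 2 → LinearIndepOn ℝ y τ)
    (hH : Subsingleton (Δ.redHomology m)) {s : MvPolynomial V ℝ}
    (hs : s ∈ annStress Δ (Set.range fun (i : Fin (m + 1)) v => y v i.succ) (m + 1)) :
    ∃ p ∈ annStress Δ (Set.range fun (i : Fin (m + 1)) v => y v i.succ) (m + 2),
      linDiff (fun v => y v 0) p = s := by
  obtain ⟨C, hC, hCs⟩ : ∃ C ∈ Δ.chains (m + 1), SimplComplex.boundary C =
      detChain (fun v (i : Fin (m + 1)) => y v i.succ) s := by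
    have h1 := Submodule.Quotient.subsingleton_iff.1 hH
    have h2 : (⟨_, detChain_mem_cycles hs⟩ : Δ.cycles m) ∈
        (Δ.boundaries m).submoduleOf (Δ.cycles m) := by rw [h1]; trivial
    exact h2
  have hcard : ∀ σ, C σ ≠ 0 → σ.card = m + 2 := fun σ hσ => by have := (hC σ hσ).2; omega
  have hface : ∀ σ, C σ ≠ 0 → σ ∈ Δ.faces := fun σ hσ => (hC σ hσ).1
  -- With the first basis vector as target, powers of these linear forms are killed by the last m +
  -- 1 forms, while the first form acts by lowering the exponent.
  have hex : ∀ σ : Finset V, ∃ c : V → ℝ, (∀ v ∉ σ, c v = 0) ∧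
      (C σ ≠ 0 → ∑ v, c v • y v = Pi.single 0 1) := by
    intro σ
    by_cases h : C σ = 0
    · exact ⟨0, by simp, fun h' => absurd h h'⟩
    · obtain ⟨c, hc, hco⟩ :=
        (hy' σ (hface σ h) (hcard σ h)).exists_sum_smul_eq (hcard σ h) (Pi.single 0 1)
      exact ⟨c, hc, fun _ => hco⟩
  choose c hc hco using hex
  -- A zero coordinate would give a linear relation among the other m + 1 vertices in the last m + 1
  -- coordinates. Independence makes it trivial, contradicting that the target is nonzero.
  have hcne : ∀ σ, C σ ≠ 0 → ∀ v ∈ σ, c σ v ≠ 0 := by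
    intro σ h v hv h0
    have h1 := hy (σ.erase v) (Δ.down_closed _ (hface σ h) _ (Finset.erase_subset _ _))
      (by rw [Finset.card_erase_of_mem hv, hcard σ h]; omega)
    have h2 : ∑ t ∈ σ.erase v, c σ t • (fun i : Fin (m + 1) => y t i.succ) = 0 := by
      funext i
      have h3 := congrFun (hco σ h) i.succ
      simp only [Finset.sum_apply, Pi.smul_apply, smul_eq_mul] at h3 ⊢
      rw [Pi.single_eq_of_ne (Fin.succ_ne_zero i)] at h3
      rw [Pi.zero_apply, ← h3]
      refine Finset.sum_subset (Finset.subset_univ _) fun t _ ht => ?_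
      by_cases htv : t = v
      · rw [htv, h0, zero_mul]
      · rw [hc σ t fun h => ht (Finset.mem_erase.2 ⟨htv, h⟩), zero_mul]
    have h4 := linearIndepOn_finset_iff.1 h1 (c σ) h2
    have h5 : c σ = 0 := by
      funext t
      by_cases ht : t ∈ σ.erase v
      · exact h4 t ht
      · by_cases htv : t = v
        · rw [htv, h0]; rfl
        · exact hc σ t fun h => ht (Finset.mem_erase.2 ⟨htv, h⟩)
    have h6 := congrFun (hco σ h) 0
    simp [h5] at h6
  have hdet : ∀ σ, C σ ≠ 0 → orientedDet y σ ≠ 0 := fun σ h =>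
    orientedDet_ne_zero (hcard σ h) (hy' σ (hface σ h) (hcard σ h))
  set w : Finset V → ℝ := fun σ =>
    C σ * ((m + 2).factorial * (orientedDet y σ * ∏ v ∈ σ, c σ v))⁻¹ with hw
  have hwC : ∀ σ, w σ ≠ 0 → C σ ≠ 0 := fun σ h => left_ne_zero_of_mul h
  set p := ∑ σ, w σ • linPoly (c σ) ^ (m + 2) with hp
  have hpmem : p ∈ annStress Δ (Set.range fun (i : Fin (m + 1)) v => y v i.succ) (m + 2) := by
    have hmem := mem_annStress.1 (sum_smul_linPoly_pow_mem (Δ := Δ) (m := m + 2)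
      (fun σ h => hface σ (hwC σ h)) hc)
    refine mem_annStress.2 ⟨hmem.1, hmem.2.1, ?_⟩
    rintro _ ⟨i, rfl⟩
    rw [hp, linDiff_sum_smul_linPoly_pow, Finset.sum_eq_zero, smul_zero]
    intro σ _
    by_cases h : C σ = 0
    · simp [hw, h]
    · have h2 := congrFun (hco σ h) i.succ
      simp only [Finset.sum_apply, Pi.smul_apply, smul_eq_mul] at h2
      rw [h2, Pi.single_eq_of_ne (Fin.succ_ne_zero i), mul_zero, zero_smul]
  have hpC : detChain y p = C := by
    funext τ
    rw [detChain_apply]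
    by_cases hτ : τ.card = m + 2
    · rw [hp, coeff_sum_smul_linPoly_pow (fun σ h => hcard σ (hwC σ h)) hc hτ]
      by_cases h : C τ = 0
      · simp [hw, h]
      · have hprod : ∏ t ∈ τ, c τ t ≠ 0 := Finset.prod_ne_zero_iff.2 fun t ht => hcne _ h t ht
        have := hdet τ h
        have hfac : ((m + 2).factorial : ℝ) ≠ 0 := by positivity
        simp only [hw]
        field_simp
    · rw [orientedDet_of_card_ne hτ, mul_zero]
      by_contra h
      exact hτ (hcard τ (Ne.symm h))
  -- The image of p and s have the same chain, namely the boundary of C, and a polynomial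
  -- annihilated by the m + 1 forms is determined by its chain.
  refine ⟨p, hpmem, sub_eq_zero.1 (eq_zero_of_detChain_eq_zero hy
    (Submodule.sub_mem _ (linDiff_mem_annStress _ hpmem) hs) ?_)⟩
  rw [map_sub, ← hCs, ← hpC, sub_eq_zero]
  exact (boundary_detChain_eq_detChain_linDiff
    fun i => (mem_annStress.1 hpmem).2.2 _ ⟨i, rfl⟩).symm

end CyclesAndStresses

/-! ### Forms in general position, and iterated links -/

section Uniform

variable {V : Type*} {ι : Type*}

/-- All square matrices of values of forms with index in `K` at the vertices of a face are
nonsingular. -/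
def IsUniform (Δ : SimplComplex V) (a : ι → V → ℝ) (K : Finset ι) : Prop :=
  ∀ J ⊆ K, ∀ σ ∈ Δ.faces, J.card = σ.card → ∀ c : ι → ℝ,
    (∀ v ∈ σ, ∑ j ∈ J, c j * a j v = 0) → ∀ j ∈ J, c j = 0

theorem IsUniform.mono {Δ : SimplComplex V} {a : ι → V → ℝ} {K L : Finset ι}
    (h : IsUniform Δ a K) (hL : L ⊆ K) : IsUniform Δ a L := fun J hJ => h J (hJ.trans hL)

theorem IsUniform.ne_zero {Δ : SimplComplex V} {a : ι → V → ℝ} {K : Finset ι}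
    (h : IsUniform Δ a K) {j : ι} (hj : j ∈ K) {v : V} (hv : v ∈ Δ.vertices) : a j v ≠ 0 := by
  intro h0
  have := h {j} (by simpa using hj) {v} hv (by simp) (fun _ => 1) (by simp [h0]) j (by simp)
  exact one_ne_zero this

/-- Uniformity concerns square matrices only; for a smaller face, as many of the m forms as it has
vertices already separate them. -/
theorem IsUniform.linearIndepOn {Δ : SimplComplex V} {a : ι → V → ℝ} {K : Finset ι}
    (h : IsUniform Δ a K) {m : ℕ} {e : Fin m → ι} (he : Function.Injective e)
    (heK : ∀ i, e i ∈ K) {σ : Finset V} (hσ : σ ∈ Δ.faces) (hm : σ.card ≤ m) :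
    LinearIndepOn ℝ (fun v i => a (e i) v) (σ : Set V) := by
  classical
  obtain ⟨f⟩ : Nonempty ((σ : Set V) ↪ Fin m) :=
    Function.Embedding.nonempty_of_card_le (by simpa using hm)
  have hef : Function.Injective fun u => e (f u) := he.comp f.injective
  have hM : IsUnit (Matrix.of fun u v : (σ : Set V) => a (e (f u)) v) := by
    rw [← Matrix.linearIndependent_rows_iff_isUnit, Fintype.linearIndependent_iff]
    intro c hc u
    have h1 := h (Finset.univ.image fun u => e (f u)) (by
        intro j hj
        obtain ⟨u, -, rfl⟩ := Finset.mem_image.1 hj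
        exact heK _) σ hσ (by
        rw [Finset.card_image_of_injective _ hef, Finset.card_univ]; simp)
      (Function.extend (fun u => e (f u)) c 0) (by
        intro v hv
        rw [Finset.sum_image (hef.injOn)]
        have h2 := congrFun hc ⟨v, hv⟩
        simp only [Finset.sum_apply, Pi.smul_apply, smul_eq_mul, Matrix.row, Matrix.of_apply,
          Pi.zero_apply] at h2
        rw [← h2]
        exact Finset.sum_congr rfl fun u _ => by rw [hef.extend_apply])
      (e (f u)) (Finset.mem_image.2 ⟨u, Finset.mem_univ _, rfl⟩)
    rwa [hef.extend_apply] at h1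
  rw [← Matrix.linearIndependent_cols_iff_isUnit] at hM
  exact LinearIndependent.of_comp (LinearMap.funLeft ℝ ℝ f) hM

variable [DecidableEq V]

theorem SimplComplex.link_empty (Δ : SimplComplex V) : Δ.link ∅ = Δ := by
  ext σ
  simp [SimplComplex.link]

theorem SimplComplex.mem_link_singleton {Δ : SimplComplex V} {v : V} {σ : Finset V} :
    σ ∈ (Δ.link {v}).faces ↔ v ∉ σ ∧ insert v σ ∈ Δ.faces := by
  constructor
  · rintro ⟨τ, hτ, hv, rfl⟩
    refine ⟨by simp, ?_⟩
    have : insert v (τ \ {v}) = τ := by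
      rw [Finset.sdiff_singleton_eq_erase, Finset.insert_erase (by simpa using hv)]
    rwa [this]
  · rintro ⟨hv, h⟩
    refine ⟨_, h, by simp, ?_⟩
    rw [Finset.sdiff_singleton_eq_erase, Finset.erase_insert hv]

theorem SimplComplex.link_link_singleton {Δ : SimplComplex V} {v : V} {σ : Finset V}
    (hv : v ∉ σ) : (Δ.link {v}).link σ = Δ.link (insert v σ) := by
  ext ρ
  constructor
  · rintro ⟨τ, hτ, h, rfl⟩
    obtain ⟨hvτ, hτ⟩ := SimplComplex.mem_link_singleton.1 hτ
    refine ⟨_, hτ, Finset.insert_subset_insert _ h, ?_⟩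
    ext w
    simp only [Finset.mem_sdiff, Finset.mem_insert]
    constructor
    · rintro ⟨h1, h2⟩
      exact ⟨Or.inr h1, fun h3 => h3.elim (fun h4 => hvτ (h4 ▸ h1)) h2⟩
    · rintro ⟨h1, h2⟩
      exact ⟨h1.resolve_left fun h3 => h2 (Or.inl h3), fun h3 => h2 (Or.inr h3)⟩
  · rintro ⟨τ, hτ, h, rfl⟩
    have hvτ : v ∈ τ := h (Finset.mem_insert_self _ _)
    refine ⟨τ.erase v, SimplComplex.mem_link_singleton.2 ⟨by simp, by
      rwa [Finset.insert_erase hvτ]⟩, ?_, ?_⟩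
    · intro w hw
      exact Finset.mem_erase.2 ⟨fun h1 => hv (h1 ▸ hw), h (Finset.mem_insert_of_mem hw)⟩
    · ext w
      simp only [Finset.mem_sdiff, Finset.mem_insert, Finset.mem_erase]
      tauto

/-- Elimination of a form preserves uniformity. -/
theorem isUniform_eliminate [DecidableEq ι] {Δ : SimplComplex V} {a : ι → V → ℝ} {K : Finset ι}
    (h : IsUniform Δ a K) {i : ι} (hi : i ∈ K) {v : V} (hv : v ∈ Δ.vertices) :
    IsUniform (Δ.link {v}) (fun j => eliminate (a i) v (a j)) (K.erase i) := by
  intro J hJ σ hσ hcard c hc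
  obtain ⟨hvσ, hσ⟩ := SimplComplex.mem_link_singleton.1 hσ
  have hiJ : i ∉ J := fun hiJ => absurd (hJ hiJ) (by simp)
  have hne := h.ne_zero hi hv
  -- With this coefficient for the eliminated form, a relation on σ among the reduced forms becomes
  -- a relation among the original forms that holds also at v.
  set e : ℝ := -∑ j ∈ J, c j * (a j v / a i v) with he
  have h1 : ∀ w, ∑ j ∈ insert i J, (if j = i then e else c j) * a j w =
      ∑ j ∈ J, c j * eliminate (a i) v (a j) w := by
    intro w
    have h3 : ∑ j ∈ J, (if j = i then e else c j) * a j w = ∑ j ∈ J, c j * a j w :=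
      Finset.sum_congr rfl fun j hj => by rw [if_neg (by rintro rfl; exact hiJ hj)]
    rw [Finset.sum_insert hiJ, if_pos rfl, h3, he, neg_mul, Finset.sum_mul, neg_add_eq_sub,
      ← Finset.sum_sub_distrib]
    refine Finset.sum_congr rfl fun j _ => ?_
    simp only [eliminate, Pi.sub_apply, Pi.smul_apply, smul_eq_mul]
    ring
  have h2 := h (insert i J) (Finset.insert_subset hi (hJ.trans (Finset.erase_subset _ _)))
    (insert v σ) hσ (by
      rw [Finset.card_insert_of_notMem hiJ, Finset.card_insert_of_notMem hvσ, hcard])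
    (fun j => if j = i then e else c j) (by
      intro w hw
      rw [h1]
      rcases Finset.mem_insert.1 hw with rfl | hw
      · refine Finset.sum_eq_zero fun j _ => ?_
        simp [eliminate, hne]
      · exact hc w hw)
  intro j hj
  have h3 := h2 j (Finset.mem_insert_of_mem hj)
  rwa [if_neg (by rintro rfl; exact hiJ hj)] at h3

end Uniform

/-! ### Surjectivity of generic forms from vanishing homology of links -/

section Surjectivity

variable {V : Type*} [Fintype V] {ι : Type*} [DecidableEq ι]

theorem annStress_insert_zero (Δ : SimplComplex V) (A : Set (V → ℝ)) (m : ℕ) :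
    annStress Δ (insert 0 A) m = annStress Δ A m :=
  le_antisymm (annStress_mono subset_rfl (Set.subset_insert _ _) m)
    (annStress_le_of_subset_span m (Set.insert_subset (Submodule.zero_mem _)
      Submodule.subset_span))

omit [Fintype V] in
theorem image_eliminate_image (a : ι → V → ℝ) {I : Finset ι} {i : ι} (hi : i ∈ I) {v : V}
    (hv : a i v ≠ 0) : eliminate (a i) v '' (a '' (I : Set ι)) =
      insert 0 ((fun j => eliminate (a i) v (a j)) '' (I.erase i : Set ι)) := by
  have h0 : eliminate (a i) v (a i) = 0 := by simp [eliminate, hv]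
  rw [Set.image_image]
  conv_lhs => rw [← Finset.insert_erase hi, Finset.coe_insert, Set.image_insert_eq, h0]

omit [Fintype V] in
theorem star_singleton_faces_eq_empty {Δ : SimplComplex V} {v : V} (hv : v ∉ Δ.vertices) :
    (Δ.star {v}).faces = ∅ := by
  refine Set.eq_empty_of_forall_notMem ?_
  rintro τ ⟨τ', h1, -, h2⟩
  exact hv (Δ.down_closed _ h1 _ h2)

omit [Fintype V] in
theorem eq_zero_of_faces_eq_empty {Δ : SimplComplex V} (h : Δ.faces = ∅) {p : MvPolynomial V ℝ}
    (hp : p ∈ faceSupported Δ) : p = 0 := by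
  ext a
  by_contra hne
  have := mem_faceSupported.1 hp a hne
  rw [h] at this
  exact this

omit [Fintype V] in
theorem star_faces_subset (Δ : SimplComplex V) (σ : Finset V) : (Δ.star σ).faces ⊆ Δ.faces := by
  rintro τ ⟨τ', h1, h2, -⟩
  exact Δ.down_closed _ h1 _ h2

/-- Induction on the number of forms. If it equals the degree m + 1, the homology of Δ itself
decides. Otherwise s splits into pieces on vertex stars, and each piece is lifted on the link with
one form fewer; the links there are links of Δ at faces with one more vertex. With fewer than m + 1
forms the homological hypothesis is void. -/
theorem exists_linDiff_eq_of_isUniform {V : Type*} [Fintype V] [LinearOrder V] {m n : ℕ}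
    {Δ : SimplComplex V} {a : ι → V → ℝ} {I : Finset ι} {g : ι} (hn : I.card = n) (hg : g ∉ I)
    (ha : IsUniform Δ a (insert g I))
    (hH : ∀ σ ∈ Δ.faces, σ.card + (m + 1) ≤ I.card → Subsingleton ((Δ.link σ).redHomology m))
    {s : MvPolynomial V ℝ} (hs : s ∈ annStress Δ (a '' (I : Set ι)) (m + 1)) :
    ∃ p ∈ annStress Δ (a '' (I : Set ι)) (m + 2), linDiff (a g) p = s := by
  induction n using Nat.strong_induction_on generalizing Δ a I g s with
  | _ n ih =>
  by_cases hI : I.card = m + 1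
  · by_cases hΔ : Δ.faces = ∅
    · refine ⟨0, Submodule.zero_mem _, ?_⟩
      rw [map_zero, eq_zero_of_faces_eq_empty hΔ (mem_annStress.1 hs).1]
    obtain ⟨τ, hτ⟩ := Set.nonempty_iff_ne_empty.2 hΔ
    have hH0 := hH ∅ (Δ.down_closed _ hτ _ (Finset.empty_subset _)) (by simp [hI])
    rw [SimplComplex.link_empty] at hH0
    set e : Fin (m + 1) → ι := fun i => (I.equivFinOfCardEq hI).symm i with he
    have heinj : Function.Injective e :=
      Subtype.val_injective.comp (I.equivFinOfCardEq hI).symm.injective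
    have heI : ∀ i, e i ∈ I := fun i => ((I.equivFinOfCardEq hI).symm i).2
    set e' : Fin (m + 2) → ι := Fin.cons g e with he'
    have he'inj : Function.Injective e' :=
      Fin.cons_injective_iff.2 ⟨fun ⟨i, hi⟩ => hg (hi ▸ heI i), heinj⟩
    have he'I : ∀ i, e' i ∈ insert g I := by
      intro i
      refine Fin.cases ?_ (fun j => ?_) i
      · simp [he']
      · simp [he', heI j]
    have hrange : (Set.range fun (i : Fin (m + 1)) v => a (e' i.succ) v) = a '' (I : Set ι) := by
      ext b
      constructor
      · rintro ⟨i, rfl⟩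
        exact ⟨e i, heI i, by simp [he']⟩
      · rintro ⟨j, hj, rfl⟩
        refine ⟨I.equivFinOfCardEq hI ⟨j, hj⟩, ?_⟩
        simp [he', he]
    have := exists_linDiff_eq_of_subsingleton_redHomology (Δ := Δ) (y := fun v i => a (e' i) v)
      (fun τ hτ hc => ha.linearIndepOn (e := fun i => e' i.succ)
        (he'inj.comp (Fin.succ_injective _)) (fun i => he'I _) hτ hc)
      (fun τ hτ hc => ha.linearIndepOn he'inj he'I hτ hc.le) hH0 (s := s) (by
        rw [hrange]; exact hs)
    rw [hrange] at this
    exact this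
  -- Surjectivity of the i-th form modulo the others is the induction hypothesis for I without i,
  -- with i in the role of g.
  · obtain ⟨t, ht, hst⟩ := exists_sum_star a I hI (fun i hi s hs => by
      refine ih (I.erase i).card ?_ rfl (by simp) (ha.mono ?_) (fun σ hσ hc => hH σ hσ ?_) hs
      · rw [← hn]; exact Finset.card_erase_lt_of_mem hi
      · rw [Finset.insert_erase hi]; exact Finset.subset_insert _ _
      · exact hc.trans (Finset.card_le_card (Finset.erase_subset _ _))) hs
    have hw : ∀ v, ∃ w ∈ annStress (Δ.star {v}) (a '' (I : Set ι)) (m + 2),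
        linDiff (a g) w = t v := by
      intro v
      by_cases hv : v ∈ Δ.vertices
      · rcases I.eq_empty_or_nonempty with rfl | ⟨i, hi⟩
        · have hgv : a g v ≠ 0 := ha.ne_zero (Finset.mem_insert_self _ _) hv
          -- With no forms left there is nothing to eliminate, and g is inverted on the star by
          -- direct integration.
          have := exists_linDiff_eq_star_of_empty hgv (p := t v) (m := m + 1) (Δ := Δ)
            (by simpa using ht v)
          simpa using this
        · have hiv : a i v ≠ 0 := ha.ne_zero (Finset.mem_insert_of_mem hi) hv
          refine exists_linDiff_eq_star (Set.mem_image_of_mem a (Finset.mem_coe.2 hi)) hiv (fun q hq => ?_) (ht v)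
          have hcard := Finset.card_erase_lt_of_mem hi
          rw [image_eliminate_image a hi hiv, annStress_insert_zero] at hq ⊢
          refine ih (I.erase i).card (by omega) (Δ := Δ.link {v})
            (a := fun j => eliminate (a i) v (a j)) rfl
            (fun h => hg (Finset.mem_of_mem_erase h)) ?_ (fun σ hσ hc => ?_) hq
          · have hgi : g ≠ i := fun h => hg (h ▸ hi)
            rw [← Finset.erase_insert_of_ne hgi]
            exact isUniform_eliminate ha (Finset.mem_insert_of_mem hi) hv
          · obtain ⟨hvσ, hσ⟩ := SimplComplex.mem_link_singleton.1 hσ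
            rw [SimplComplex.link_link_singleton hvσ]
            refine hH _ hσ ?_
            rw [Finset.card_insert_of_notMem hvσ]
            omega
      · refine ⟨0, Submodule.zero_mem _, ?_⟩
        rw [map_zero, eq_zero_of_faces_eq_empty (star_singleton_faces_eq_empty hv)
          (mem_annStress.1 (ht v)).1]
    choose w hw hwt using hw
    refine ⟨∑ v, w v, Submodule.sum_mem _ fun v _ =>
      annStress_mono (star_faces_subset _ _) subset_rfl _ (hw v), ?_⟩
    rw [map_sum, hst]
    exact Finset.sum_congr rfl fun v _ => hwt v

end Surjectivity

/-! ### Zariski-generic parameters and semicontinuity -/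

section Generic

variable {κ : Type*}

/-- A set of points that contains the complement of the zero set of a nonzero polynomial. -/
def IsGeneric (S : Set (κ → ℝ)) : Prop :=
  ∃ f : MvPolynomial κ ℝ, f ≠ 0 ∧ ∀ b, eval b f ≠ 0 → b ∈ S

theorem IsGeneric.nonempty {S : Set (κ → ℝ)} (h : IsGeneric S) : S.Nonempty := by
  obtain ⟨f, hf, h⟩ := h
  by_contra hne
  refine hf (MvPolynomial.funext fun b => ?_)
  rw [map_zero]
  by_contra hb
  exact hne ⟨b, h b hb⟩

theorem IsGeneric.mono {S T : Set (κ → ℝ)} (h : IsGeneric S) (hST : S ⊆ T) : IsGeneric T :=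
  let ⟨f, hf, h⟩ := h
  ⟨f, hf, fun b hb => hST (h b hb)⟩

theorem IsGeneric.inter {S T : Set (κ → ℝ)} (hS : IsGeneric S) (hT : IsGeneric T) :
    IsGeneric (S ∩ T) := by
  obtain ⟨f, hf, hS⟩ := hS
  obtain ⟨g, hg, hT⟩ := hT
  refine ⟨f * g, mul_ne_zero hf hg, fun b hb => ?_⟩
  rw [map_mul] at hb
  exact ⟨hS b (left_ne_zero_of_mul hb), hT b (right_ne_zero_of_mul hb)⟩

theorem IsGeneric.iInter {α : Type*} [Finite α] {S : α → Set (κ → ℝ)}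
    (h : ∀ i, IsGeneric (S i)) : IsGeneric (⋂ i, S i) := by
  have := Fintype.ofFinite α
  choose f hf h using h
  refine ⟨∏ i, f i, Finset.prod_ne_zero_iff.2 fun i _ => hf i, fun b hb => ?_⟩
  rw [map_prod, Finset.prod_ne_zero_iff] at hb
  exact Set.mem_iInter.2 fun i => h i b (hb i (Finset.mem_univ i))

theorem isGeneric_det_ne_zero {n : Type*} [Fintype n] [DecidableEq n]
    (M : Matrix n n (MvPolynomial κ ℝ)) {b₀ : κ → ℝ} (h : (M.map (eval b₀)).det ≠ 0) :
    IsGeneric {b | (M.map (eval b)).det ≠ 0} := by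
  have key : ∀ b, eval b M.det = (M.map (eval b)).det := fun b => by
    rw [RingHom.map_det]; rfl
  refine ⟨M.det, fun h0 => h ?_, fun b hb => ?_⟩
  · rw [← key, h0, map_zero]
  · rw [key] at hb; exact hb

/-- The dimension of the kernel of a linear family of linear maps is upper semicontinuous. -/
theorem isGeneric_finrank_ker_le [Fintype κ] {E F : Type*} [AddCommGroup E] [Module ℝ E]
    [FiniteDimensional ℝ E] [AddCommGroup F] [Module ℝ F] (A : κ → E →ₗ[ℝ] F) (b₀ : κ → ℝ) :
    IsGeneric {b | Module.finrank ℝ (LinearMap.ker (∑ i, b i • A i)) ≤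
      Module.finrank ℝ (LinearMap.ker (∑ i, b₀ i • A i))} := by
  classical
  set B : (κ → ℝ) → E →ₗ[ℝ] F := fun b => ∑ i, b i • A i with hB
  -- On a complement C of the kernel at b₀ the map has a left inverse l. The determinant of l ∘ B(b)
  -- on C is polynomial in b and equals 1 at b₀; where it is nonzero, the kernel of B(b) meets C
  -- trivially.
  obtain ⟨C, hC⟩ := Submodule.exists_isCompl (LinearMap.ker (B b₀))
  set c := Module.finBasis ℝ C with hc
  have hinj : Function.Injective ((B b₀).comp C.subtype) := by
    rw [← LinearMap.ker_eq_bot, LinearMap.ker_comp, ← Submodule.disjoint_iff_comap_eq_bot]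
    exact hC.disjoint.symm
  obtain ⟨l, hl⟩ := LinearMap.exists_leftInverse_of_injective _ (LinearMap.ker_eq_bot.2 hinj)
  set M : Matrix _ _ (MvPolynomial κ ℝ) :=
    Matrix.of fun i j => ∑ t, X t * MvPolynomial.C (c.repr (l (A t (c j))) i) with hM
  have hMb : ∀ b, M.map (eval b) = LinearMap.toMatrix c c (l.comp ((B b).comp C.subtype)) := by
    intro b
    ext i j
    rw [LinearMap.toMatrix_apply]
    simp [hM, hB, map_sum, Finsupp.finsetSum_apply]
  have h0 : (M.map (eval b₀)).det ≠ 0 := by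
    rw [hMb, hl, LinearMap.toMatrix_id, Matrix.det_one]
    exact one_ne_zero
  refine (isGeneric_det_ne_zero M h0).mono fun b hb => ?_
  rw [Set.mem_ofPred_eq, hMb, LinearMap.det_toMatrix] at hb
  have hinj' : Function.Injective ((B b).comp C.subtype) := by
    have h1 : Function.Injective (l.comp ((B b).comp C.subtype)) :=
      (LinearEquiv.ofIsUnitDet (f := l.comp ((B b).comp C.subtype)) (v := c) (v' := c)
        (by rw [LinearMap.det_toMatrix]; exact isUnit_iff_ne_zero.2 hb)).injective
    exact Function.Injective.of_comp (f := l) h1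
  have hdisj : Disjoint C (LinearMap.ker (B b)) := by
    rw [Submodule.disjoint_iff_comap_eq_bot, ← LinearMap.ker_comp, LinearMap.ker_eq_bot]
    exact hinj'
  have h1 := Submodule.finrank_add_finrank_le_of_disjoint hdisj
  have h2 := Submodule.finrank_add_eq_of_isCompl hC
  show Module.finrank ℝ (LinearMap.ker (B b)) ≤ Module.finrank ℝ (LinearMap.ker (B b₀))
  omega

end Generic

/-! ### Linear forms with generic coefficients -/

section GenericForms

variable {V η ι : Type*} [Fintype η]

/-- The linear form on the points `y` given by a covector. -/
def pairing (y : V → η → ℝ) (c : η → ℝ) : V → ℝ := fun v => ∑ l, c l * y v l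

/-- The covectors of a configuration of parameters. -/
def covector (b : ι × η → ℝ) (i : ι) : η → ℝ := fun l => b (i, l)

/-- The determinant is polynomial in the parameters, and covectors dual to the independent points
turn the matrix into the identity. -/
theorem isGeneric_det_pairing {n : Type*} [Fintype n] [DecidableEq n] {e : n → ι}
    (he : Function.Injective e) {y : n → η → ℝ} (hy : LinearIndependent ℝ y) :
    IsGeneric {b : ι × η → ℝ |
      (Matrix.of fun i j => ∑ l, covector b (e i) l * y j l).det ≠ 0} := by
  classical
  have hex : ∀ i : n, ∃ c : η → ℝ, ∀ j, ∑ l, c l * y j l = if i = j then 1 else 0 :=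
    fun i => hy.exists_dotProduct_eq _
  choose c hc using hex
  have hM : ∀ b : ι × η → ℝ, (Matrix.of fun i j => ∑ l, (X (e i, l) : MvPolynomial (ι × η) ℝ) *
      C (y j l)).map (eval b) = Matrix.of fun i j => ∑ l, covector b (e i) l * y j l := by
    intro b; ext i j; simp [covector]
  have := isGeneric_det_ne_zero (Matrix.of fun i j => ∑ l, (X (e i, l) : MvPolynomial (ι × η) ℝ) *
      C (y j l)) (b₀ := fun t => Function.extend e c 0 t.1 t.2) (by
    rw [hM]
    have : (Matrix.of fun i j => ∑ l, covector (fun t => Function.extend e c 0 t.1 t.2) (e i) l *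
        y j l) = (1 : Matrix n n ℝ) := by
      ext i j
      simp only [Matrix.of_apply, covector, he.extend_apply, hc, Matrix.one_apply]
    rw [this, Matrix.det_one]
    exact one_ne_zero)
  simpa only [hM] using this

variable [Fintype V] [Fintype ι] [DecidableEq ι]

theorem linDiff_pairing (y : V → η → ℝ) (c : η → ℝ) :
    linDiff (pairing y c) = ∑ l, c l • linDiff fun v => y v l := by
  have : pairing y c = ∑ l, c l • fun v => y v l := by
    funext v; simp [pairing]
  rw [this, ← linDiffHom_apply, map_sum]
  simp only [map_smul, linDiffHom_apply]

/-- For a generic choice of covectors, the dimension of the space of annihilated polynomials is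
minimal. -/
theorem isGeneric_finrank_annStress_le (Γ : SimplComplex V) (y : V → η → ℝ) (I : Finset ι) (k : ℕ) :
    IsGeneric {b : ι × η → ℝ | ∀ c : ι → η → ℝ,
      Module.finrank ℝ (annStress Γ ((fun i => pairing y (covector b i)) '' (I : Set ι)) k) ≤
        Module.finrank ℝ (annStress Γ ((fun i => pairing y (c i)) '' (I : Set ι)) k)} := by
  set N : (ι × η → ℝ) → ℕ := fun b => Module.finrank ℝ
    (annStress Γ ((fun i => pairing y (covector b i)) '' (I : Set ι)) k) with hN
  -- The dimension is a natural number, so its minimum is attained; semicontinuity spreads this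
  -- minimum to generic parameters.
  obtain ⟨b₀, hb₀⟩ : ∃ b₀, ∀ b, N b₀ ≤ N b := by
    exact ⟨Function.argmin N, fun b => Function.argmin_le N b⟩
  -- The annihilation conditions depend linearly on the parameters: component i of the combined map
  -- is the derivative along the i-th form.
  set A : ι × η → annStress Γ ∅ k →ₗ[ℝ] (ι → MvPolynomial V ℝ) := fun t =>
    if t.1 ∈ I then (LinearMap.single ℝ (fun _ => MvPolynomial V ℝ) t.1).comp
      ((linDiff fun v => y v t.2).comp (annStress Γ ∅ k).subtype) else 0 with hA
  have hAt : ∀ i l p j, A (i, l) p j =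
      if i = j then (if j ∈ I then linDiff (fun v => y v l) (p : MvPolynomial V ℝ) else 0)
      else 0 := by
    intro i l p j
    by_cases hij : i = j
    · subst hij
      by_cases hi : i ∈ I <;> simp [hA, hi]
    · by_cases hi : i ∈ I <;> simp [hA, hi, hij]
  have hAb : ∀ (b : ι × η → ℝ) p i, (∑ t, b t • A t) p i =
      if i ∈ I then linDiff (pairing y (covector b i)) (p : MvPolynomial V ℝ) else 0 := by
    intro b p i
    rw [linDiff_pairing, Fintype.sum_prod_type]
    simp only [LinearMap.sum_apply, LinearMap.smul_apply, Finset.sum_apply, Pi.smul_apply, hAt]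
    rw [Finset.sum_eq_single i]
    · by_cases hi : i ∈ I <;> simp [hi, covector]
    · intro j _ hj
      simp [hj]
    · exact fun h => absurd (Finset.mem_univ _) h
  have hker : ∀ b, N b = Module.finrank ℝ (LinearMap.ker (∑ t, b t • A t)) := by
    intro b
    have : annStress Γ ((fun i => pairing y (covector b i)) '' (I : Set ι)) k =
        (LinearMap.ker (∑ t, b t • A t)).map (annStress Γ ∅ k).subtype := by
      ext p
      constructor
      · intro hp
        have hp0 : p ∈ annStress Γ ∅ k := annStress_mono subset_rfl (Set.empty_subset _) k hp
        refine ⟨⟨p, hp0⟩, ?_, rfl⟩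
        refine LinearMap.mem_ker.2 (funext fun i => ?_)
        rw [hAb]
        split_ifs with hi
        · exact (mem_annStress.1 hp).2.2 _ ⟨i, hi, rfl⟩
        · rfl
      · rintro ⟨q, hq, rfl⟩
        have hq' := mem_annStress.1 q.2
        refine mem_annStress.2 ⟨hq'.1, hq'.2.1, ?_⟩
        rintro _ ⟨i, hi, rfl⟩
        have := congrFun (LinearMap.mem_ker.1 hq) i
        rw [hAb, if_pos (Finset.mem_coe.1 hi)] at this
        exact this
    rw [hN]
    simp only
    rw [this, Submodule.finrank_map_subtype_eq]
  refine (isGeneric_finrank_ker_le A b₀).mono fun b hb c => ?_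
  rw [Set.mem_ofPred_eq, ← hker, ← hker] at hb
  exact hb.trans (hb₀ fun t => c t.1 t.2)

end GenericForms

/-! ### Simultaneous choice of generic covectors -/

section GenericCovectors

/-- The complex of linearly independent subsets of a configuration of points. -/
def indepComplex {V E : Type*} [AddCommGroup E] [Module ℝ E] (y : V → E) : SimplComplex V where
  faces := {σ | LinearIndepOn ℝ y (σ : Set V)}
  down_closed := fun _ hσ _ hτ => LinearIndepOn.mono hσ (Finset.coe_subset.2 hτ)

theorem IsUniform.comap {V W ι : Type*} {Δ : SimplComplex V} {Γ : SimplComplex W}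
    {a : ι → W → ℝ} {K : Finset ι} (f : V ↪ W)
    (h : ∀ σ ∈ Δ.faces, σ.card ≤ K.card → σ.map f ∈ Γ.faces) (ha : IsUniform Γ a K) :
    IsUniform Δ (fun j v => a j (f v)) K := by
  intro J hJ σ hσ hcard c hc
  refine ha J hJ (σ.map f) (h σ hσ (hcard ▸ Finset.card_le_card hJ)) (by simpa using hcard) c ?_
  intro w hw
  obtain ⟨v, hv, rfl⟩ := Finset.mem_map.1 hw
  exact hc v hv

variable {V η ι : Type*} [Fintype V] [Fintype η] [Fintype ι]

theorem isGeneric_isUniform [DecidableEq ι] (y : V → η → ℝ) :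
    IsGeneric {b : ι × η → ℝ | IsUniform (indepComplex y) (fun i => pairing y (covector b i))
      Finset.univ} := by
  classical
  -- There are finitely many pairs of an index set and a tuple of vertices, and dependent tuples
  -- impose no condition.
  have h : ∀ t : Σ J : Finset ι, J → V, IsGeneric {b : ι × η → ℝ |
      LinearIndependent ℝ (fun j => y (t.2 j)) →
      (Matrix.of fun i j : t.1 => ∑ l, covector b i l * y (t.2 j) l).det ≠ 0} := by
    rintro ⟨J, f⟩
    by_cases hy : LinearIndependent ℝ (fun j => y (f j))
    · exact (isGeneric_det_pairing (e := fun j : J => (j : ι)) Subtype.val_injective hy).mono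
        fun b hb _ => hb
    · exact ⟨1, one_ne_zero, fun b _ h => absurd h hy⟩
  refine (IsGeneric.iInter h).mono fun b hb => ?_
  intro J _ σ hσ hcard c hc j hj
  have hb := Set.mem_iInter.1 hb
  have e : J ≃ σ := Finset.equivOfCardEq hcard
  have h1 := hb ⟨J, fun j => e j⟩ (LinearIndependent.comp hσ (fun j => e j) e.injective)
  by_contra hne
  refine h1 (Matrix.exists_vecMul_eq_zero_iff.1 ⟨fun j => c j, fun h => hne ?_, ?_⟩)
  · exact congrFun h ⟨j, hj⟩
  · funext j'
    have := hc (e j') (e j').2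
    rw [← Finset.sum_coe_sort J] at this
    exact this

theorem isGeneric_span_eq_top [DecidableEq ι] (hcard : Fintype.card ι = Fintype.card η) :
    IsGeneric {b : ι × η → ℝ | Submodule.span ℝ (Set.range (covector b)) = ⊤} := by
  classical
  have e := Fintype.equivOfCardEq hcard
  have hy : LinearIndependent ℝ (fun j : ι => (Pi.single (e j) 1 : η → ℝ)) := by
    have := (Pi.basisFun ℝ η).linearIndependent.comp e e.injective
    convert this using 1
    funext j
    simp
  refine (isGeneric_det_pairing (e := fun j : ι => j) (fun _ _ h => h) hy).mono fun b hb => ?_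
  have h1 : IsUnit (Matrix.of fun i j => ∑ l, covector b i l * (Pi.single (e j) 1 : η → ℝ) l) :=
    (Matrix.isUnit_iff_isUnit_det _).2 (isUnit_iff_ne_zero.2 hb)
  rw [← Matrix.linearIndependent_rows_iff_isUnit] at h1
  have h2 : LinearIndependent ℝ (covector b) := by
    refine LinearIndependent.of_comp (LinearMap.funLeft ℝ ℝ e) ?_
    have h3 : LinearMap.funLeft ℝ ℝ e ∘ covector b = (Matrix.of fun i j =>
        ∑ l, covector b i l * (Pi.single (e j) 1 : η → ℝ) l).row := by
      funext i j
      simp [Matrix.row, LinearMap.funLeft_apply, Pi.single_apply]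
    exact h3 ▸ h1
  exact h2.span_eq_top_of_card_eq_finrank' (by simp [hcard])

/-- Allows one choice of covectors to be minimal for all complexes at once. -/
instance : Finite (SimplComplex V) :=
  Finite.of_injective SimplComplex.faces fun _ _ h => SimplComplex.ext h

/-- The restriction of the pairing with covectors to linear forms, as a linear map. -/
def pairingHom {V η : Type*} [Fintype η] (y : V → η → ℝ) : (η → ℝ) →ₗ[ℝ] (V → ℝ) where
  toFun := pairing y
  map_add' a b := by funext v; simp [pairing, add_mul, Finset.sum_add_distrib]
  map_smul' r a := by funext v; simp [pairing, mul_assoc, Finset.mul_sum]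

omit [Fintype V] in
theorem pairingHom_apply (y : V → η → ℝ) (c : η → ℝ) : pairingHom y c = pairing y c := rfl

omit [Fintype V] in
theorem pairing_mem_span {y : V → η → ℝ} {b : η → ℝ} {B : Set (η → ℝ)}
    (h : b ∈ Submodule.span ℝ B) : pairing y b ∈ Submodule.span ℝ (pairing y '' B) := by
  have := Submodule.mem_map_of_mem (f := pairingHom y) h
  rw [Submodule.map_span] at this
  exact this

/-- Points together with an extra point form a configuration indexed by `Option V`. -/
def optionPoints {V η : Type*} (y : V → η → ℝ) (o : η → ℝ) : Option V → η → ℝ :=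
  fun t => t.elim o y

/-- Existence of generic covectors. -/
theorem exists_generic_covectors [DecidableEq ι] (hcard : Fintype.card ι = Fintype.card η)
    (y : V → η → ℝ) (o : η → ℝ) (k : ℕ) :
    ∃ c : ι → η → ℝ,
      IsUniform (indepComplex (optionPoints y o)) (fun i => pairing (optionPoints y o) (c i))
        Finset.univ ∧
      Submodule.span ℝ (Set.range c) = ⊤ ∧
      ∀ (Γ : SimplComplex V) (I : Finset ι) (c' : ι → η → ℝ),
        Module.finrank ℝ (annStress Γ ((fun i => pairing y (c i)) '' (I : Set ι)) k) ≤
        Module.finrank ℝ (annStress Γ ((fun i => pairing y (c' i)) '' (I : Set ι)) k) := by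
  obtain ⟨b, ⟨h1, h2⟩, h3⟩ := (((isGeneric_isUniform (ι := ι) (optionPoints y o)).inter
    (isGeneric_span_eq_top hcard)).inter (IsGeneric.iInter fun t : SimplComplex V × Finset ι =>
      isGeneric_finrank_annStress_le t.1 y t.2 k)).nonempty
  exact ⟨covector b, h1, h2, fun Γ I => Set.mem_iInter.1 h3 (Γ, I)⟩

end GenericCovectors

/-! ### Dimension counts -/

section Dimensions

variable {V : Type*} [Fintype V]

theorem annStress_congr_span {Δ : SimplComplex V} {A B : Set (V → ℝ)}
    (h1 : A ⊆ Submodule.span ℝ B) (h2 : B ⊆ Submodule.span ℝ A) (m : ℕ) :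
    annStress Δ A m = annStress Δ B m :=
  le_antisymm (annStress_le_of_subset_span m h2) (annStress_le_of_subset_span m h1)

/-- Rank and nullity of a linear map on a finite-dimensional submodule. -/
theorem finrank_map_add_finrank_inf_ker {E F : Type*} [AddCommGroup E] [Module ℝ E]
    [AddCommGroup F] [Module ℝ F] (f : E →ₗ[ℝ] F) (p : Submodule ℝ E) [FiniteDimensional ℝ p] :
    Module.finrank ℝ (p.map f) + Module.finrank ℝ (p ⊓ LinearMap.ker f : Submodule ℝ E) =
      Module.finrank ℝ p := by
  have h := LinearMap.finrank_range_add_finrank_ker (f.comp p.subtype)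
  rw [LinearMap.range_comp, Submodule.range_subtype, LinearMap.ker_comp] at h
  rw [← h, ← Submodule.finrank_map_subtype_eq p, Submodule.map_comap_subtype]

theorem annStress_inf_ker (Δ : SimplComplex V) (A : Set (V → ℝ)) (m : ℕ) (g : V → ℝ) :
    annStress Δ A m ⊓ LinearMap.ker (linDiff g) = annStress Δ (insert g A) m := by
  ext p
  simp only [Submodule.mem_inf, mem_annStress, LinearMap.mem_ker, Set.forall_mem_insert]
  tauto

theorem finrank_map_linDiff (Δ : SimplComplex V) (A : Set (V → ℝ)) (m : ℕ) (g : V → ℝ) :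
    Module.finrank ℝ ((annStress Δ A m).map (linDiff g)) +
      Module.finrank ℝ (annStress Δ (insert g A) m) = Module.finrank ℝ (annStress Δ A m) := by
  rw [← annStress_inf_ker, finrank_map_add_finrank_inf_ker]

theorem map_linDiff_le (Δ : SimplComplex V) (A : Set (V → ℝ)) (m : ℕ) (g : V → ℝ) :
    (annStress Δ A (m + 1)).map (linDiff g) ≤ annStress Δ A m := by
  rintro _ ⟨p, hp, rfl⟩
  exact linDiff_mem_annStress g hp

theorem finrank_annStress_succ_le (Δ : SimplComplex V) (A : Set (V → ℝ)) (m : ℕ) (g : V → ℝ) :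
    Module.finrank ℝ (annStress Δ A (m + 1)) ≤ Module.finrank ℝ (annStress Δ A m) +
      Module.finrank ℝ (annStress Δ (insert g A) (m + 1)) := by
  rw [← finrank_map_linDiff Δ A (m + 1) g]
  exact Nat.add_le_add_right (Submodule.finrank_mono (map_linDiff_le Δ A m g)) _

theorem finrank_annStress_succ_eq {Δ : SimplComplex V} {A : Set (V → ℝ)} {m : ℕ} {g : V → ℝ}
    (h : ∀ s ∈ annStress Δ A m, ∃ p ∈ annStress Δ A (m + 1), linDiff g p = s) :
    Module.finrank ℝ (annStress Δ A (m + 1)) = Module.finrank ℝ (annStress Δ A m) +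
      Module.finrank ℝ (annStress Δ (insert g A) (m + 1)) := by
  rw [← finrank_map_linDiff Δ A (m + 1) g, le_antisymm (map_linDiff_le Δ A m g) h]

/-- Exchanging a form `h` for a form `g` that is surjective on the polynomials annihilated by the
other forms. -/
theorem finrank_annStress_exchange {Δ : SimplComplex V} {A : Set (V → ℝ)} {m : ℕ} {g h : V → ℝ}
    (hg : ∀ s ∈ annStress Δ A m, ∃ p ∈ annStress Δ A (m + 1), linDiff g p = s) :
    Module.finrank ℝ (annStress Δ (insert h A) m) +
        Module.finrank ℝ (annStress Δ (insert g A) (m + 1)) ≤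
      Module.finrank ℝ (annStress Δ (insert g A) m) +
        Module.finrank ℝ (annStress Δ (insert h A) (m + 1)) := by
  -- The dimension of U is counted twice. Under g its image contains the space for h and A in degree
  -- m, by surjectivity, and its kernel the space for g and A in degree m + 1. Under h the
  -- corresponding inclusions are reversed.
  set U : Submodule ℝ (MvPolynomial V ℝ) :=
    annStress Δ A (m + 1) ⊓ LinearMap.ker (linDiff h * linDiff g) with hU
  have : FiniteDimensional ℝ U := Submodule.finiteDimensional_of_le inf_le_left
  have hUmem : ∀ p, p ∈ U ↔ p ∈ annStress Δ A (m + 1) ∧ linDiff h (linDiff g p) = 0 :=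
    fun p => Iff.rfl
  have h1 := finrank_map_add_finrank_inf_ker (linDiff g) U
  have h2 := finrank_map_add_finrank_inf_ker (linDiff h) U
  have h3 : annStress Δ (insert h A) m ≤ U.map (linDiff g) := by
    intro s hs
    rw [← annStress_inf_ker] at hs
    obtain ⟨p, hp, hps⟩ := hg s hs.1
    exact ⟨p, (hUmem p).2 ⟨hp, by rw [hps]; exact hs.2⟩, hps⟩
  have h4 : annStress Δ (insert g A) (m + 1) ≤ U ⊓ LinearMap.ker (linDiff g) := by
    intro p hp
    rw [← annStress_inf_ker] at hp
    refine ⟨(hUmem p).2 ⟨hp.1, ?_⟩, hp.2⟩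
    rw [LinearMap.mem_ker.1 hp.2, map_zero]
  have h5 : U.map (linDiff h) ≤ annStress Δ (insert g A) m := by
    rintro _ ⟨p, hp, rfl⟩
    have hp := (hUmem p).1 hp
    rw [← annStress_inf_ker]
    refine ⟨linDiff_mem_annStress h hp.1, ?_⟩
    exact (linDiff_comm_apply g h p).trans hp.2
  have h6 : U ⊓ LinearMap.ker (linDiff h) ≤ annStress Δ (insert h A) (m + 1) := by
    rw [← annStress_inf_ker]
    exact inf_le_inf_right _ inf_le_left
  have : FiniteDimensional ℝ (U ⊓ LinearMap.ker (linDiff g) : Submodule ℝ (MvPolynomial V ℝ)) :=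
    Submodule.finiteDimensional_of_le inf_le_left
  have h3 := Submodule.finrank_mono h3
  have h4 := Submodule.finrank_mono h4
  have h5 := Submodule.finrank_mono h5
  have h6 := Submodule.finrank_mono h6
  omega

variable [DecidableEq V]

/-- Adding a vertex `u` to `X`: the polynomials on `X` and those on the star of `u` meet in
polynomials on the link of `u`. -/
theorem finrank_add_finrank_star_le {X Y : SimplComplex V} {u : V}
    (hXY : ∀ σ, σ ∈ X.faces ↔ σ ∈ Y.faces ∧ u ∉ σ) (A : Set (V → ℝ)) (m : ℕ) :
    Module.finrank ℝ (annStress X A m) + Module.finrank ℝ (annStress (Y.star {u}) A m) ≤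
      Module.finrank ℝ (annStress Y A m) + Module.finrank ℝ (annStress (Y.link {u}) A m) := by
  rw [← Submodule.finrank_sup_add_finrank_inf_eq]
  refine add_le_add (Submodule.finrank_mono (sup_le ?_ ?_)) (Submodule.finrank_mono ?_)
  · exact annStress_mono (fun σ hσ => ((hXY σ).1 hσ).1) subset_rfl m
  · exact annStress_mono (star_faces_subset _ _) subset_rfl m
  · rintro p ⟨hp1, hp2⟩
    have hp1 := mem_annStress.1 hp1
    have hp2 := mem_annStress.1 hp2
    refine mem_annStress.2 ⟨mem_faceSupported.2 fun a ha => ?_, hp1.2⟩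
    have h1 := ((hXY _).1 (mem_faceSupported.1 hp1.1 a ha)).2
    obtain ⟨τ, hτ, h2, h3⟩ := mem_faceSupported.1 hp2.1 a ha
    refine SimplComplex.mem_link_singleton.2 ⟨h1, Y.down_closed _ hτ _ ?_⟩
    exact Finset.insert_subset (by simpa using h3) h2

omit [DecidableEq V] in
-- Rank and nullity of the derivative by u: the kernel consists of polynomials avoiding u, and the
-- image lies on the star of u.
theorem finrank_annStress_succ_le_add_star {X Y : SimplComplex V} {u : V}
    (hXY : ∀ σ, σ ∈ X.faces ↔ σ ∈ Y.faces ∧ u ∉ σ) (A : Set (V → ℝ)) (m : ℕ) :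
    Module.finrank ℝ (annStress Y A (m + 1)) ≤
      Module.finrank ℝ (annStress X A (m + 1)) + Module.finrank ℝ (annStress (Y.star {u}) A m) := by
  rw [← finrank_map_add_finrank_inf_ker (pd u), add_comm]
  refine add_le_add (Submodule.finrank_mono ?_) (Submodule.finrank_mono ?_)
  · rintro p ⟨hp, h0⟩
    have hp := mem_annStress.1 hp
    refine mem_annStress.2 ⟨mem_faceSupported.2 fun a ha => ?_, hp.2⟩
    refine (hXY _).2 ⟨mem_faceSupported.1 hp.1 a ha, fun hu => ?_⟩
    have hle : Finsupp.single u 1 ≤ a := by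
      rw [Finsupp.single_le_iff]
      exact Nat.one_le_iff_ne_zero.2 (Finsupp.mem_support_iff.1 hu)
    have h := congrArg (coeff (a - Finsupp.single u 1)) (LinearMap.mem_ker.1 h0)
    rw [coeff_pd, tsub_add_cancel_of_le hle, coeff_zero] at h
    rcases mul_eq_zero.1 h with h | h
    · exact ha h
    · exact absurd h (by positivity)
  · rintro _ ⟨p, hp, rfl⟩
    exact pd_mem_annStress_star u hp

end Dimensions

/-! ### Betti numbers from annihilated polynomials -/

section Betti

variable {V : Type*} [Fintype V] [LinearOrder V]

/-- The Betti numbers are bounded by dimensions of spaces of annihilated polynomials. -/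
theorem redBetti_add_finrank_le {Δ : SimplComplex V} {m : ℕ} {y : V → Fin (m + 2) → ℝ}
    (hy : ∀ τ ∈ Δ.faces, τ.card ≤ m + 1 →
      LinearIndepOn ℝ (fun v (i : Fin (m + 1)) => y v i.succ) τ)
    {A : Set (V → ℝ)} (hA : A = Set.range fun (i : Fin (m + 1)) v => y v i.succ) :
    Δ.redBetti m + Module.finrank ℝ (annStress Δ A (m + 2)) ≤
      Module.finrank ℝ (annStress Δ A (m + 1)) +
        Module.finrank ℝ (annStress Δ (insert (fun v => y v 0) A) (m + 2)) := by
  subst hA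
  set A := Set.range fun (i : Fin (m + 1)) v => y v i.succ with hA
  set D := detChain fun v (i : Fin (m + 1)) => y v i.succ with hD
  have h1 := finrank_map_linDiff Δ A (m + 2) fun v => y v 0
  have h2 := Submodule.finrank_quotient_add_finrank ((Δ.boundaries m).submoduleOf (Δ.cycles m))
  have h3 : Module.finrank ℝ (Δ.cycles m) ≤ Module.finrank ℝ (annStress Δ A (m + 1)) := by
    have : Δ.cycles m ≤ (annStress Δ A (m + 1)).map D := by
      intro z hz
      obtain ⟨s, hs, hsz⟩ := exists_detChain_eq hy hz
      exact ⟨s, hs, hsz⟩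
    exact (Submodule.finrank_mono this).trans (Submodule.finrank_map_le _ _)
  -- The image of the further form goes injectively into the boundaries under `detChain`.
  have h4 : Module.finrank ℝ ((annStress Δ A (m + 2)).map (linDiff fun v => y v 0)) ≤
      Module.finrank ℝ ((Δ.boundaries m).submoduleOf (Δ.cycles m)) := by
    set P := (annStress Δ A (m + 2)).map (linDiff fun v => y v 0) with hP
    have hPle : P ≤ annStress Δ A (m + 1) := map_linDiff_le _ _ _ _
    have : FiniteDimensional ℝ P := Submodule.finiteDimensional_of_le hPle
    have h5 := finrank_map_add_finrank_inf_ker D P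
    have h6 : P ⊓ LinearMap.ker D = ⊥ := by
      rw [Submodule.eq_bot_iff]
      rintro p ⟨hp, h0⟩
      exact eq_zero_of_detChain_eq_zero hy (hPle hp) h0
    rw [h6, finrank_bot, add_zero] at h5
    rw [← h5, ← Submodule.finrank_map_subtype_eq (Δ.cycles m)]
    refine Submodule.finrank_mono ?_
    rintro _ ⟨_, ⟨p, hp, rfl⟩, rfl⟩
    refine ⟨⟨_, detChain_mem_cycles (linDiff_mem_annStress _ hp)⟩, ?_, rfl⟩
    show _ ∈ Δ.boundaries m
    refine ⟨detChain y p, ?_, ?_⟩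
    · have := detChain_mem_chains y (mem_annStress.1 hp).1
      have h7 : ((m + 2 : ℕ) : ℤ) - 1 = m + 1 := by push_cast; ring
      rwa [h7] at this
    · exact boundary_detChain_eq_detChain_linDiff fun i => (mem_annStress.1 hp).2.2 _ ⟨i, rfl⟩
  have h8 : Δ.redBetti m = Module.finrank ℝ (Δ.cycles m ⧸
    (Δ.boundaries m).submoduleOf (Δ.cycles m)) := rfl
  omega

end Betti

/-! ### Telescoping inequalities -/

section Telescoping

theorem sum_Ico_add_le_of_le {k n : ℕ} (hkn : k ≤ n) {p q s : ℕ → ℕ}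
    (h : ∀ r, k ≤ r → r < n → p r + s r ≤ q r + s (r + 1)) :
    ∑ r ∈ Finset.Ico k n, p r + s k ≤ ∑ r ∈ Finset.Ico k n, q r + s n := by
  induction n, hkn using Nat.le_induction with
  | base => simp
  | succ n hkn ih =>
    have h1 := ih fun r hr hrn => h r hr (by omega)
    have h2 := h n hkn (by omega)
    rw [Finset.sum_Ico_succ_top hkn, Finset.sum_Ico_succ_top hkn]
    omega

theorem sum_Ico_add_eq_of_eq {k n : ℕ} (hkn : k ≤ n) {s t : ℕ → ℕ}
    (h : ∀ r, k ≤ r → r < n → t r = s r + t (r + 1)) :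
    ∑ r ∈ Finset.Ico k n, s r + t n = t k := by
  induction n, hkn using Nat.le_induction with
  | base => simp
  | succ n hkn ih =>
    have h1 := ih fun r hr hrn => h r hr (by omega)
    have h2 := h n hkn (by omega)
    rw [Finset.sum_Ico_succ_top hkn]
    omega

theorem le_sum_Ico_add_of_le {k n : ℕ} (hkn : k ≤ n) {s t : ℕ → ℕ}
    (h : ∀ r, k ≤ r → r < n → t r ≤ s r + t (r + 1)) :
    t k ≤ ∑ r ∈ Finset.Ico k n, s r + t n := by
  induction n, hkn using Nat.le_induction with
  | base => simp
  | succ n hkn ih =>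
    have h1 := ih fun r hr hrn => h r hr (by omega)
    have h2 := h n hkn (by omega)
    rw [Finset.sum_Ico_succ_top hkn]
    omega

end Telescoping

/-! ### Initial segments of the sequence of forms -/

section InitialForms

/-- The indices smaller than `r`. -/
def initialIndices (n r : ℕ) : Finset (Fin n) := Finset.univ.filter fun i => (i : ℕ) < r

theorem mem_initialIndices {n r : ℕ} {i : Fin n} : i ∈ initialIndices n r ↔ (i : ℕ) < r := by
  simp [initialIndices]

theorem initialIndices_self (n : ℕ) : initialIndices n n = Finset.univ := by
  ext i; simp [mem_initialIndices]

theorem initialIndices_succ {n r : ℕ} (hr : r < n) :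
    initialIndices n (r + 1) = insert ⟨r, hr⟩ (initialIndices n r) := by
  ext i
  rw [Finset.mem_insert, mem_initialIndices, mem_initialIndices, Fin.ext_iff]
  simp only
  omega

theorem card_initialIndices {n r : ℕ} (hr : r ≤ n) : (initialIndices n r).card = r := by
  induction r with
  | zero => simp [initialIndices]
  | succ r ih =>
    rw [initialIndices_succ hr, Finset.card_insert_of_notMem (by simp [mem_initialIndices]),
      ih (by omega)]

theorem image_initialIndices_succ {β : Type*} {n r : ℕ} (F : Fin n → β) (hr : r < n) :
    F '' (initialIndices n (r + 1) : Set (Fin n)) =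
      insert (F ⟨r, hr⟩) (F '' (initialIndices n r : Set (Fin n))) := by
  rw [initialIndices_succ hr, Finset.coe_insert, Set.image_insert_eq]

end InitialForms

/-! ### The configuration with ω as an extra coordinate -/

section Points

variable {V : Type*}

theorem IsProper.linearIndepOn {d : ℕ} {Δ : SimplComplex V} {x : V → Fin d → ℝ}
    (h : IsProper Δ x) {σ : Finset V} (hσ : σ ∈ Δ.faces) (hd : σ.card ≤ d) :
    LinearIndepOn ℝ x (σ : Set V) := by
  refine linearIndependent_iff_card_eq_finrank_span.2 ?_
  have := h σ hσ hd
  rw [Set.image_eq_range] at this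
  rw [Set.finrank, this]
  simp

/-- The points with a further coordinate, indexed by `none`. -/
def liftPoints {d : ℕ} (x : V → Fin d → ℝ) (ω : V → ℝ) : V → Option (Fin d) → ℝ :=
  fun v t => t.elim (ω v) (x v)

/-- Projection along the extra point recovers `x`. The extra point makes uniformity hold also after
the ω-coordinate is eliminated. -/
theorem linearIndepOn_optionPoints {d : ℕ} {x : V → Fin d → ℝ} (ω : V → ℝ) {σ : Finset V}
    [DecidableEq V] (h : LinearIndepOn ℝ x (σ : Set V)) :
    LinearIndepOn ℝ (optionPoints (liftPoints x ω) (Pi.single none 1))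
      (insert none (σ.map Function.Embedding.some) : Finset (Option V)) := by
  rw [linearIndepOn_finset_iff]
  intro g hg
  have hnot : none ∉ σ.map Function.Embedding.some := by simp
  rw [Finset.sum_insert hnot, Finset.sum_map] at hg
  have h1 : ∀ v ∈ σ, g (some v) = 0 := by
    refine linearIndepOn_finset_iff.1 h (fun v => g (some v)) (funext fun i => ?_)
    have := congrFun hg (some i)
    simpa [optionPoints, liftPoints] using this
  have h2 : g none = 0 := by
    have := congrFun hg none
    rw [Finset.sum_eq_zero] at this
    · simpa [optionPoints] using this
    · intro v hv
      have : g (Function.Embedding.some v) = 0 := h1 v hv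
      rw [this, zero_smul]
  intro t ht
  rcases Finset.mem_insert.1 ht with rfl | ht
  · exact h2
  · obtain ⟨v, hv, rfl⟩ := Finset.mem_map.1 ht
    exact h1 v hv

variable {d : ℕ} {Δ : SimplComplex V} {x : V → Fin d → ℝ} {ω : V → ℝ} {ι : Type*}
  {c : ι → Option (Fin d) → ℝ}

theorem pairing_liftPoints_single (x : V → Fin d → ℝ) (ω : V → ℝ) (t : Option (Fin d)) :
    pairing (liftPoints x ω) (Pi.single t 1) = fun v => liftPoints x ω v t := by
  funext v
  simp [pairing, Pi.single_apply]

theorem pairing_optionPoints_none (y : V → Option (Fin d) → ℝ) (b : Option (Fin d) → ℝ) :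
    pairing (optionPoints y (Pi.single none 1)) b none = b none := by
  simp [pairing, optionPoints, Pi.single_apply]

/-- Uniformity of the forms given by generic covectors. -/
theorem isUniform_pairing [Fintype ι] (hx : IsProper Δ x)
    (hc : IsUniform (indepComplex (optionPoints (liftPoints x ω) (Pi.single none 1)))
      (fun i => pairing (optionPoints (liftPoints x ω) (Pi.single none 1)) (c i)) Finset.univ)
    {K : Finset ι} (hK : K.card ≤ d) :
    IsUniform Δ (fun i => pairing (liftPoints x ω) (c i)) K := by
  classical
  refine (hc.mono (Finset.subset_univ K)).comap Function.Embedding.some fun σ hσ hcard => ?_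
  exact (linearIndepOn_optionPoints ω (hx.linearIndepOn hσ (hcard.trans hK))).mono (by simp)

theorem none_mem_vertices (y : V → Option (Fin d) → ℝ) :
    none ∈ (indepComplex (optionPoints y (Pi.single none 1))).vertices := by
  show LinearIndepOn ℝ _ _
  rw [Finset.coe_singleton, linearIndepOn_singleton_iff]
  intro h
  have := congrFun h none
  simp [optionPoints] at this

theorem covector_none_ne_zero [Fintype ι] {y : V → Option (Fin d) → ℝ}
    (hc : IsUniform (indepComplex (optionPoints y (Pi.single none 1)))
      (fun i => pairing (optionPoints y (Pi.single none 1)) (c i)) Finset.univ) (i : ι) :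
    c i none ≠ 0 := by
  have := hc.ne_zero (Finset.mem_univ i) (none_mem_vertices y)
  rwa [pairing_optionPoints_none] at this

/-- Uniformity after eliminating one covector at the extra point. -/
theorem isUniform_pairing_sub [Fintype ι] [DecidableEq ι] (hx : IsProper Δ x)
    (hc : IsUniform (indepComplex (optionPoints (liftPoints x ω) (Pi.single none 1)))
      (fun i => pairing (optionPoints (liftPoints x ω) (Pi.single none 1)) (c i)) Finset.univ)
    (hcard : Fintype.card ι = d + 1) (e : ι) :
    IsUniform Δ (fun i => pairing (liftPoints x ω) (c i - (c i none / c e none) • c e))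
      (Finset.univ.erase e) := by
  classical
  -- A form takes its ω-coefficient as value at the extra point, so elimination there leaves
  -- combinations of the coordinates alone.
  have h1 := isUniform_eliminate hc (Finset.mem_univ e) (none_mem_vertices _)
  have hKd : (Finset.univ.erase e).card = d := by
    rw [Finset.card_erase_of_mem (Finset.mem_univ e), Finset.card_univ, hcard]; rfl
  have h2 := h1.comap (Δ := Δ) Function.Embedding.some fun σ hσ hcard => ?_
  · convert h2 using 3 with i v
    rw [← pairingHom_apply, map_sub, map_smul]
    simp only [eliminate, Pi.sub_apply, Pi.smul_apply, pairingHom_apply, pairing_optionPoints_none]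
    rfl
  · rw [SimplComplex.mem_link_singleton]
    exact ⟨by simp, linearIndepOn_optionPoints ω (hx.linearIndepOn hσ (hcard.trans hKd.le))⟩

end Points

/-! ### The bound for induced subcomplexes -/

section BettiBound

theorem SimplComplex.induced_univ {V : Type*} [Fintype V] (Δ : SimplComplex V) :
    Δ.induced Finset.univ = Δ := by
  ext σ; simp [SimplComplex.induced]

theorem SimplComplex.star_faces_mono {V : Type*} {X Y : SimplComplex V} (h : X.faces ⊆ Y.faces)
    (σ : Finset V) : (X.star σ).faces ⊆ (Y.star σ).faces := by
  rintro τ ⟨τ', h1, h2⟩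
  exact ⟨τ', h h1, h2⟩

variable {V : Type*} [Fintype V]

theorem stressCokerDim_add_finrank_ge {d : ℕ} (Δ : SimplComplex V) (x : V → Fin d → ℝ)
    (ω : V → ℝ) (k : ℕ) :
    Module.finrank ℝ (annStress Δ (Set.range fun i v => x v i) k) ≤
      stressCokerDim Δ x ω k +
        Module.finrank ℝ (annStress Δ (Set.range fun i v => x v i) (k + 1)) := by
  rw [← stress_eq_annStress, ← stress_eq_annStress]
  have : FiniteDimensional ℝ (stress Δ x (k + 1)) := by
    rw [stress_eq_annStress]; infer_instance
  have : FiniteDimensional ℝ (stress Δ x k) := by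
    rw [stress_eq_annStress]; infer_instance
  have h1 := Submodule.finrank_quotient_add_finrank (LinearMap.range (stressMap Δ x ω k))
  have h2 := LinearMap.finrank_range_le (stressMap Δ x ω k)
  rw [stressCokerDim]
  omega

theorem eq_zero_of_stressInjective {d : ℕ} {Δ : SimplComplex V} {x : V → Fin d → ℝ}
    {ω : V → ℝ} {k : ℕ} (h : StressInjective Δ x ω k) {p : MvPolynomial V ℝ}
    (hp : p ∈ annStress Δ (insert ω (Set.range fun i v => x v i)) k) : p = 0 := by
  rw [← annStress_inf_ker, ← stress_eq_annStress] at hp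
  exact h hp.1 (Submodule.zero_mem _) (by rw [LinearMap.mem_ker.1 hp.2, map_zero])

omit [Fintype V] in
/-- If `c` spans, then so do the forms given by `c`. -/
theorem insert_range_subset_span_pairing {d : ℕ} (x : V → Fin d → ℝ) (ω : V → ℝ) {ι : Type*}
    {c : ι → Option (Fin d) → ℝ} (hc : Submodule.span ℝ (Set.range c) = ⊤) :
    insert ω (Set.range fun i v => x v i) ⊆
      (Submodule.span ℝ (Set.range fun i => pairing (liftPoints x ω) (c i)) : Set (V → ℝ)) := by
  have h : ∀ t, (fun v => liftPoints x ω v t) ∈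
      Submodule.span ℝ (Set.range fun i => pairing (liftPoints x ω) (c i)) := by
    intro t
    rw [← pairing_liftPoints_single]
    have := pairing_mem_span (y := liftPoints x ω) (b := Pi.single t 1) (B := Set.range c)
      (by rw [hc]; trivial)
    rwa [← Set.range_comp] at this
  refine Set.insert_subset (h none) ?_
  rintro _ ⟨i, rfl⟩
  exact h (some i)

/-- The comparison of the cokernel for generic covectors with the given one. -/
theorem finrank_annStress_generic_le {d : ℕ} {Δ : SimplComplex V} [LinearOrder V]
    {x : V → Fin (d + 1) → ℝ} {ω : V → ℝ} (hx : IsProper Δ x)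
    {c : Fin (d + 2) → Option (Fin (d + 1)) → ℝ}
    (hc : IsUniform (indepComplex (optionPoints (liftPoints x ω) (Pi.single none 1)))
      (fun i => pairing (optionPoints (liftPoints x ω) (Pi.single none 1)) (c i)) Finset.univ)
    (hspan : Submodule.span ℝ (Set.range c) = ⊤) {m : ℕ}
    (hH : ∀ σ ∈ Δ.faces, σ.card + (m + 1) ≤ d → Subsingleton ((Δ.link σ).redHomology m)) :
    Module.finrank ℝ (annStress Δ ((fun i => pairing (liftPoints x ω) (c i)) ''
        (initialIndices (d + 2) (d + 1) : Set (Fin (d + 2)))) (m + 1)) +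
      Module.finrank ℝ (annStress Δ (Set.range fun i v => x v i) (m + 2)) ≤
    Module.finrank ℝ (annStress Δ (Set.range fun i v => x v i) (m + 1)) +
      Module.finrank ℝ (annStress Δ ((fun i => pairing (liftPoints x ω) (c i)) ''
        (initialIndices (d + 2) (d + 1) : Set (Fin (d + 2)))) (m + 2)) := by
  set y := liftPoints x ω with hy
  set e : Fin (d + 2) := ⟨d, by omega⟩ with he
  -- All ω-components are cleared with the help of `c e`. Then A together with h spans the first d +
  -- 1 generic forms, A together with g spans the coordinate forms, and the two sides differ by one
  -- exchange.
  set c' : Fin (d + 2) → Option (Fin (d + 1)) → ℝ := fun i => c i - (c i none / c e none) • c e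
    with hc'
  have hne := covector_none_ne_zero hc e
  have hc'0 : ∀ i, c' i none = 0 := fun i => by simp [hc', hne]
  have hc'e : c' e = 0 := by simp [hc', hne]
  set I := initialIndices (d + 2) d with hI
  set A := (fun i => pairing y (c' i)) '' (I : Set (Fin (d + 2))) with hA
  set g := pairing y (c' (Fin.last (d + 1))) with hg
  set h := pairing y (c e) with hh
  have hins : insert (Fin.last (d + 1)) I = Finset.univ.erase e := by
    ext i
    simp only [Finset.mem_insert, hI, mem_initialIndices, Finset.mem_erase, Finset.mem_univ,
      and_true, Fin.ext_iff, he, Fin.val_last, ne_eq]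
    omega
  have hu : IsUniform Δ (fun i => pairing y (c' i)) (insert (Fin.last (d + 1)) I) := by
    rw [hins]
    exact isUniform_pairing_sub hx hc (by simp) e
  have hex := finrank_annStress_exchange (Δ := Δ) (A := A) (m := m + 1) (g := g) (h := h)
    fun s hs => exists_linDiff_eq_of_isUniform (a := fun i => pairing y (c' i)) rfl
      (by simp [hI, mem_initialIndices]) hu
      (fun σ hσ hcard => hH σ hσ (by rwa [hI, card_initialIndices (by omega)] at hcard)) hs
  have h1 : ∀ j, annStress Δ ((fun i => pairing y (c i)) ''
      (initialIndices (d + 2) (d + 1) : Set (Fin (d + 2)))) j = annStress Δ (insert h A) j := by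
    intro j
    rw [image_initialIndices_succ _ (by omega : d < d + 2)]
    refine annStress_congr_span ?_ ?_ j
    · refine Set.insert_subset (Submodule.subset_span (Set.mem_insert _ _)) ?_
      rintro _ ⟨i, hi, rfl⟩
      have : pairing y (c i) = pairing y (c' i) + (c i none / c e none) • h := by
        rw [hh, ← pairingHom_apply, ← pairingHom_apply, ← pairingHom_apply, hc', map_sub, map_smul]
        simp
      simp only [this]
      exact Submodule.add_mem _ (Submodule.subset_span (Set.mem_insert_of_mem _ ⟨i, hi, rfl⟩))
        (Submodule.smul_mem _ _ (Submodule.subset_span (Set.mem_insert _ _)))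
    · refine Set.insert_subset (Submodule.subset_span (Set.mem_insert _ _)) ?_
      rintro _ ⟨i, hi, rfl⟩
      have : pairing y (c' i) = pairing y (c i) - (c i none / c e none) • h := by
        rw [hh, ← pairingHom_apply, ← pairingHom_apply, ← pairingHom_apply, hc', map_sub, map_smul]
      simp only [this]
      exact Submodule.sub_mem _ (Submodule.subset_span (Set.mem_insert_of_mem _ ⟨i, hi, rfl⟩))
        (Submodule.smul_mem _ _ (Submodule.subset_span (Set.mem_insert _ _)))
  have himage : insert g A = pairing y '' (c' '' (Finset.univ.erase e : Finset (Fin (d + 2)))) := by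
    rw [← hins, Finset.coe_insert, Set.image_insert_eq, Set.image_insert_eq, Set.image_image]
  have h2 : ∀ j, annStress Δ (Set.range fun i v => x v i) j = annStress Δ (insert g A) j := by
    intro j
    refine annStress_congr_span ?_ ?_ j
    · rintro _ ⟨i, rfl⟩
      have h3 : (fun v => x v i) = pairing y (Pi.single (some i) 1) :=
        (pairing_liftPoints_single x ω (some i)).symm
      simp only [h3, himage]
      refine pairing_mem_span ?_
      have h4 : (Pi.single (some i) 1 : Option (Fin (d + 1)) → ℝ) ∈
          Submodule.span ℝ (Set.range c) := by rw [hspan]; trivial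
      obtain ⟨β, hβ⟩ := (Submodule.mem_span_range_iff_exists_fun ℝ).1 h4
      -- The total multiple of `c e` that is subtracted is proportional to the ω-component of a
      -- coordinate vector, which is zero.
      have h5 : ∑ r, β r • c' r = Pi.single (some i) 1 := by
        have h6 := congrFun hβ none
        simp only [Finset.sum_apply, Pi.smul_apply, smul_eq_mul] at h6
        rw [Pi.single_eq_of_ne (by simp)] at h6
        simp only [hc', smul_sub, Finset.sum_sub_distrib, hβ, smul_smul, ← Finset.sum_smul,
          mul_div_assoc', ← Finset.sum_div, h6]
        simp
      rw [← h5]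
      refine Submodule.sum_mem _ fun r _ => Submodule.smul_mem _ _ ?_
      by_cases hr : r = e
      · rw [hr, hc'e]; exact Submodule.zero_mem _
      · exact Submodule.subset_span ⟨r, by simpa using hr, rfl⟩
    · rw [himage]
      rintro _ ⟨_, ⟨r, -, rfl⟩, rfl⟩
      have h3 : pairing y (c' r) = ∑ i, c' r (some i) • fun v => x v i := by
        funext v
        simp [pairing, Fintype.sum_option, hc'0, hy, liftPoints]
      rw [h3]
      exact Submodule.sum_mem _ fun i _ => Submodule.smul_mem _ _
        (Submodule.subset_span ⟨i, rfl⟩)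
  rw [h1, h1, h2, h2]
  exact hex

/-- The comparison of stars and links for generic covectors. -/
theorem finrank_link_le_finrank_star [DecidableEq V] {η : Type*} [Fintype η] {n : ℕ}
    {y : V → η → ℝ} {c : Fin (n + 1) → η → ℝ} {k : ℕ}
    (hmin : ∀ (Γ : SimplComplex V) (I : Finset (Fin (n + 1))) (c' : Fin (n + 1) → η → ℝ),
      Module.finrank ℝ (annStress Γ ((fun i => pairing y (c i)) '' (I : Set (Fin (n + 1)))) k) ≤
      Module.finrank ℝ (annStress Γ ((fun i => pairing y (c' i)) '' (I : Set (Fin (n + 1)))) k))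
    (Y : SimplComplex V) {u : V} (hu : pairing y (c 0) u ≠ 0) (r : ℕ) :
    Module.finrank ℝ (annStress (Y.link {u})
      ((fun i => pairing y (c i)) '' (initialIndices (n + 1) r : Set (Fin (n + 1)))) k) ≤
    Module.finrank ℝ (annStress (Y.star {u})
      ((fun i => pairing y (c i)) '' (initialIndices (n + 1) (r + 1) : Set (Fin (n + 1)))) k) := by
  have h0 : (0 : Fin (n + 1)) ∈ initialIndices (n + 1) (r + 1) := by simp [mem_initialIndices]
  rw [finrank_annStress_star (θ := pairing y (c 0)) (Set.mem_image_of_mem (fun i => pairing y (c i)) (Finset.mem_coe.2 h0)) hu]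
  -- The reduced forms are again given by covectors, shifted by one index because the eliminated
  -- form itself becomes zero. They are one competitor in the minimality of `c`.
  set c' : Fin (n + 1) → η → ℝ := fun j => if h : (j : ℕ) + 1 < n + 1 then
    c ⟨j + 1, h⟩ - (pairing y (c ⟨j + 1, h⟩) u / pairing y (c 0) u) • c 0 else 0 with hc'
  refine (hmin _ _ c').trans (Submodule.finrank_mono (annStress_le_of_subset_span k ?_))
  rintro _ ⟨_, ⟨i, hi, rfl⟩, rfl⟩
  rw [Finset.mem_coe, mem_initialIndices] at hi
  rcases i with ⟨i, hin⟩
  rcases i with _ | i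
  · have : eliminate (pairing y (c 0)) u (pairing y (c ⟨0, hin⟩)) = 0 := by
      have h1 : (⟨0, hin⟩ : Fin (n + 1)) = 0 := rfl
      simp [h1, eliminate, hu]
    simp only [this]
    exact Submodule.zero_mem _
  · refine Submodule.subset_span ⟨⟨i, by omega⟩, ?_, ?_⟩
    · rw [Finset.mem_coe, mem_initialIndices]
      simp only at hi ⊢
      omega
    · simp only [hc', dif_pos hin, eliminate]
      rw [← pairingHom_apply, map_sub, map_smul]
      rfl

theorem redBetti_induced_le [LinearOrder V] {d m : ℕ} (hmd : m ≤ d) {Δ : SimplComplex V}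
    {x : V → Fin (d + 1) → ℝ} (hx : IsProper Δ x) {ω : V → ℝ}
    (hH : ∀ σ ∈ Δ.faces, σ.card + (m + 1) ≤ d → Subsingleton ((Δ.link σ).redHomology m))
    (hweak : IsWeaklyToricChordal Δ x ω (m + 1)) (W : Finset V) :
    (Δ.induced W).redBetti m ≤ stressCokerDim Δ x ω (m + 1) := by
  set y := liftPoints x ω with hy
  obtain ⟨c, hc, hspan, hmin⟩ := exists_generic_covectors (ι := Fin (d + 2)) (by simp) y
    (Pi.single none 1) (m + 1)
  set F : Fin (d + 2) → V → ℝ := fun i => pairing y (c i) with hF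
  set s : SimplComplex V → ℕ → ℕ := fun X r => Module.finrank ℝ
    (annStress X (F '' (initialIndices (d + 2) r : Set (Fin (d + 2)))) (m + 1)) with hs
  set t : SimplComplex V → ℕ → ℕ := fun X r => Module.finrank ℝ
    (annStress X (F '' (initialIndices (d + 2) r : Set (Fin (d + 2)))) (m + 2)) with ht
  have hunif : ∀ r ≤ d + 1, IsUniform Δ F (initialIndices (d + 2) r) := fun r hr =>
    isUniform_pairing hx hc (by rw [card_initialIndices (by omega)]; exact hr)
  -- All d + 2 forms together span the coordinates and ω, so this is weak chordality restricted to a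
  -- smaller star.
  have hstar0 : ∀ X : SimplComplex V, X.faces ⊆ Δ.faces → ∀ u ∈ Δ.vertices,
      annStress (X.star {u}) (F '' (initialIndices (d + 2) (d + 2) : Set (Fin (d + 2)))) (m + 1) =
        ⊥ := by
    intro X hX u hu
    rw [Submodule.eq_bot_iff]
    intro p hp
    refine eq_zero_of_stressInjective (hweak u hu) ?_
    have hp := annStress_mono (SimplComplex.star_faces_mono hX {u}) subset_rfl _ hp
    refine annStress_le_of_subset_span _ ?_ hp
    rw [initialIndices_self, Finset.coe_univ, Set.image_univ]
    exact insert_range_subset_span_pairing x ω hspan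
  -- The partial derivatives lie on vertex stars and have degree m + 1, so they vanish by weak
  -- chordality.
  have ht0 : t (Δ.induced W) (d + 2) = 0 := by
    have : annStress (Δ.induced W)
        (F '' (initialIndices (d + 2) (d + 2) : Set (Fin (d + 2)))) (m + 2) = ⊥ := by
      rw [Submodule.eq_bot_iff]
      intro p hp
      refine eq_zero_of_pd_eq_zero (m := m + 1) (mem_annStress.1 hp).2.1 fun u => ?_
      have h1 := pd_mem_annStress_star u hp
      by_cases hu : u ∈ Δ.vertices
      · rw [hstar0 _ (fun σ (hσ : σ ∈ (Δ.induced W).faces) => hσ.1) u hu] at h1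
        exact h1
      · refine eq_zero_of_faces_eq_empty (star_singleton_faces_eq_empty fun h => hu ?_)
          (mem_annStress.1 h1).1
        exact (show {u} ∈ (Δ.induced W).faces from h).1
    rw [ht]
    simp only
    rw [this, finrank_bot]
  -- Monotonicity of ∑ s(r) - t(m + 1) under adding vertices, written without subtraction.
  have hstep : ∀ S : Finset V,
      ∑ r ∈ Finset.Ico (m + 1) (d + 2), s (Δ.induced W) r + t (Δ.induced (W ∪ S)) (m + 1) ≤
      ∑ r ∈ Finset.Ico (m + 1) (d + 2), s (Δ.induced (W ∪ S)) r + t (Δ.induced W) (m + 1) := by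
    intro S
    induction S using Finset.induction_on with
    | empty => simp
    | insert u S _ ih =>
      rw [Finset.union_insert]
      set T := W ∪ S with hT
      by_cases huT : u ∈ T
      · rwa [Finset.insert_eq_of_mem huT]
      by_cases hu : u ∈ Δ.vertices
      · have hXY : ∀ σ, σ ∈ (Δ.induced T).faces ↔
            σ ∈ (Δ.induced (insert u T)).faces ∧ u ∉ σ := by
          intro σ
          constructor
          · rintro ⟨h1, h2⟩
            exact ⟨⟨h1, h2.trans (Finset.subset_insert _ _)⟩, fun h => huT (h2 h)⟩
          · rintro ⟨⟨h1, h2⟩, h3⟩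
            exact ⟨h1, (Finset.subset_insert_iff_of_notMem h3).1 h2⟩
        have hF0 : pairing y (c 0) u ≠ 0 :=
          (hunif 1 (by omega)).ne_zero (j := 0) (by simp [mem_initialIndices]) hu
        -- For each r the loss on the link is at most the star term for r + 1. After telescoping
        -- only the star term at m + 1 remains, which pays for the growth of t.
        have h1 := sum_Ico_add_le_of_le (k := m + 1) (n := d + 2) (by omega)
          (p := s (Δ.induced T)) (q := s (Δ.induced (insert u T)))
          (s := s ((Δ.induced (insert u T)).star {u})) fun r _ hrd => by
            have h2 := finrank_add_finrank_star_le hXY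
              (F '' (initialIndices (d + 2) r : Set (Fin (d + 2)))) (m + 1)
            have h3 := finrank_link_le_finrank_star hmin (Δ.induced (insert u T)) hF0 r
            exact h2.trans (Nat.add_le_add_left h3 _)
        have h4 := finrank_annStress_succ_le_add_star hXY
          (F '' (initialIndices (d + 2) (m + 1) : Set (Fin (d + 2)))) (m + 1)
        have h5 : s ((Δ.induced (insert u T)).star {u}) (d + 2) = 0 := by
          simp only [hs]
          rw [hstar0 _ (fun σ (hσ : σ ∈ (Δ.induced (insert u T)).faces) => hσ.1) u hu, finrank_bot]
        change t (Δ.induced (insert u T)) (m + 1) ≤ t (Δ.induced T) (m + 1) +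
          s ((Δ.induced (insert u T)).star {u}) (m + 1) at h4
        omega
      · have : Δ.induced (insert u T) = Δ.induced T := by
          ext σ
          constructor
          · rintro ⟨h1, h2⟩
            refine ⟨h1, (Finset.subset_insert_iff_of_notMem fun h => hu ?_).1 h2⟩
            exact Δ.down_closed _ h1 _ (by simpa using h)
          · rintro ⟨h1, h2⟩
            exact ⟨h1, h2.trans (Finset.subset_insert _ _)⟩
        rwa [this]
  have hΔs : ∑ r ∈ Finset.Ico (m + 1) (d + 1), s Δ r + t Δ (d + 1) = t Δ (m + 1) := by
    refine sum_Ico_add_eq_of_eq (by omega) fun r hr hrd => ?_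
    simp only [hs, ht]
    rw [image_initialIndices_succ F (by omega : r < d + 2)]
    refine finrank_annStress_succ_eq fun p hp => ?_
    refine exists_linDiff_eq_of_isUniform (a := F) rfl (by simp [mem_initialIndices]) ?_ ?_ hp
    · rw [← initialIndices_succ]
      exact hunif _ (by omega)
    · intro σ hσ hcard
      rw [card_initialIndices (by omega)] at hcard
      exact hH σ hσ (by omega)
  have hWs : t (Δ.induced W) (m + 2) ≤
      ∑ r ∈ Finset.Ico (m + 2) (d + 2), s (Δ.induced W) r + t (Δ.induced W) (d + 2) := by
    refine le_sum_Ico_add_of_le (by omega) fun r hr hrd => ?_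
    simp only [hs, ht]
    rw [image_initialIndices_succ F hrd]
    exact finrank_annStress_succ_le _ _ _ _
  have hβ : (Δ.induced W).redBetti m + t (Δ.induced W) (m + 1) ≤
      s (Δ.induced W) (m + 1) + t (Δ.induced W) (m + 2) := by
    simp only [hs, ht]
    rw [image_initialIndices_succ F (by omega : m + 1 < d + 2)]
    set e : Fin (m + 1) → Fin (d + 2) := fun i => ⟨i, by omega⟩ with he
    refine redBetti_add_finrank_le
      -- The further form occupies coordinate 0, the m + 1 annihilating forms follow.
      (y := fun v => (Fin.cons (F ⟨m + 1, by omega⟩ v) fun i => F (e i) v : Fin (m + 2) → ℝ)) ?_ ?_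
    · intro τ hτ hcard
      refine (hunif (m + 1) (by omega)).linearIndepOn (e := e) ?_ ?_ hτ.1 hcard
      · intro i j hij
        simpa [he, Fin.ext_iff] using hij
      · intro i
        rw [mem_initialIndices]
        exact i.2
    · ext b
      simp only [Fin.cons_succ]
      constructor
      · rintro ⟨j, hj, rfl⟩
        rw [Finset.mem_coe, mem_initialIndices] at hj
        exact ⟨⟨j, hj⟩, rfl⟩
      · rintro ⟨i, rfl⟩
        exact ⟨e i, by rw [Finset.mem_coe, mem_initialIndices]; exact i.2, rfl⟩
  have hgen := finrank_annStress_generic_le hx hc hspan hH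
  have hα := stressCokerDim_add_finrank_ge Δ x ω (m + 1)
  rw [show m + 1 + 1 = m + 2 from rfl] at hα
  have hfin := hstep Finset.univ
  rw [Finset.union_eq_right.2 (Finset.subset_univ W), SimplComplex.induced_univ] at hfin
  have hsum1 : ∑ r ∈ Finset.Ico (m + 1) (d + 2), s Δ r =
      ∑ r ∈ Finset.Ico (m + 1) (d + 1), s Δ r + s Δ (d + 1) :=
    Finset.sum_Ico_succ_top (by omega) _
  have hsum2 : ∑ r ∈ Finset.Ico (m + 1) (d + 2), s (Δ.induced W) r =
      s (Δ.induced W) (m + 1) + ∑ r ∈ Finset.Ico (m + 2) (d + 2), s (Δ.induced W) r :=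
    Finset.sum_eq_sum_Ico_succ_bot (by omega) _
  change s Δ (d + 1) + _ ≤ _ + t Δ (d + 1) at hgen
  omega

end BettiBound

/-! ### Resolution chordality, missing faces and degenerate degrees -/

section Chordality

variable {V : Type*} [Fintype V] [LinearOrder V]

/-- The terms over ordered pairs of added vertices are antisymmetric: of the two orders, exactly one
inserts a smaller vertex before a larger one and shifts the sign. -/
theorem boundary_boundary (c : Finset V → ℝ) :
    SimplComplex.boundary (SimplComplex.boundary c) = 0 := by
  funext ρ
  rw [Pi.zero_apply]
  set n : V → ℕ := fun v => (ρ.filter (fun w => w < v)).card with hn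
  set f : V → V → ℝ := fun v w => if v ∉ ρ ∧ w ∉ ρ ∧ v ≠ w then
    (-1 : ℝ) ^ (n v + n w + if v < w then 1 else 0) * c (insert w (insert v ρ)) else 0 with hf
  have h1 : SimplComplex.boundary (SimplComplex.boundary c) ρ = ∑ v, ∑ w, f v w := by
    rw [boundary_apply]
    refine Finset.sum_subset_zero_on_sdiff (Finset.subset_univ _) (fun v hv => ?_) fun v hv => ?_
    · have hv : v ∈ ρ := by simpa using hv
      simp [hf, hv]
    · have hv : v ∉ ρ := by simpa using hv
      rw [boundary_apply, Finset.mul_sum]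
      refine Finset.sum_subset_zero_on_sdiff (Finset.subset_univ _) (fun w hw => ?_)
        fun w hw => ?_
      · have hw : w ∈ insert v ρ := by simpa using hw
        rw [hf]
        simp only
        rw [if_neg]
        rintro ⟨-, h2, h3⟩
        exact (Finset.mem_insert.1 hw).elim (fun h => h3 h.symm) h2
      · have hw : w ∉ insert v ρ := by simpa using hw
        have hwv : v ≠ w := fun h => hw (h ▸ Finset.mem_insert_self _ _)
        have hwρ : w ∉ ρ := fun h => hw (Finset.mem_insert_of_mem h)
        rw [hf]
        simp only
        have hcard : ((insert v ρ).filter (fun t => t < w)).card =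
            n w + if v < w then 1 else 0 := by
          rw [Finset.filter_insert]
          split_ifs with h
          · rw [Finset.card_insert_of_notMem (by simp [hv])]
          · rfl
        rw [if_pos ⟨hv, hwρ, hwv⟩, ← mul_assoc, ← pow_add, hcard, ← add_assoc]
  have h2 : ∀ v w, f w v = -f v w := by
    intro v w
    by_cases h : v ∉ ρ ∧ w ∉ ρ ∧ v ≠ w
    · have h' : w ∉ ρ ∧ v ∉ ρ ∧ w ≠ v := ⟨h.2.1, h.1, h.2.2.symm⟩
      simp only [hf]
      rw [if_pos h, if_pos h', Finset.insert_comm, add_comm (n w)]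
      rcases lt_or_gt_of_ne h.2.2 with h3 | h3
      · rw [if_pos h3, if_neg h3.not_gt]; ring
      · rw [if_neg h3.not_gt, if_pos h3]; ring
    · have h' : ¬ (w ∉ ρ ∧ v ∉ ρ ∧ w ≠ v) := fun h' => h ⟨h'.2.1, h'.1, h'.2.2.symm⟩
      simp only [hf]
      rw [if_neg h, if_neg h', neg_zero]
  have h3 : ∑ v, ∑ w, f v w = -∑ v, ∑ w, f v w := by
    conv_lhs => rw [Finset.sum_comm]
    simp only [← Finset.sum_neg_distrib]
    exact Finset.sum_congr rfl fun v _ => Finset.sum_congr rfl fun w _ => h2 v w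
  rw [h1]
  linarith

/-- If the cycles of all induced subcomplexes are boundaries, then the complex is resolution
chordal and has no missing faces in the corresponding dimension. -/
theorem isResolutionChordal_of_cycles_le {Δ : SimplComplex V} {m : ℕ}
    (h : ∀ W : Finset V, (Δ.induced W).cycles m ≤ (Δ.induced W).boundaries m) :
    Δ.IsResolutionChordal m ∧ ∀ σ : Finset V, Δ.IsMissingFace σ → σ.card ≠ m + 2 := by
  classical
  constructor
  · intro z hz
    -- A filling inside the complex induced on the vertices of z uses no others, and it uses all of
    -- them because every simplex of z is contained in a simplex of the filling.
    set W : Finset V := Finset.univ.filter (· ∈ SimplComplex.chainVertices z) with hW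
    have hWmem : ∀ v, v ∈ W ↔ v ∈ SimplComplex.chainVertices z := fun v => by simp [hW]
    have hzW : z ∈ (Δ.induced W).cycles m :=
      ⟨fun σ hσ => ⟨⟨(hz.1 σ hσ).1, fun v hv => (hWmem v).2 ⟨σ, hσ, hv⟩⟩, (hz.1 σ hσ).2⟩, hz.2⟩
    obtain ⟨c, hc, hcz⟩ := h W hzW
    refine ⟨c, fun σ hσ => ⟨(hc σ hσ).1.1, (hc σ hσ).2⟩, ?_, hcz⟩
    ext v
    constructor
    · rintro ⟨σ, hσ, hv⟩
      exact (hWmem v).1 ((hc σ hσ).1.2 hv)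
    · rintro ⟨σ, hσ, hv⟩
      rw [← hcz, boundary_apply] at hσ
      obtain ⟨w, -, hw⟩ := Finset.exists_ne_zero_of_sum_ne_zero hσ
      exact ⟨_, right_ne_zero_of_mul hw, Finset.mem_insert_of_mem hv⟩
  · rintro σ ⟨-, hσ, hsub⟩ hcard
    -- The boundary of σ is a cycle in the complex induced on σ. The only possible simplex of a
    -- filling is σ, which is not a face, so this boundary would vanish although its coefficients at
    -- facets are ±1.
    set e : Finset V → ℝ := Pi.single σ 1 with he
    set z := SimplComplex.boundary e with hz
    have hsingle : ∀ τ, e τ ≠ 0 → τ = σ := by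
      intro τ hτ
      by_contra hne
      exact hτ (Pi.single_eq_of_ne hne _)
    have hzmem : z ∈ (Δ.induced σ).cycles m := by
      refine ⟨fun τ hτ => ?_, LinearMap.mem_ker.2 (boundary_boundary e)⟩
      rw [hz, boundary_apply] at hτ
      obtain ⟨v, hv, hne⟩ := Finset.exists_ne_zero_of_sum_ne_zero hτ
      have hv : v ∉ τ := by simpa using hv
      have h1 := hsingle _ (right_ne_zero_of_mul hne)
      have h2 : τ ⊂ σ := h1 ▸ Finset.ssubset_insert hv
      refine ⟨⟨hsub τ h2, h2.subset⟩, ?_⟩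
      rw [← h1, Finset.card_insert_of_notMem hv] at hcard
      omega
    obtain ⟨c, hc, hcz⟩ := h σ hzmem
    have hc0 : c = 0 := by
      funext τ
      by_contra hne
      obtain ⟨⟨h1, h2⟩, h3⟩ := hc τ hne
      have : τ = σ := Finset.eq_of_subset_of_card_le h2 (by omega)
      exact hσ (this ▸ h1)
    rw [hc0, map_zero] at hcz
    obtain ⟨v, hv⟩ : σ.Nonempty := Finset.card_pos.1 (by omega)
    have h1 := congrFun hcz (σ.erase v)
    rw [hz, boundary_apply, Finset.sum_eq_single v, Finset.insert_erase hv, he,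
      Pi.single_eq_same, mul_one, Pi.zero_apply] at h1
    · exact pow_ne_zero _ (by norm_num) h1.symm
    · intro w hw hwv
      have hw : w ∉ σ.erase v := by simpa using hw
      have : e (insert w (σ.erase v)) = 0 := by
        by_contra hne
        have h2 := hsingle _ hne
        rw [← h2] at hv
        exact (Finset.mem_insert.1 hv).elim (fun h => hwv h.symm) (fun h => by simp at h)
      rw [this, mul_zero]
    · intro h
      simp at h

theorem cycles_le_boundaries_of_redBetti_eq_zero {Δ : SimplComplex V} {j : ℤ}
    (h : Δ.redBetti j = 0) : Δ.cycles j ≤ Δ.boundaries j := by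
  have h1 : Subsingleton (Δ.redHomology j) := Module.finrank_zero_iff.1 h
  have h2 := Submodule.Quotient.subsingleton_iff.1 h1
  intro z hz
  have h3 : (⟨z, hz⟩ : Δ.cycles j) ∈ (Δ.boundaries j).submoduleOf (Δ.cycles j) := by
    rw [h2]; trivial
  exact h3

omit [LinearOrder V] in
theorem linPoly_eq_zero_iff {c : V → ℝ} : linPoly c = 0 ↔ c = 0 := by
  classical
  constructor
  · intro h
    funext v
    have h1 := linDiff_linPoly (Pi.single v 1) c
    rw [h, map_zero] at h1
    have h2 := C_injective V ℝ (h1.symm.trans (map_zero C).symm)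
    simpa [Pi.single_apply] using h2
  · rintro rfl
    simp [linPoly]

/-- If no nonzero polynomial of degree `m + 1 > d` is annihilated by `d + 1` forms, then there
are no cycles. -/
theorem cycles_eq_bot_of_annStress_eq_bot {d m : ℕ} (hdm : d ≤ m) {Δ : SimplComplex V}
    {x : V → Fin d → ℝ} {ω : V → ℝ}
    (h : ∀ p ∈ annStress Δ (insert ω (Set.range fun i v => x v i)) (m + 1), p = 0)
    {z : Finset V → ℝ} (hz : z ∈ Δ.cycles m) : z = 0 := by
  -- The coordinates padded with copies of ω; since d ≤ m, at least one copy occurs.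
  set y : V → Fin (m + 1) → ℝ := fun v i => if hi : (i : ℕ) < d then x v ⟨i, hi⟩ else ω v with hy
  have hyx : ∀ (i : Fin d), (fun v => y v ⟨i, by omega⟩) = fun v => x v i := by
    intro i; funext v; simp [hy]
  have hyω : (fun v => y v ⟨d, by omega⟩) = ω := by
    funext v; simp [hy]
  have hmem : ∀ p, (∀ i, linDiff (fun v => y v i) p = 0) →
      ∀ a ∈ insert ω (Set.range fun i v => x v i), linDiff a p = 0 := by
    rintro p hp a (rfl | ⟨i, rfl⟩)
    · rw [← hyω]; exact hp _
    · simp only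
      rw [← hyx]; exact hp _
  have hind : ∀ τ ∈ Δ.faces, τ.card ≤ m + 1 → LinearIndepOn ℝ y (τ : Set V) := by
    intro τ hτ _
    rw [linearIndepOn_finset_iff]
    intro g hg v hv
    set c : V → ℝ := fun v => if v ∈ τ then g v else 0 with hc
    -- A linear relation among the points of a face gives a linear form whose power of degree m + 1
    -- is annihilated by all forms, and hence is zero. No properness is needed for independence.
    have hc0 : linPoly c = 0 := by
      refine eq_zero_of_pow_eq_zero (n := m + 1) (h _ (mem_annStress.2
        ⟨mem_faceSupported_of_vars (Δ.down_closed _ hτ _ (vars_linPoly_pow (fun v hv => ?_) _)),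
          isHomogeneous_linPoly_pow _ _, hmem _ fun i => ?_⟩))
      · simp [hc, hv]
      · rw [linDiff_linPoly_pow]
        have : ∑ v, c v * y v i = 0 := by
          have h1 := congrFun hg i
          simp only [Finset.sum_apply, Pi.smul_apply, smul_eq_mul, Pi.zero_apply] at h1
          rw [← h1]
          simp [hc]
        rw [this, mul_zero, zero_smul]
    have := congrFun (linPoly_eq_zero_iff.1 hc0) v
    simpa [hc, hv] using this
  obtain ⟨s, hs, hsz⟩ := exists_detChain_eq hind hz
  have hs := mem_annStress.1 hs
  have hs0 : s = 0 := h s (mem_annStress.2 ⟨hs.1, hs.2.1, hmem s fun i => hs.2.2 _ ⟨i, rfl⟩⟩)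
  rw [← hsz, hs0, map_zero]

omit [LinearOrder V] in
theorem StressInjective.mono {d k : ℕ} {Δ Γ : SimplComplex V} {x : V → Fin d → ℝ} {ω : V → ℝ}
    (h : StressInjective Γ x ω k) (hΔ : Δ.faces ⊆ Γ.faces) : StressInjective Δ x ω k := by
  refine Set.InjOn.mono ?_ h
  rw [stress_eq_annStress, stress_eq_annStress]
  exact annStress_mono hΔ subset_rfl k

omit [LinearOrder V] in
theorem stressCokerDim_eq_zero {d k : ℕ} {Δ : SimplComplex V} {x : V → Fin d → ℝ} {ω : V → ℝ}
    (h : Function.Surjective (stressMap Δ x ω k)) : stressCokerDim Δ x ω k = 0 := by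
  have := Submodule.Quotient.subsingleton_iff.2 (LinearMap.range_eq_top.2 h)
  exact Module.finrank_zero_of_subsingleton

omit [LinearOrder V] in
theorem one_mem_annStress {Δ : SimplComplex V} (h : ∅ ∈ Δ.faces) (A : Set (V → ℝ)) :
    (1 : MvPolynomial V ℝ) ∈ annStress Δ A 0 :=
  mem_annStress.2 ⟨mem_faceSupported_of_vars (by rwa [vars_one]), isHomogeneous_one _ _,
    fun a _ => linDiff_C a 1⟩

omit [LinearOrder V] in
theorem empty_notMem_of_stressInjective {d : ℕ} {Δ : SimplComplex V} {x : V → Fin d → ℝ}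
    {ω : V → ℝ} (h : StressInjective Δ x ω 0) : ∅ ∉ Δ.faces := fun h0 =>
  one_ne_zero (eq_zero_of_stressInjective h (one_mem_annStress h0 _))

/-- Without vertices, ∅ is the only possible face. If it is present, the (-1)-cycles have dimension
at most 1, and the constants already account for a cokernel of positive dimension, as there are no
stresses of degree 1. -/
theorem redBetti_neg_one_le {d : ℕ} {Δ : SimplComplex V} (x : V → Fin d → ℝ) (ω : V → ℝ)
    (h : Δ.vertices = ∅) (W : Finset V) :
    (Δ.induced W).redBetti (-1) ≤ stressCokerDim Δ x ω 0 := by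
  have hcyc : ∀ z ∈ (Δ.induced W).cycles (-1), ∀ σ, z σ ≠ 0 → σ = ∅ ∧ ∅ ∈ Δ.faces := by
    intro z hz σ hσ
    obtain ⟨h1, h2⟩ := hz.1 σ hσ
    have h3 : σ = ∅ := Finset.card_eq_zero.1 (by omega)
    exact ⟨h3, h3 ▸ h1.1⟩
  have hle : (Δ.induced W).redBetti (-1) ≤ Module.finrank ℝ ((Δ.induced W).cycles (-1)) :=
    Submodule.finrank_quotient_le _
  refine hle.trans ?_
  by_cases h0 : ∅ ∈ Δ.faces
  · have h1 : Module.finrank ℝ ((Δ.induced W).cycles (-1)) ≤ 1 := by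
      have hinj : Function.Injective ((LinearMap.proj (R := ℝ) (φ := fun _ : Finset V => ℝ) ∅).comp
          ((Δ.induced W).cycles (-1)).subtype) := by
        rw [injective_iff_map_eq_zero]
        intro z hz
        refine Subtype.ext (funext fun σ => ?_)
        by_contra hσ
        have h1 := (hcyc z z.2 σ hσ).1
        exact hσ (h1 ▸ hz)
      exact (LinearMap.finrank_le_finrank_of_injective hinj).trans (Module.finrank_self ℝ).le
    have h2 := stressCokerDim_add_finrank_ge Δ x ω 0
    have h3 : annStress Δ (Set.range fun i v => x v i) 1 = ⊥ := by
      rw [Submodule.eq_bot_iff]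
      intro p hp
      refine eq_zero_of_pd_eq_zero (m := 0) (mem_annStress.1 hp).2.1 fun v => ?_
      exact eq_zero_of_faces_eq_empty (star_singleton_faces_eq_empty (by simp [h]))
        (mem_annStress.1 (pd_mem_annStress_star v hp)).1
    have h4 : 0 < Module.finrank ℝ (annStress Δ (Set.range fun i v => x v i) 0) := by
      have : Nontrivial (annStress Δ (Set.range fun i v => x v i) 0) :=
        ⟨⟨1, one_mem_annStress h0 _⟩, 0, fun h => one_ne_zero (congrArg Subtype.val h)⟩
      exact Module.finrank_pos
    rw [zero_add, h3, finrank_bot] at h2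
    omega
  · have : (Δ.induced W).cycles (-1) = ⊥ := by
      rw [Submodule.eq_bot_iff]
      intro z hz
      funext σ
      by_contra hσ
      exact h0 (hcyc z hz σ hσ).2
    rw [this, finrank_bot]
    exact Nat.zero_le _

end Chordality

end

theorem mainTheorem7 {V : Type*} [Fintype V] [LinearOrder V] (d k : ℕ)
    (Δ : SimplComplex V) (x : V → Fin d → ℝ) (hproper : IsProper Δ x) (ω : V → ℝ)
    (hlink : ∀ σ ∈ Δ.faces, (σ.card : ℤ) < (d : ℤ) - k →
      Subsingleton ((Δ.link σ).redHomology ((k : ℤ) - 1))) :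
    (k ≤ d → ∀ α : ℕ, stressCokerDim Δ x ω k = α → IsWeaklyToricChordal Δ x ω k →
      ∀ W : Finset V, (W : Set V) ⊆ Δ.vertices →
        (Δ.induced W).redBetti ((k : ℤ) - 1) ≤ α) ∧
    (IsToricChordal Δ x ω k →
      Δ.IsResolutionChordal ((k : ℤ) - 1) ∧
        ∀ σ : Finset V, Δ.IsMissingFace σ → σ.card ≠ k + 1) := by
  -- For k = 0 injectivity excludes nonzero constants. Hence weak chordality forbids vertices, and
  -- toric chordality forbids even the empty face.
  rcases k with _ | m
  · constructor
    · rintro - α rfl hweak W -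
      refine redBetti_neg_one_le x ω (Set.eq_empty_of_forall_notMem fun v hv => ?_) W
      exact empty_notMem_of_stressInjective (hweak v hv) ⟨{v}, hv, by simp, by simp⟩
    · rintro ⟨-, hinj⟩
      have hface : ∀ σ, σ ∉ Δ.faces := fun σ hσ =>
        empty_notMem_of_stressInjective hinj (Δ.down_closed σ hσ _ (Finset.empty_subset _))
      constructor
      · intro z hz
        have : z = 0 := by
          funext σ
          by_contra hσ
          exact hface σ (hz.1 σ hσ).1
        exact ⟨0, Submodule.zero_mem _, by rw [this], by rw [this, map_zero]⟩
      · rintro σ ⟨hσ, -⟩ hcard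
        obtain ⟨v, hv⟩ : σ.Nonempty := Finset.card_pos.1 (by omega)
        exact hface _ (hσ v hv)
  · have hk : ((m + 1 : ℕ) : ℤ) - 1 = m := by push_cast; ring
    rw [hk] at hlink ⊢
    have hmain : m + 1 ≤ d → IsWeaklyToricChordal Δ x ω (m + 1) → ∀ W : Finset V,
        (Δ.induced W).redBetti m ≤ stressCokerDim Δ x ω (m + 1) := by
      intro hd hweak W
      obtain ⟨d, rfl⟩ : ∃ d', d = d' + 1 := ⟨d - 1, by omega⟩
      refine redBetti_induced_le (by omega) hproper (fun σ hσ hcard => hlink σ hσ ?_) hweak W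
      push_cast
      omega
    refine ⟨fun hd α hα hweak W _ => hα ▸ hmain hd hweak W, ?_⟩
    rintro ⟨hsurj, hinj⟩
    refine isResolutionChordal_of_cycles_le fun W => ?_
    by_cases hd : m + 1 ≤ d
    · refine cycles_le_boundaries_of_redBetti_eq_zero (Nat.le_zero.1 ?_)
      rw [← stressCokerDim_eq_zero hsurj]
      exact hmain hd (fun v _ => hinj.mono (star_faces_subset _ _)) W
    -- For k > d part (1) is not available, but injectivity leaves no nonzero cycles to fill.
    · intro z hz
      have hzΔ : z ∈ Δ.cycles m := ⟨fun σ hσ => ⟨(hz.1 σ hσ).1.1, (hz.1 σ hσ).2⟩, hz.2⟩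
      rw [cycles_eq_bot_of_annStress_eq_bot (by omega)
        (fun p hp => eq_zero_of_stressInjective hinj hp) hzΔ]
      exact Submodule.zero_mem _
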